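/- Let $n\ge 1$ be an integer, $s\in(0,1)$, $p>1$ and $\Lambda\ge 1$. There exist constants $\alpha\in(0,1)$ and $C\ge 1$, depending only on $n,s,p,\Lambda$, such that the following holds. Let $\Omega\subset\mathbb R^n$ be a bounded open set. Let $K:\mathbb R^n\times\mathbb R^n\to[0,\infty)$ be measurable with $K(x,y)=K(y,x)$ and $$\frac{1}{\Lambda|x-y|^{n+sp}}\le K(x,y)\le\frac{\Lambda}{|x-y|^{n+sp}}\qquad\text{for a.e. }(x,y)\in\mathbb R^n\times\mathbb R^n .$$ Let $F_0\ge 0$ and let $F:\Omega\times\mathbb R\to\mathbb R$ satisfy $|F(x,t)|\le F_0$ for a.e. $x\in\Omega$ and every $t\in\mathbb R$, and be such that $x\mapsto F(x,v(x))$ is measurable on $\Omega$ for every measurable $v$ (for instance, $F$ is a Carathéodory function, or $F$ is Borel measurable and possibly discontinuous). For measurable $u:\mathbb R^n\to\mathbb R$ set $$\mathcal E(u;\Omega)=\frac1{2p}\iint_{\mathcal C_\Omega}|u(x)-u(y)|^pK(x,y)\,dx\,dy+\int_\Omega F(x,u(x))\,dx,\qquad \mathcal C_\Omega=\mathbb R^{2n}\setminus(\mathbb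 R^n\setminus\Omega)^2 .$$ Denote by $\mathbb W^{s,p}(\Omega)$ the set of measurable $u:\mathbb R^n\to\mathbb R$ with $u|_\Omega\in L^p(\Omega)$ and $\iint_{\mathcal C_\Omega}\frac{|u(x)-u(y)|^p}{|x-y|^{n+sp}}\,dx\,dy<\infty$, and by $L^{p-1}_s(\mathbb R^n)$ the set of measurable $u$ with $\int_{\mathbb R^n}\frac{|u(x)|^{p-1}}{(1+|x|)^{n+sp}}\,dx<\infty$. Let $u\in L^{p-1}_s(\mathbb R^n)\cap\mathbb W^{s,p}(\Omega)$ be a minimizer of $\mathcal E$ in $\Omega$, that is, $\mathcal E(u;\Omega)\le\mathcal E(u+\varphi;\Omega)$ for every measurable $\varphi:\mathbb R^n\to\mathbb R$ whose support $\overline{\{\varphi\ne0\}}$ is contained in $\Omega$. Then, after modification on a null set, $u\in C^\alpha_{\rm loc}(\Omega)$, and $$\|u\|_{L^\infty(B_R(x_0))}+R^\alpha[u]_{C^\alpha(B_R(x_0))}\le C\left(R^{-n/p}\|u\|_{L^p(B_{2R}(x_0))}+\operatorname{Tail}_{s,p}(u;x_0,R)+R^sF_0^{1/p}\right)$$ for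 every $x_0\in\Omega$ and $0<R<\operatorname{dist}(x_0,\partial\Omega)/2$, where $[u]_{C^\alpha(B)}=\sup_{x\ne y\in B}\frac{|u(x)-u(y)|}{|x-y|^\alpha}$ and $$\operatorname{Tail}_{s,p}(u;x_0,R)=\left(R^{sp}\int_{\mathbb R^n\setminus B_R(x_0)}\frac{|u(x)|^{p-1}}{|x-x_0|^{n+sp}}\,dx\right)^{\frac1{p-1}} .$$ -/

import Mathlib

open MeasureTheory Set
open scoped ENNReal

/-- The Euclidean space `ℝⁿ`. Functions on it are called measurable in the sense of Lebesgue,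
that is, `AEMeasurable` with respect to `volume`. -/
abbrev Rn (n : ℕ) : Type := EuclideanSpace ℝ (Fin n)

namespace NonlocalEnergy

/-- `u ∈ L^{p-1}_s(ℝⁿ)`: `u` is measurable and `∫ |u(x)|^{p-1} / (1 + |x|)^{n+sp} dx < ∞`. -/
def MemWeightedL (n : ℕ) (s p : ℝ) (u : Rn n → ℝ) : Prop :=
  AEMeasurable u ∧
    ∫⁻ x, ENNReal.ofReal (|u x| ^ (p - 1) / (1 + ‖x‖) ^ ((n : ℝ) + s * p)) < ∞

/-- `Tail_{s,p}(u; x₀, R) = (R^{sp} ∫_{ℝⁿ ∖ B_R(x₀)} |u(x)|^{p-1} / |x - x₀|^{n+sp} dx)^{1/(p-1)}`,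
as an element of `[0, ∞]`; it is finite for `u ∈ L^{p-1}_s(ℝⁿ)`. -/
noncomputable def tail (n : ℕ) (s p : ℝ) (u : Rn n → ℝ) (x₀ : Rn n) (R : ℝ) : ℝ≥0∞ :=
  (ENNReal.ofReal (R ^ (s * p)) *
    ∫⁻ x in (Metric.ball x₀ R)ᶜ,
      ENNReal.ofReal (|u x| ^ (p - 1) / ‖x - x₀‖ ^ ((n : ℝ) + s * p))) ^ (1 / (p - 1))

/-- `𝒞_Ω = ℝ²ⁿ ∖ (ℝⁿ ∖ Ω)²`. -/
def crossSet {n : ℕ} (Ω : Set (Rn n)) : Set (Rn n × Rn n) :=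
  (Ωᶜ ×ˢ Ωᶜ)ᶜ

/-- `u ∈ 𝕎^{s,p}(Ω)`: `u : ℝⁿ → ℝ` is measurable, `u|_Ω ∈ L^p(Ω)`, and
`∬_{𝒞_Ω} |u(x) - u(y)|^p / |x - y|^{n+sp} dx dy < ∞`. -/
def MemW (n : ℕ) (s p : ℝ) (Ω : Set (Rn n)) (u : Rn n → ℝ) : Prop :=
  AEMeasurable u ∧
  MemLp u (ENNReal.ofReal p) (volume.restrict Ω) ∧
    ∫⁻ z in crossSet Ω,
      ENNReal.ofReal (|u z.1 - u z.2| ^ p / ‖z.1 - z.2‖ ^ ((n : ℝ) + s * p)) < ∞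

/-- The structural assumptions on the interaction kernel `K`. -/
structure IsAdmissibleKernel (n : ℕ) (s p Λ : ℝ) (K : Rn n → Rn n → ℝ) : Prop where
  aemeasurable : AEMeasurable (fun z : Rn n × Rn n => K z.1 z.2)
  nonneg : ∀ x y, 0 ≤ K x y
  symm : ∀ᵐ z : Rn n × Rn n, K z.1 z.2 = K z.2 z.1
  lower : ∀ᵐ z : Rn n × Rn n, 1 / (Λ * ‖z.1 - z.2‖ ^ ((n : ℝ) + s * p)) ≤ K z.1 z.2
  upper : ∀ᵐ z : Rn n × Rn n, K z.1 z.2 ≤ Λ / ‖z.1 - z.2‖ ^ ((n : ℝ) + s * p)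

/-- `x ↦ F(x, v(x))` is measurable on `Ω` for every measurable `v`. This is what makes the potential
term of the energy meaningful. Carathéodory integrands have this property
(`SuperpositionMeasurable.of_caratheodory`), and so have Borel ones, which may be discontinuous in
the second variable, such as `F(x, t) = χ_{(0,∞)}(t)`. -/
def SuperpositionMeasurable {n : ℕ} (Ω : Set (Rn n)) (F : Rn n → ℝ → ℝ) : Prop :=
  ∀ v : Rn n → ℝ, Measurable v → AEMeasurable (fun x => F x (v x)) (volume.restrict Ω)

/-- Carathéodory integrands: measurable in `x ∈ Ω` for every `t`, continuous in `t` for a.e.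
`x ∈ Ω`. -/
theorem SuperpositionMeasurable.of_caratheodory {n : ℕ} {Ω : Set (Rn n)} {F : Rn n → ℝ → ℝ}
    (hmeas : ∀ t, AEMeasurable (fun x => F x t) (volume.restrict Ω))
    (hcont : ∀ᵐ x ∂(volume.restrict Ω), Continuous (F x)) : SuperpositionMeasurable Ω F := by
  intro v hv
  obtain ⟨f, hf⟩ : ∃ f : ℕ → SimpleFunc (Rn n) ℝ,
      ∀ x, Filter.Tendsto (fun k => f k x) Filter.atTop (nhds (v x)) :=
    ⟨hv.stronglyMeasurable.approx, hv.stronglyMeasurable.tendsto_approx⟩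
  refine aemeasurable_of_tendsto_metrizable_ae Filter.atTop (f := fun k x => F x (f k x)) ?_ ?_
  · intro k
    have h : (fun x => F x (f k x)) =
        fun x => ∑ t ∈ (f k).range, (f k ⁻¹' {t}).indicator (fun x => F x t) x := by
      funext x
      rw [Finset.sum_eq_single (f k x)]
      · simp
      · intro t _ ht
        exact Set.indicator_of_notMem (fun hx => ht (by simpa using hx.symm)) _
      · intro hx
        exact absurd (SimpleFunc.mem_range_self _ x) hx
    rw [h]
    exact Finset.aemeasurable_fun_sum _ fun t _ =>
      (hmeas t).indicator ((f k).measurableSet_fiber t)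
  · filter_upwards [hcont] with x hx
    exact (hx.tendsto _).comp (hf x)

/-- Borel integrands. -/
theorem SuperpositionMeasurable.of_measurable {n : ℕ} {Ω : Set (Rn n)} {F : Rn n → ℝ → ℝ}
    (hF : Measurable (Function.uncurry F)) : SuperpositionMeasurable Ω F :=
  fun _ hv => (hF.comp (measurable_id.prodMk hv)).aemeasurable

/-- The energy
`ℰ(u; Ω) = 1/(2p) ∬_{𝒞_Ω} |u(x) - u(y)|^p K(x, y) dx dy + ∫_Ω F(x, u(x)) dx`.
The interaction term is a number in `[0, ∞]`. The potential term is a real number, an integral of a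
bounded measurable function over a bounded set in all cases of interest. The sum is infinite exactly
when the interaction term is. -/
noncomputable def energy {n : ℕ} (p : ℝ) (K : Rn n → Rn n → ℝ) (F : Rn n → ℝ → ℝ)
    (Ω : Set (Rn n)) (u : Rn n → ℝ) : EReal :=
  ((ENNReal.ofReal (1 / (2 * p)) *
      ∫⁻ z in crossSet Ω, ENNReal.ofReal (|u z.1 - u z.2| ^ p * K z.1 z.2) : ℝ≥0∞) : EReal) +
    ((∫ x in Ω, F x (u x) : ℝ) : EReal)

/-- `u` is a minimizer of `ℰ` in `Ω`: `u ∈ 𝕎^{s,p}(Ω)` and `ℰ(u; Ω) ≤ ℰ(u + φ; Ω)` for every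
measurable `φ : ℝⁿ → ℝ` whose support (the closure of `{φ ≠ 0}`) lies in `Ω`. A function that is
minimal among all perturbations vanishing outside `Ω` is in particular a minimizer in this sense. -/
def IsMinimizer {n : ℕ} (s p : ℝ) (K : Rn n → Rn n → ℝ) (F : Rn n → ℝ → ℝ)
    (Ω : Set (Rn n)) (u : Rn n → ℝ) : Prop :=
  MemW n s p Ω u ∧
    ∀ φ : Rn n → ℝ, AEMeasurable φ → tsupport φ ⊆ Ω →
      energy p K F Ω u ≤ energy p K F Ω (fun x => u x + φ x)

/-- `[v]_{C^α(S)} = sup_{x, y ∈ S, x ≠ y} |v(x) - v(y)| / |x - y|^α`, in `[0, ∞]`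
(the pairs with `x = y` contribute `0 / 0 = 0`). -/
noncomputable def holderSeminorm {n : ℕ} (α : ℝ) (v : Rn n → ℝ) (S : Set (Rn n)) : ℝ≥0∞ :=
  ⨆ x ∈ S, ⨆ y ∈ S, edist (v x) (v y) / edist x y ^ α

/-- `v ∈ C^α_loc(Ω)`: `v` is `α`-Hölder continuous on every compact subset of `Ω`. -/
def MemHolderLoc {n : ℕ} (α : ℝ) (v : Rn n → ℝ) (Ω : Set (Rn n)) : Prop :=
  ∀ Q : Set (Rn n), IsCompact Q → Q ⊆ Ω → holderSeminorm α v Q < ∞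

end NonlocalEnergy

/-! Comparing a minimizer `u` with `u - ζ^p (u - k)₊`, where `ζ` is a cutoff function, and using
`|F| ≤ F₀` only through `|∫ F(x, u) - ∫ F(x, v)| ≤ 2 F₀ |{u ≠ v}|`, gives a Caccioppoli inequality
with a tail for `(u - k)₊`. Since `-u` minimizes an energy of the same kind, both `u` and `-u` lie
in a fractional De Giorgi class.

The Caccioppoli inequality also controls `∬ (u(x) - k)₊ (k - u(y))₊^{p-1} |x - y|^{-n-sp}`: a set
where `u` is well above `k` and a set where `u` is well below `k` cannot both be large. This
replaces the isoperimetric inequality of the local theory. It drives De Giorgi's iteration, which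
yields the sup bound, and it reduces the oscillation by a fixed factor when the radius is reduced by
a fixed factor, the tails being summed along the scales. The resulting decay holds almost everywhere
on small balls and passes to the essential limits of `u`, which form its Hölder continuous
representative. -/

namespace NonlocalEnergy

open Metric

section Radial

/-- `n ω_n / b`, where `ω_n` is the volume of the unit ball of `ℝⁿ`: the value of
`∫ |y|^{-(n+b)} dy` over the complement of the unit ball, and of `∫ |y|^{b-n} dy` over the unit
ball, for `b > 0`. -/
noncomputable def radialConst (n : ℕ) (b : ℝ) : ℝ :=
  n * volume.real (ball (0 : Rn n) 1) / b

theorem radialConst_nonneg (n : ℕ) {b : ℝ} (hb : 0 < b) : 0 ≤ radialConst n b := by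
  unfold radialConst
  positivity

theorem lintegral_radial {n : ℕ} (hn : n ≠ 0) {f : ℝ → ℝ} (hf : ∀ r, 0 ≤ f r)
    (hfi : IntegrableOn (fun r => r ^ (n - 1) * f r) (Ioi 0)) (x : Rn n) :
    ∫⁻ y, ENNReal.ofReal (f ‖y - x‖) =
      ENNReal.ofReal
        (n * volume.real (ball (0 : Rn n) 1) * ∫ r in Ioi (0 : ℝ), r ^ (n - 1) * f r) := by
  have : Nonempty (Fin n) := ⟨⟨0, Nat.pos_of_ne_zero hn⟩⟩
  have hfi' : Integrable (fun y : Rn n => f ‖y‖) := by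
    simpa [integrable_fun_norm_addHaar] using hfi
  rw [lintegral_sub_right_eq_self (fun y => ENNReal.ofReal (f ‖y‖)) x,
    ← ofReal_integral_eq_lintegral_ofReal hfi' (.of_forall fun _ => hf _),
    integral_fun_norm_addHaar]
  simp [mul_assoc]

theorem pow_pred_mul_rpow_sub {n : ℕ} (hn : n ≠ 0) (c : ℝ) {r : ℝ} (hr : 0 < r) :
    r ^ (n - 1) * r ^ (c - n) = r ^ (c - 1) := by
  rw [← Real.rpow_natCast, ← Real.rpow_add hr, Nat.cast_pred (Nat.pos_of_ne_zero hn)]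
  ring_nf

theorem setLIntegral_radial_rpow {n : ℕ} (hn : n ≠ 0) {c : ℝ} {S : Set ℝ} (hS : MeasurableSet S)
    (hS0 : S ⊆ Ioi 0) (hfi : IntegrableOn (fun r => r ^ (c - 1)) S) (x : Rn n) :
    ∫⁻ y in {y | ‖y - x‖ ∈ S}, ‖y - x‖ₑ ^ (c - n) =
      ENNReal.ofReal (n * volume.real (ball (0 : Rn n) 1) * ∫ r in S, r ^ (c - 1)) := by
  have hmul (r : ℝ) : r ^ (n - 1) * S.indicator (fun r => r ^ (c - n)) r =
      S.indicator (fun r => r ^ (c - 1)) r := by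
    by_cases hr : r ∈ S
    · simp [hr, pow_pred_mul_rpow_sub hn c (hS0 hr)]
    · simp [hr]
  have hradial := lintegral_radial hn (f := S.indicator fun r => r ^ (c - n))
    (indicator_nonneg fun r hr => Real.rpow_nonneg (le_of_lt (hS0 hr)) _)
    (by simpa only [hmul] using ((integrable_indicator_iff hS).2 hfi).integrableOn) x
  have hSx : MeasurableSet {y : Rn n | ‖y - x‖ ∈ S} := hS.preimage (by fun_prop)
  simp only [hmul, setIntegral_indicator hS, inter_eq_self_of_subset_right hS0] at hradial
  rw [← hradial, ← lintegral_indicator hSx]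
  congr 1 with y
  by_cases hy : ‖y - x‖ ∈ S
  · rw [indicator_of_mem hy, indicator_of_mem (by exact hy), ← ofReal_norm,
      ENNReal.ofReal_rpow_of_pos (hS0 hy)]
  · rw [indicator_of_notMem hy, indicator_of_notMem (by exact hy), ENNReal.ofReal_zero]

theorem lintegral_compl_ball_rpow {n : ℕ} (x : Rn n) {b ρ : ℝ} (hb : 0 < b) (hρ : 0 < ρ) :
    ∫⁻ y in (ball x ρ)ᶜ, ‖y - x‖ₑ ^ (-((n : ℝ) + b)) =
      ENNReal.ofReal (radialConst n b * ρ ^ (-b)) := by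
  rcases eq_or_ne n 0 with rfl | hn
  · have : (ball x ρ)ᶜ = ∅ := by
      ext y
      simp [Subsingleton.elim y x, hρ]
    simp [this, radialConst]
  · have hset : (ball x ρ)ᶜ = {y | ‖y - x‖ ∈ Ici ρ} := by
      ext y
      simp [dist_eq_norm]
    rw [hset, neg_add', sub_eq_add_neg, add_comm, ← sub_eq_add_neg,
      setLIntegral_radial_rpow hn measurableSet_Ici (Ici_subset_Ioi.2 hρ)
        ((integrableOn_Ici_iff_integrableOn_Ioi).2 (integrableOn_Ioi_rpow_of_lt (by linarith) hρ)),
      integral_Ici_eq_integral_Ioi, integral_Ioi_rpow_of_lt (by linarith) hρ, radialConst]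
    congr 1
    rw [sub_add_cancel, neg_div_neg_eq]
    ring

theorem lintegral_ball_rpow {n : ℕ} (hn : n ≠ 0) (x : Rn n) {b ρ : ℝ} (hb : 0 < b) (hρ : 0 < ρ) :
    ∫⁻ y in ball x ρ, ‖y - x‖ₑ ^ (b - n) = ENNReal.ofReal (radialConst n b * ρ ^ b) := by
  have : Nonempty (Fin n) := ⟨⟨0, Nat.pos_of_ne_zero hn⟩⟩
  have hset : ball x ρ =ᵐ[volume] {y | ‖y - x‖ ∈ Ioo 0 ρ} := by
    have hball : {y | ‖y - x‖ ∈ Ioo 0 ρ} = ball x ρ \ {x} := by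
      ext y
      simp [dist_eq_norm, sub_eq_zero, and_comm]
    rw [hball]
    exact (sdiff_null_ae_eq_self (measure_singleton x)).symm
  have hfi : IntervalIntegrable (fun r : ℝ => r ^ (b - 1)) volume 0 ρ :=
    intervalIntegral.intervalIntegrable_rpow' (by linarith)
  rw [setLIntegral_congr hset, setLIntegral_radial_rpow hn measurableSet_Ioo Ioo_subset_Ioi_self
      (((intervalIntegrable_iff_integrableOn_Ioo_of_le hρ.le).1 hfi)),
    ← integral_Ioc_eq_integral_Ioo, ← intervalIntegral.integral_of_le hρ.le,
    integral_rpow (Or.inl (by linarith)), radialConst]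
  congr 1
  rw [sub_add_cancel, Real.zero_rpow hb.ne', sub_zero]
  ring

theorem volume_ball_eq {n : ℕ} (x : Rn n) {r : ℝ} (hr : 0 < r) :
    volume (ball x r) = ENNReal.ofReal (r ^ n * volume.real (ball (0 : Rn n) 1)) := by
  rw [Measure.addHaar_ball_of_pos _ _ hr, ENNReal.ofReal_mul (by positivity), measureReal_def,
    ENNReal.ofReal_toReal measure_ball_lt_top.ne, finrank_euclideanSpace_fin]

end Radial

section Tail

variable {n : ℕ} {s p : ℝ} {f g : Rn n → ℝ≥0∞} {x₀ x₁ : Rn n} {R : ℝ}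

/-- The power `Tail_{s,p}(f; x₀, R)^{p-1}` of the tail of a function with values in `[0, ∞]`. It is
used instead of `tail` because it is subadditive in `f` up to a constant. -/
noncomputable def tailPow (n : ℕ) (s p : ℝ) (f : Rn n → ℝ≥0∞) (x₀ : Rn n) (R : ℝ) : ℝ≥0∞ :=
  ENNReal.ofReal (R ^ (s * p)) *
    ∫⁻ y in (ball x₀ R)ᶜ, f y ^ (p - 1) * ‖y - x₀‖ₑ ^ (-((n : ℝ) + s * p))

theorem tailPow_mono (hp : 1 < p) (h : ∀ᵐ y ∂(volume.restrict (ball x₀ R)ᶜ), f y ≤ g y) :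
    tailPow n s p f x₀ R ≤ tailPow n s p g x₀ R := by
  refine mul_le_mul' le_rfl (lintegral_mono_ae ?_)
  filter_upwards [h] with y hy
  have : 0 ≤ p - 1 := by linarith
  gcongr

theorem ofReal_rpow_mul_ofReal_rpow_neg {ρ : ℝ} (hρ : 0 < ρ) (C a : ℝ) :
    ENNReal.ofReal (ρ ^ a) * ENNReal.ofReal (C * ρ ^ (-a)) = ENNReal.ofReal C := by
  rw [← ENNReal.ofReal_mul (by positivity), mul_left_comm, ← Real.rpow_add hρ, add_neg_cancel,
    Real.rpow_zero, mul_one]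

theorem tailPow_const (hsp : 0 < s * p) (hR : 0 < R) (c : ℝ≥0∞) :
    tailPow n s p (fun _ => c) x₀ R = ENNReal.ofReal (radialConst n (s * p)) * c ^ (p - 1) := by
  rw [tailPow, lintegral_const_mul _ (by fun_prop), lintegral_compl_ball_rpow x₀ hsp hR,
    mul_left_comm, ofReal_rpow_mul_ofReal_rpow_neg hR, mul_comm]

theorem rpow_neg_le_mul_rpow_neg {a b : ℝ≥0∞} {κ E : ℝ} (hκ : 0 < κ) (hE : 0 ≤ E)
    (h : a ≤ ENNReal.ofReal κ * b) : b ^ (-E) ≤ ENNReal.ofReal (κ ^ E) * a ^ (-E) := by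
  have hκE : ENNReal.ofReal (κ ^ E) ≠ 0 := (ENNReal.ofReal_pos.2 (by positivity)).ne'
  calc b ^ (-E) = ENNReal.ofReal (κ ^ E) * (ENNReal.ofReal κ * b) ^ (-E) := by
        rw [ENNReal.rpow_neg (_ * b), ENNReal.mul_rpow_of_nonneg _ _ hE,
          ENNReal.ofReal_rpow_of_pos hκ, ENNReal.mul_inv (.inl hκE) (.inl ENNReal.ofReal_ne_top),
          ← mul_assoc, ENNReal.mul_inv_cancel hκE ENNReal.ofReal_ne_top, one_mul, ENNReal.rpow_neg]
    _ ≤ _ := by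
        rw [ENNReal.rpow_neg, ENNReal.rpow_neg]
        gcongr

theorem lintegral_compl_ball_diff_le (hsp : 0 ≤ s * p) (hR : 0 < R) {ρ κ : ℝ} (hκ : 0 < κ)
    (hcomp : ∀ y, R ≤ ‖y - x₀‖ → ρ ≤ ‖y - x₁‖ → ‖y - x₀‖ ≤ κ * ‖y - x₁‖) :
    ∫⁻ y in (ball x₁ ρ)ᶜ \ ball x₀ R, f y ^ (p - 1) * ‖y - x₁‖ₑ ^ (-((n : ℝ) + s * p)) ≤
      ENNReal.ofReal (κ ^ ((n : ℝ) + s * p) * R ^ (-(s * p))) * tailPow n s p f x₀ R := by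
  calc ∫⁻ y in (ball x₁ ρ)ᶜ \ ball x₀ R, f y ^ (p - 1) * ‖y - x₁‖ₑ ^ (-((n : ℝ) + s * p))
      ≤ ∫⁻ y in (ball x₁ ρ)ᶜ \ ball x₀ R, ENNReal.ofReal (κ ^ ((n : ℝ) + s * p)) *
          (f y ^ (p - 1) * ‖y - x₀‖ₑ ^ (-((n : ℝ) + s * p))) := by
        refine setLIntegral_mono' (measurableSet_ball.compl.diff measurableSet_ball) fun y hy => ?_
        have hy₁ : ρ ≤ ‖y - x₁‖ := by simpa [dist_eq_norm] using hy.1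
        have hy₀ : R ≤ ‖y - x₀‖ := by simpa [dist_eq_norm] using hy.2
        rw [mul_left_comm]
        gcongr
        refine rpow_neg_le_mul_rpow_neg hκ (by positivity) ?_
        rw [← ofReal_norm, ← ofReal_norm, ← ENNReal.ofReal_mul hκ.le]
        exact ENNReal.ofReal_le_ofReal (hcomp y hy₀ hy₁)
    _ ≤ ENNReal.ofReal (κ ^ ((n : ℝ) + s * p)) *
          ∫⁻ y in (ball x₀ R)ᶜ, f y ^ (p - 1) * ‖y - x₀‖ₑ ^ (-((n : ℝ) + s * p)) := by
        rw [lintegral_const_mul' _ _ ENNReal.ofReal_ne_top]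
        gcongr
        exact fun y hy => hy.2
    _ = _ := by
        rw [tailPow, ← mul_assoc, ← ENNReal.ofReal_mul (by positivity), mul_assoc,
          ← Real.rpow_add hR, neg_add_cancel, Real.rpow_zero, mul_one]

theorem tailPow_recenter_le (hp : 1 < p) (hsp : 0 < s * p) {ρ κ : ℝ} (hR : 0 < R) (hρ : 0 < ρ)
    (hκ : 0 < κ) {c : ℝ≥0∞}
    (hcomp : ∀ y, R ≤ ‖y - x₀‖ → ρ ≤ ‖y - x₁‖ → ‖y - x₀‖ ≤ κ * ‖y - x₁‖)
    (hf : ∀ᵐ y ∂(volume.restrict (ball x₀ R)), f y ≤ c) :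
    tailPow n s p f x₁ ρ ≤ ENNReal.ofReal (radialConst n (s * p)) * c ^ (p - 1) +
      ENNReal.ofReal (κ ^ ((n : ℝ) + s * p) * (ρ / R) ^ (s * p)) * tailPow n s p f x₀ R := by
  have : 0 ≤ p - 1 := by linarith
  have hnear : ∫⁻ y in (ball x₁ ρ)ᶜ ∩ ball x₀ R,
      f y ^ (p - 1) * ‖y - x₁‖ₑ ^ (-((n : ℝ) + s * p)) ≤
      ∫⁻ y in (ball x₁ ρ)ᶜ, c ^ (p - 1) * ‖y - x₁‖ₑ ^ (-((n : ℝ) + s * p)) := by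
    refine le_trans (lintegral_mono_ae ?_) (lintegral_mono_set inter_subset_left)
    filter_upwards [ae_restrict_of_ae_restrict_of_subset inter_subset_right hf] with y hy
    gcongr
  rw [← tailPow_const (x₀ := x₁) hsp hρ, tailPow, tailPow, ← lintegral_inter_add_sdiff _ _
    (measurableSet_ball (x := x₀) (ε := R)), mul_add]
  gcongr ?_ + ?_
  · gcongr
  · refine (mul_le_mul' le_rfl (lintegral_compl_ball_diff_le hsp.le hR hκ hcomp)).trans_eq ?_
    rw [← mul_assoc, ← ENNReal.ofReal_mul (by positivity), Real.div_rpow hρ.le hR.le,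
      Real.rpow_neg hR.le]
    congr 2
    ring

theorem ennreal_add_rpow_le {q : ℝ} (hq : 0 ≤ q) (a b : ℝ≥0∞) :
    (a + b) ^ q ≤ ENNReal.ofReal (2 ^ q) * (a ^ q + b ^ q) := by
  have hmono := ENNReal.monotone_rpow_of_nonneg hq
  calc (a + b) ^ q ≤ (2 * max a b) ^ q := by
        gcongr
        rw [two_mul]
        gcongr
        · exact le_max_left _ _
        · exact le_max_right _ _
    _ = ENNReal.ofReal (2 ^ q) * max (a ^ q) (b ^ q) := by
        rw [ENNReal.mul_rpow_of_nonneg _ _ hq, ← hmono.map_max,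
          ← ENNReal.ofReal_rpow_of_pos two_pos, ENNReal.ofReal_ofNat]
    _ ≤ _ := by
        gcongr
        exact max_le_add_of_nonneg zero_le zero_le

theorem tailPow_add_const_le (hp : 1 < p) (hsp : 0 < s * p) (hR : 0 < R) (c : ℝ≥0∞) :
    tailPow n s p (fun y => f y + c) x₀ R ≤ ENNReal.ofReal (2 ^ (p - 1)) *
      (tailPow n s p f x₀ R + ENNReal.ofReal (radialConst n (s * p)) * c ^ (p - 1)) := by
  have hp' : 0 ≤ p - 1 := by linarith
  have hadd : ∫⁻ y in (ball x₀ R)ᶜ, (f y + c) ^ (p - 1) * ‖y - x₀‖ₑ ^ (-((n : ℝ) + s * p)) ≤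
      ENNReal.ofReal (2 ^ (p - 1)) * ∫⁻ y in (ball x₀ R)ᶜ,
        (f y ^ (p - 1) * ‖y - x₀‖ₑ ^ (-((n : ℝ) + s * p)) +
          c ^ (p - 1) * ‖y - x₀‖ₑ ^ (-((n : ℝ) + s * p))) := by
    rw [← lintegral_const_mul' _ _ ENNReal.ofReal_ne_top]
    refine lintegral_mono fun y => ?_
    rw [← add_mul, ← mul_assoc]
    gcongr
    exact ennreal_add_rpow_le hp' _ _
  rw [← tailPow_const (x₀ := x₀) hsp hR, tailPow, tailPow, tailPow, ← mul_add,
    ← lintegral_add_right _ (by fun_prop), mul_left_comm]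
  gcongr

end Tail

section PowerInequalities

variable {p : ℝ}

theorem mul_rpow_sub_one_eq {x : ℝ} (hp : p ≠ 0) (hx : 0 ≤ x) : x * x ^ (p - 1) = x ^ p := by
  rw [← Real.rpow_one_add' hx (by simpa using hp), add_sub_cancel]

theorem rpow_sub_rpow_le (hp : 1 ≤ p) {x y : ℝ} (hy : 0 ≤ y) (hyx : y ≤ x) :
    x ^ p - y ^ p ≤ p * x ^ (p - 1) * (x - y) := by
  rcases (hy.trans hyx).eq_or_lt with h | hx
  · have : y = 0 := le_antisymm (h ▸ hyx) hy
    simp [← h, this]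
  · have hbernoulli := one_add_mul_self_le_rpow_one_add (s := y / x - 1) (p := p)
      (by linarith [div_nonneg hy hx.le]) hp
    rw [add_sub_cancel, Real.div_rpow hy hx.le, le_div_iff₀ (by positivity),
      ← mul_rpow_sub_one_eq (by linarith) hx.le] at hbernoulli
    rw [← mul_rpow_sub_one_eq (by linarith) hx.le]
    have hexpand : (1 + p * (y / x - 1)) * (x * x ^ (p - 1)) =
        x * x ^ (p - 1) + p * x ^ (p - 1) * (y - x) := by field_simp
    linarith

theorem shrink_add_rpow_add_le (hp : 1 < p) {a b h : ℝ} (ha : 0 ≤ a) (hb : 0 ≤ b) (h0 : 0 ≤ h)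
    (h1 : h ≤ 1) : ((1 - h) * a + b) ^ p + h * (a * max a b ^ (p - 1)) ≤ (a + b) ^ p := by
  have : 0 ≤ p - 1 := by linarith
  have : 0 ≤ 1 - h := by linarith
  have : 0 ≤ max a b := le_max_of_le_left ha
  have hmax : max a b ≤ a + b := max_le (by linarith) (by linarith)
  have hshrink : (1 - h) * a + b ≤ a + b := by nlinarith
  rw [← mul_rpow_sub_one_eq (x := (1 - h) * a + b) (by linarith) (by positivity),
    ← mul_rpow_sub_one_eq (x := a + b) (by linarith) (by positivity)]
  calc _ ≤ ((1 - h) * a + b) * (a + b) ^ (p - 1) + h * (a * (a + b) ^ (p - 1)) := by gcongr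
    _ = _ := by ring

theorem abs_cutoff_sub_rpow_le_of_le (hp : 1 < p) {a b z z' : ℝ} (hb : 0 ≤ b)
    (hz' : 0 ≤ z') (hzz : z' ≤ z) (hz1 : z ≤ 1) :
    |(1 - z ^ p) * a - (1 - z' ^ p) * b| ^ p ≤ |a - b| ^ p + p ^ p * b ^ p * (z - z') ^ p := by
  have hp0 : 0 < p := by linarith
  rcases (hz'.trans hzz).eq_or_lt with h | hz
  · have : z' = 0 := le_antisymm (h ▸ hzz) hz'
    simp [← h, this, Real.zero_rpow hp0.ne']
  have hzp : 0 ≤ 1 - z ^ p := by linarith [Real.rpow_le_one hz.le hz1 hp0.le]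
  have hd : 0 ≤ z - z' := by linarith
  have hmono : z' ^ p ≤ z ^ p := by gcongr
  set t : ℝ := p * b * (z - z') / z with ht
  have hzt : z ^ p * t = p * z ^ (p - 1) * (z - z') * b := by
    rw [ht, Real.rpow_sub_one hz.ne']
    field_simp
  have hztp : z ^ p * t ^ p = p ^ p * b ^ p * (z - z') ^ p := by
    rw [ht, Real.div_rpow (by positivity) hz.le, Real.mul_rpow (by positivity) hd,
      Real.mul_rpow hp0.le hb]
    field_simp
  have hconvexcomb : |(1 - z ^ p) * a - (1 - z' ^ p) * b| ≤ (1 - z ^ p) * |a - b| + z ^ p * t := by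
    calc _ = |(1 - z ^ p) * (a - b) - (z ^ p - z' ^ p) * b| := by congr 1; ring
      _ ≤ |(1 - z ^ p) * (a - b)| + |(z ^ p - z' ^ p) * b| := abs_sub _ _
      _ = (1 - z ^ p) * |a - b| + (z ^ p - z' ^ p) * b := by
        rw [abs_mul, abs_mul, abs_of_nonneg hzp, abs_of_nonneg (sub_nonneg.2 hmono),
          abs_of_nonneg hb]
      _ ≤ _ := by
        rw [hzt]
        gcongr
        exact rpow_sub_rpow_le hp.le hz' hzz
  calc _ ≤ ((1 - z ^ p) * |a - b| + z ^ p * t) ^ p := by gcongr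
    _ ≤ (1 - z ^ p) * |a - b| ^ p + z ^ p * t ^ p :=
      (convexOn_rpow hp.le).2 (abs_nonneg (a - b)) (by positivity : 0 ≤ t) hzp (by positivity)
        (by ring)
    _ ≤ _ := by
      rw [hztp]
      have : 0 ≤ z ^ p * |a - b| ^ p := by positivity
      linarith

theorem abs_cutoff_sub_rpow_le (hp : 1 < p) {a b z z' : ℝ} (ha : 0 ≤ a) (hb : 0 ≤ b)
    (hz : 0 ≤ z) (hz1 : z ≤ 1) (hz' : 0 ≤ z') (hz1' : z' ≤ 1) :
    |(1 - z ^ p) * a - (1 - z' ^ p) * b| ^ p ≤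
      |a - b| ^ p + (p ^ p * a ^ p * |z - z'| ^ p + p ^ p * b ^ p * |z' - z| ^ p) := by
  have : 0 < p := by linarith
  have hA : 0 ≤ p ^ p * a ^ p * |z - z'| ^ p := by positivity
  have hB : 0 ≤ p ^ p * b ^ p * |z' - z| ^ p := by positivity
  rcases le_total z' z with h | h
  · have := abs_cutoff_sub_rpow_le_of_le hp (a := a) hb hz' h hz1
    rw [abs_sub_comm z', abs_of_nonneg (sub_nonneg.2 h)] at *
    linarith
  · have := abs_cutoff_sub_rpow_le_of_le hp (a := b) ha hz h hz1'
    rw [abs_sub_comm z, abs_of_nonneg (sub_nonneg.2 h)] at *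
    rw [abs_sub_comm, abs_sub_comm b] at this
    linarith

theorem abs_shrink_sub_rpow_le (hp : 1 < p) {a b h : ℝ} (ha : 0 ≤ a) (hb : 0 ≤ b) (h0 : 0 ≤ h)
    (h1 : h ≤ 1) : |(1 - h) * a - b| ^ p ≤ |a - b| ^ p + p * (a * b ^ (p - 1)) := by
  have hp0 : 0 < p := by linarith
  have : 0 ≤ p - 1 := by linarith
  have he0 : 0 ≤ (1 - h) * a := mul_nonneg (by linarith) ha
  have he1 : (1 - h) * a ≤ a := by nlinarith
  have hpos : 0 ≤ p * (a * b ^ (p - 1)) := by positivity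
  generalize (1 - h) * a = e at *
  rcases le_total b e with hbe | heb
  · have : |e - b| ^ p ≤ |a - b| ^ p := by
      rw [abs_of_nonneg (by linarith), abs_of_nonneg (by linarith)]
      exact Real.rpow_le_rpow (by linarith) (by linarith) hp0.le
    linarith
  rw [abs_of_nonpos (by linarith), neg_sub]
  rcases le_total a b with hab | hba
  · rw [abs_of_nonpos (by linarith), neg_sub]
    have htangent := rpow_sub_rpow_le hp.le (x := b - e) (y := b - a) (by linarith) (by linarith)
    have : p * (b - e) ^ (p - 1) * (b - e - (b - a)) ≤ p * b ^ (p - 1) * a := by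
      have : 0 ≤ b - e := by linarith
      have : 0 ≤ b - e - (b - a) := by linarith
      gcongr <;> linarith
    linarith
  · calc (b - e) ^ p ≤ b ^ p := Real.rpow_le_rpow (by linarith) (by linarith) hp0.le
      _ = b * b ^ (p - 1) := (mul_rpow_sub_one_eq hp0.ne' hb).symm
      _ ≤ a * b ^ (p - 1) := by gcongr
      _ ≤ p * (a * b ^ (p - 1)) := le_mul_of_one_le_left (by positivity) hp.le
      _ ≤ _ := le_add_of_nonneg_left (by positivity)

end PowerInequalities

section Truncation

variable {X : Type*} {p : ℝ} {u ζ : X → ℝ} {k : ℝ} {B₀ B₁ B₂ : Set X} {x y : X}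

/-- `ζ` is a cutoff function between `B₀` and `B₁`: it takes values in `[0, 1]`, equals `1` on `B₀`
and vanishes outside `B₁`. -/
structure IsCutoff (ζ : X → ℝ) (B₀ B₁ : Set X) : Prop where
  mem_Icc : ∀ x, ζ x ∈ Icc 0 1
  eq_one : ∀ x ∈ B₀, ζ x = 1
  eq_zero : ∀ x ∉ B₁, ζ x = 0

/-- The competitor `u - ζ^p (u - k)₊`: the function `u` truncated at the level `k` where the cutoff
function `ζ` equals `1`. -/
noncomputable def truncation (p : ℝ) (u ζ : X → ℝ) (k : ℝ) (x : X) : ℝ :=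
  u x - ζ x ^ p * (u x - k)⁺

open Classical in
/-- Bounds, after symmetrization in `x` and `y`, the amount by which `|u(x) - u(y)|^p` may increase
when `u` is truncated with a cutoff function supported in `B₁ ⊆ B₂`. The pairs in `B₂ × B₂` pay for
the variation of the cutoff, the pairs in `B₁ × B₂ᶜ` for the values of `u` far away. -/
noncomputable def truncationError (p : ℝ) (u ζ : X → ℝ) (k : ℝ) (B₁ B₂ : Set X) (x y : X) : ℝ :=
  (if x ∈ B₂ ∧ y ∈ B₂ then p ^ p * (u x - k)⁺ ^ p * |ζ x - ζ y| ^ p else 0) +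
    (if x ∈ B₁ ∧ y ∉ B₂ then p * ((u x - k)⁺ * (u y - k)⁺ ^ (p - 1)) else 0)

open Classical in
/-- Bounds from below the amount by which `|u(x) - u(y)|^p` decreases under truncation at the level
`k` when `x` and `y` lie on different sides of that level and the cutoff function is `1` on `B₀`. -/
noncomputable def truncationGain (p : ℝ) (u : X → ℝ) (k : ℝ) (B₀ B₂ : Set X) (x y : X) : ℝ :=
  if x ∈ B₀ ∧ y ∈ B₂ ∧ u y ≤ k then (u x - k)⁺ * max (u x - k)⁺ (k - u y)⁺ ^ (p - 1) else 0

theorem truncationError_nonneg (hp : 1 < p) (u ζ : X → ℝ) (k : ℝ) (B₁ B₂ : Set X) (x y : X) :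
    0 ≤ truncationError p u ζ k B₁ B₂ x y := by
  have : 0 < p := by linarith
  unfold truncationError
  split_ifs <;> positivity

theorem truncationGain_nonneg (u : X → ℝ) (k : ℝ) (B₀ B₂ : Set X) (x y : X) :
    0 ≤ truncationGain p u k B₀ B₂ x y := by
  unfold truncationGain
  split_ifs <;> positivity

theorem truncation_of_le (hx : u x ≤ k) : truncation p u ζ k x = u x := by
  simp [truncation, posPart_of_nonpos (sub_nonpos.2 hx)]

theorem truncation_of_eq_zero (hp : p ≠ 0) (hx : ζ x = 0) : truncation p u ζ k x = u x := by
  simp [truncation, hx, Real.zero_rpow hp]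

theorem truncation_sub_level_of_le (hx : k ≤ u x) :
    truncation p u ζ k x - k = (1 - ζ x ^ p) * (u x - k) := by
  rw [truncation, posPart_of_nonneg (sub_nonneg.2 hx)]
  ring

theorem abs_truncation_sub_rpow_le_of_le_of_le (hp : 1 < p) (hζ : ζ x ∈ Icc 0 1)
    (hx : k ≤ u x) (hy : u y ≤ k) :
    |truncation p u ζ k x - truncation p u ζ k y| ^ p +
        ζ x ^ p * ((u x - k) * max (u x - k) (k - u y) ^ (p - 1)) ≤ |u x - u y| ^ p := by
  have hζ1 : ζ x ^ p ≤ 1 := Real.rpow_le_one hζ.1 hζ.2 (by linarith)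
  have ha : 0 ≤ (1 - ζ x ^ p) * (u x - k) := mul_nonneg (by linarith) (by linarith)
  have htrunc : truncation p u ζ k x - truncation p u ζ k y =
      (1 - ζ x ^ p) * (u x - k) + (k - u y) := by
    rw [truncation_of_le hy, ← truncation_sub_level_of_le hx]
    ring
  rw [htrunc, abs_of_nonneg (add_nonneg ha (sub_nonneg.2 hy)),
    abs_of_nonneg (sub_nonneg.2 (hy.trans hx))]
  simpa only [sub_add_sub_cancel] using
    shrink_add_rpow_add_le hp (sub_nonneg.2 hx) (sub_nonneg.2 hy) (Real.rpow_nonneg hζ.1 _) hζ1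

theorem truncationGain_le (hζ : 0 ≤ ζ x) (hζB₀ : ∀ x ∈ B₀, ζ x = 1) (hx : k ≤ u x)
    (hy : u y ≤ k) : truncationGain p u k B₀ B₂ x y ≤
      ζ x ^ p * ((u x - k) * max (u x - k) (k - u y) ^ (p - 1)) := by
  have hx' : 0 ≤ u x - k := by linarith
  have : 0 ≤ max (u x - k) (k - u y) := le_max_of_le_left hx'
  unfold truncationGain
  split_ifs with h
  · rw [hζB₀ x h.1, Real.one_rpow, one_mul, posPart_of_nonneg hx',
      posPart_of_nonneg (sub_nonneg.2 hy)]
  · positivity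

theorem truncationGain_eq_zero (h : u x ≤ k ∨ k < u y) :
    truncationGain p u k B₀ B₂ x y = 0 := by
  rcases h with hx | hy
  · simp [truncationGain, posPart_of_nonpos (sub_nonpos.2 hx)]
  · simp [truncationGain, hy]

theorem abs_truncation_sub_rpow_le_of_lt (hp : 1 < p) (h12 : B₁ ⊆ B₂)
    (hζ : ∀ x, ζ x ∈ Icc 0 1) (hζB₁ : ∀ x ∉ B₁, ζ x = 0) (hx : k < u x) (hy : k < u y) :
    |truncation p u ζ k x - truncation p u ζ k y| ^ p ≤ |u x - u y| ^ p +
      (truncationError p u ζ k B₁ B₂ x y + truncationError p u ζ k B₁ B₂ y x) := by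
  have hp0 : p ≠ 0 := by linarith
  have hζp (x : X) : ζ x ^ p ∈ Icc 0 1 :=
    ⟨Real.rpow_nonneg (hζ x).1 _, Real.rpow_le_one (hζ x).1 (hζ x).2 (by linarith)⟩
  have hEx := truncationError_nonneg hp u ζ k B₁ B₂ x y
  have hEy := truncationError_nonneg hp u ζ k B₁ B₂ y x
  have hax : 0 ≤ u x - k := by linarith
  have hay : 0 ≤ u y - k := by linarith
  rw [← sub_sub_sub_cancel_right (truncation p u ζ k x) _ k, truncation_sub_level_of_le hx.le,
    truncation_sub_level_of_le hy.le, ← sub_sub_sub_cancel_right (u x) (u y) k]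
  by_cases hx2 : x ∈ B₂ <;> by_cases hy2 : y ∈ B₂
  · simpa [truncationError, hx2, hy2, posPart_of_nonneg hax, posPart_of_nonneg hay] using
      abs_cutoff_sub_rpow_le hp hax hay (hζ x).1 (hζ x).2 (hζ y).1 (hζ y).2
  · have hζy : ζ y = 0 := hζB₁ y fun h => hy2 (h12 h)
    by_cases hx1 : x ∈ B₁
    · simpa [truncationError, hx2, hy2, hx1, hζy, posPart_of_nonneg hax, posPart_of_nonneg hay,
        Real.zero_rpow hp0] using abs_shrink_sub_rpow_le hp hax hay (hζp x).1 (hζp x).2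
    · simp only [hζy, hζB₁ x hx1, Real.zero_rpow hp0, sub_zero, one_mul]
      linarith
  · have hζx : ζ x = 0 := hζB₁ x fun h => hx2 (h12 h)
    by_cases hy1 : y ∈ B₁
    · rw [abs_sub_comm, abs_sub_comm (u x - k)]
      simpa [truncationError, hx2, hy2, hy1, hζx, posPart_of_nonneg hax, posPart_of_nonneg hay,
        Real.zero_rpow hp0] using abs_shrink_sub_rpow_le hp hay hax (hζp y).1 (hζp y).2
    · simp only [hζx, hζB₁ y hy1, Real.zero_rpow hp0, sub_zero, one_mul]
      linarith
  · simp only [hζB₁ x fun h => hx2 (h12 h), hζB₁ y fun h => hy2 (h12 h), Real.zero_rpow hp0,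
      sub_zero, one_mul]
    linarith

theorem abs_truncation_sub_rpow_add_gain_le (hp : 1 < p) (h12 : B₁ ⊆ B₂)
    (hζ : IsCutoff ζ B₀ B₁) (x y : X) :
    |truncation p u ζ k x - truncation p u ζ k y| ^ p + truncationGain p u k B₀ B₂ x y ≤
      |u x - u y| ^ p +
        (truncationError p u ζ k B₁ B₂ x y + truncationError p u ζ k B₁ B₂ y x) := by
  have hEx := truncationError_nonneg hp u ζ k B₁ B₂ x y
  have hEy := truncationError_nonneg hp u ζ k B₁ B₂ y x
  rcases le_or_gt (u x) k with hx | hx <;> rcases le_or_gt (u y) k with hy | hy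
  · rw [truncationGain_eq_zero (.inl hx), truncation_of_le hx, truncation_of_le hy]
    linarith
  · have hstraddle := abs_truncation_sub_rpow_le_of_le_of_le hp (hζ.mem_Icc y) hy.le hx
    have hpos : 0 ≤ ζ y ^ p * ((u y - k) * max (u y - k) (k - u x) ^ (p - 1)) :=
      mul_nonneg (Real.rpow_nonneg (hζ.mem_Icc y).1 _) (mul_nonneg (by linarith)
        (Real.rpow_nonneg (le_max_of_le_left (by linarith)) _))
    rw [truncationGain_eq_zero (.inl hx), abs_sub_comm, abs_sub_comm (u x)]
    linarith
  · have hstraddle := abs_truncation_sub_rpow_le_of_le_of_le hp (hζ.mem_Icc x) hx.le hy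
    have hgain := truncationGain_le (p := p) (B₂ := B₂) (hζ.mem_Icc x).1 hζ.eq_one hx.le hy
    linarith
  · rw [truncationGain_eq_zero (.inr hy), add_zero]
    exact abs_truncation_sub_rpow_le_of_lt hp h12 hζ.mem_Icc hζ.eq_zero hx hy

end Truncation

section Comparison

variable {n : ℕ} {s p Λ : ℝ} {Ω : Set (Rn n)} {K : Rn n → Rn n → ℝ} {F : Rn n → ℝ → ℝ} {F₀ : ℝ}
  {u v : Rn n → ℝ}

/-- The interaction term of the energy, `∬_{𝒞_Ω} |u(x) - u(y)|^p K(x, y) dx dy`. -/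
noncomputable def interaction (p : ℝ) (K : Rn n → Rn n → ℝ) (Ω : Set (Rn n)) (u : Rn n → ℝ) :
    ℝ≥0∞ :=
  ∫⁻ z in crossSet Ω, ENNReal.ofReal (|u z.1 - u z.2| ^ p * K z.1 z.2)

/-- `u` minimizes the interaction energy up to an error `c |{v ≠ u}|`. This is all that the
regularity theory retains of a minimizer of `ℰ`, because `F` is bounded. -/
def IsAlmostMinimizer (p : ℝ) (K : Rn n → Rn n → ℝ) (c : ℝ) (Ω : Set (Rn n)) (u : Rn n → ℝ) :
    Prop :=
  ∀ v : Rn n → ℝ, Measurable v → tsupport (v - u) ⊆ Ω →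
    interaction p K Ω u ≤
      interaction p K Ω v + ENNReal.ofReal c * volume (Function.support (v - u))

theorem ereal_le_add_of_add_le_add {a b : ℝ≥0∞} {f g t : ℝ} (ht : 0 ≤ t) (hgf : g - f ≤ t)
    (h : (a : EReal) + f ≤ b + g) : a ≤ b + ENNReal.ofReal t := by
  have hab : (a : EReal) ≤ b + g - f :=
    EReal.le_sub_iff_add_le (.inl (EReal.coe_ne_bot f)) (.inl (EReal.coe_ne_top f)) |>.2 h
  rw [← EReal.coe_ennreal_le_coe_ennreal_iff, EReal.coe_ennreal_add, EReal.coe_ennreal_ofReal,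
    max_eq_left ht]
  calc (a : EReal) ≤ b + g - f := hab
    _ = b + ((g - f : ℝ) : EReal) := by
      rw [EReal.coe_sub, sub_eq_add_neg, sub_eq_add_neg, add_assoc]
    _ ≤ _ := by gcongr

theorem integrableOn_potential (hΩ : volume Ω ≠ ∞) (hF : SuperpositionMeasurable Ω F)
    (hFb : ∀ᵐ x ∂(volume.restrict Ω), ∀ t : ℝ, |F x t| ≤ F₀) (hu : Measurable u) :
    IntegrableOn (fun x => F x (u x)) Ω :=
  .of_bound hΩ.lt_top (hF u hu).aestronglyMeasurable F₀ (hFb.mono fun _ hx => hx _)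

theorem setIntegral_potential_sub_le (hΩ : volume Ω ≠ ∞) (hF : SuperpositionMeasurable Ω F)
    (hF₀ : 0 ≤ F₀) (hFb : ∀ᵐ x ∂(volume.restrict Ω), ∀ t : ℝ, |F x t| ≤ F₀) (hu : Measurable u)
    (hv : Measurable v) (hS : volume (Function.support (v - u)) ≠ ∞) :
    (∫ x in Ω, F x (v x)) - ∫ x in Ω, F x (u x) ≤
      2 * F₀ * volume.real (Function.support (v - u)) := by
  have hFu := integrableOn_potential hΩ hF hFb hu
  have hFv := integrableOn_potential hΩ hF hFb hv
  have hS_meas : MeasurableSet (Function.support (v - u)) := measurableSet_support (hv.sub hu)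
  have hbound : Integrable ((Function.support (v - u)).indicator fun _ => 2 * F₀) volume :=
    (integrable_indicator_iff hS_meas).2 (integrableOn_const hS)
  rw [← integral_sub hFv hFu]
  calc ∫ x in Ω, (F x (v x) - F x (u x)) ≤
        ∫ x in Ω, (Function.support (v - u)).indicator (fun _ => 2 * F₀) x := by
        refine integral_mono_ae (hFv.sub hFu) hbound.integrableOn ?_
        filter_upwards [hFb] with x hx
        by_cases hxS : x ∈ Function.support (v - u)
        · rw [indicator_of_mem hxS]
          linarith [(abs_le.1 (hx (v x))).2, (abs_le.1 (hx (u x))).1]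
        · have hvu : v x = u x := sub_eq_zero.1 (Function.notMem_support.1 hxS)
          rw [indicator_of_notMem hxS, hvu, sub_self]
    _ ≤ ∫ x, (Function.support (v - u)).indicator (fun _ => 2 * F₀) x :=
        setIntegral_le_integral hbound
          (ae_of_all _ (indicator_nonneg fun _ _ => by positivity))
    _ = _ := by
        rw [integral_indicator hS_meas, setIntegral_const, smul_eq_mul, mul_comm]

theorem IsMinimizer.isAlmostMinimizer (hp : 0 < p) (hΩ : volume Ω ≠ ∞)
    (hF : SuperpositionMeasurable Ω F) (hF₀ : 0 ≤ F₀)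
    (hFb : ∀ᵐ x ∂(volume.restrict Ω), ∀ t : ℝ, |F x t| ≤ F₀) (hu : Measurable u)
    (hmin : IsMinimizer s p K F Ω u) : IsAlmostMinimizer p K (4 * p * F₀) Ω u := by
  intro v hv hsupp
  have hS : volume (Function.support (v - u)) ≠ ∞ :=
    measure_ne_top_of_subset (subset_closure.trans hsupp) hΩ
  have henergy := hmin.2 (v - u) (hv.sub hu).aemeasurable hsupp
  simp only [Pi.sub_apply, add_sub_cancel] at henergy
  have hscaled := ereal_le_add_of_add_le_add (by positivity)
    (setIntegral_potential_sub_le hΩ hF hF₀ hFb hu hv hS) henergy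
  have hcancel (a : ℝ≥0∞) : ENNReal.ofReal (2 * p) * (ENNReal.ofReal (1 / (2 * p)) * a) = a := by
    rw [← mul_assoc, ← ENNReal.ofReal_mul (by positivity), mul_one_div_cancel (by positivity),
      ENNReal.ofReal_one, one_mul]
  calc interaction p K Ω u =
        ENNReal.ofReal (2 * p) * (ENNReal.ofReal (1 / (2 * p)) * interaction p K Ω u) :=
      (hcancel _).symm
    _ ≤ ENNReal.ofReal (2 * p) * (ENNReal.ofReal (1 / (2 * p)) * interaction p K Ω v +
        ENNReal.ofReal (2 * F₀ * volume.real (Function.support (v - u)))) :=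
      mul_le_mul' le_rfl hscaled
    _ = _ := by
      rw [mul_add, hcancel, ← ENNReal.ofReal_mul (by positivity), ← ENNReal.ofReal_toReal hS,
        ← ENNReal.ofReal_mul (by positivity), measureReal_def]
      ring_nf

theorem ofReal_norm_rpow_le (a : ℝ) (x : Rn n) : ENNReal.ofReal (‖x‖ ^ a) ≤ ‖x‖ₑ ^ a := by
  rcases eq_or_ne x 0 with rfl | hx
  · rcases lt_trichotomy a 0 with ha | rfl | ha
    · simp [Real.zero_rpow ha.ne]
    · simp
    · simp [Real.zero_rpow ha.ne']
  · rw [← ofReal_norm, ENNReal.ofReal_rpow_of_pos (norm_pos_iff.2 hx)]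

theorem IsAdmissibleKernel.lintegral_mul_le (hΛ : 0 ≤ Λ) (hK : IsAdmissibleKernel n s p Λ K)
    {g : Rn n × Rn n → ℝ} (hg : ∀ z, 0 ≤ g z) (S : Set (Rn n × Rn n)) :
    ∫⁻ z in S, ENNReal.ofReal (g z * K z.1 z.2) ≤
      ENNReal.ofReal Λ *
        ∫⁻ z in S, ENNReal.ofReal (g z) * ‖z.1 - z.2‖ₑ ^ (-((n : ℝ) + s * p)) := by
  rw [← lintegral_const_mul' _ _ ENNReal.ofReal_ne_top]
  refine lintegral_mono_ae (ae_restrict_of_ae ?_)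
  filter_upwards [hK.upper] with z hz
  calc ENNReal.ofReal (g z * K z.1 z.2)
      ≤ ENNReal.ofReal (Λ * (g z * ‖z.1 - z.2‖ ^ (-((n : ℝ) + s * p)))) := by
        refine ENNReal.ofReal_le_ofReal ((mul_le_mul_of_nonneg_left hz (hg z)).trans_eq ?_)
        rw [Real.rpow_neg (norm_nonneg _)]
        ring
    _ ≤ _ := by
        rw [ENNReal.ofReal_mul hΛ, ENNReal.ofReal_mul (hg z)]
        gcongr
        exact ofReal_norm_rpow_le _ _

theorem IsAdmissibleKernel.le_lintegral_mul (hΛ : 0 < Λ) (hK : IsAdmissibleKernel n s p Λ K)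
    {g : Rn n × Rn n → ℝ} (hg : ∀ z, 0 ≤ g z) (hdiag : ∀ z, z.1 = z.2 → g z = 0)
    (S : Set (Rn n × Rn n)) :
    ∫⁻ z in S, ENNReal.ofReal (g z) * ‖z.1 - z.2‖ₑ ^ (-((n : ℝ) + s * p)) ≤
      ENNReal.ofReal Λ * ∫⁻ z in S, ENNReal.ofReal (g z * K z.1 z.2) := by
  rw [← lintegral_const_mul' _ _ ENNReal.ofReal_ne_top]
  refine lintegral_mono_ae (ae_restrict_of_ae ?_)
  filter_upwards [hK.lower] with z hz
  by_cases h : z.1 = z.2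
  · simp [hdiag z h]
  · have hpos : 0 < ‖z.1 - z.2‖ := norm_pos_iff.2 (sub_ne_zero.2 h)
    rw [← ofReal_norm, ENNReal.ofReal_rpow_of_pos hpos, ← ENNReal.ofReal_mul (hg z),
      ← ENNReal.ofReal_mul hΛ.le]
    refine ENNReal.ofReal_le_ofReal ?_
    calc g z * ‖z.1 - z.2‖ ^ (-((n : ℝ) + s * p))
        = Λ * (g z * (1 / (Λ * ‖z.1 - z.2‖ ^ ((n : ℝ) + s * p)))) := by
          rw [Real.rpow_neg hpos.le]
          field_simp
      _ ≤ _ := mul_le_mul_of_nonneg_left (mul_le_mul_of_nonneg_left hz (hg z)) hΛ.le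

theorem MemW.interaction_lt_top (hΛ : 0 ≤ Λ) (hK : IsAdmissibleKernel n s p Λ K)
    (hu : MemW n s p Ω u) : interaction p K Ω u < ∞ := by
  calc interaction p K Ω u ≤ ∫⁻ z in crossSet Ω, ENNReal.ofReal Λ *
        ENNReal.ofReal (|u z.1 - u z.2| ^ p / ‖z.1 - z.2‖ ^ ((n : ℝ) + s * p)) := by
        refine lintegral_mono_ae (ae_restrict_of_ae ?_)
        filter_upwards [hK.upper] with z hz
        rw [← ENNReal.ofReal_mul hΛ, mul_div_left_comm]
        gcongr
    _ < ∞ := by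
        rw [lintegral_const_mul' _ _ ENNReal.ofReal_ne_top]
        exact ENNReal.mul_lt_top ENNReal.ofReal_lt_top hu.2.2

end Comparison

section Cutoff

variable {n : ℕ} {x₀ : Rn n} {r R : ℝ}

/-- A radial Lipschitz cutoff function between the balls of radii `r` and `(r + R) / 2`. -/
noncomputable def cutoff (x₀ : Rn n) (r R : ℝ) (x : Rn n) : ℝ :=
  max 0 (min 1 ((r + R - 2 * ‖x - x₀‖) / (R - r)))

theorem isCutoff_cutoff (x₀ : Rn n) (hrR : r < R) :
    IsCutoff (cutoff x₀ r R) (ball x₀ r) (ball x₀ ((r + R) / 2)) where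
  mem_Icc _ := ⟨le_max_left _ _, max_le zero_le_one (min_le_left _ _)⟩
  eq_one x hx := by
    rw [mem_ball_iff_norm] at hx
    have : 1 ≤ (r + R - 2 * ‖x - x₀‖) / (R - r) := by
      rw [le_div_iff₀ (by linarith)]
      linarith
    rw [cutoff, min_eq_left this, max_eq_right zero_le_one]
  eq_zero x hx := by
    rw [mem_ball_iff_norm, not_lt] at hx
    have : (r + R - 2 * ‖x - x₀‖) / (R - r) ≤ 0 :=
      div_nonpos_of_nonpos_of_nonneg (by linarith) (by linarith)
    rw [cutoff, min_eq_right (by linarith), max_eq_left this]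

theorem abs_cutoff_sub_le (hrR : r < R) (x y : Rn n) :
    |cutoff x₀ r R x - cutoff x₀ r R y| ≤ 2 / (R - r) * ‖x - y‖ := by
  have : 0 < R - r := by linarith
  have hclamp (a b : ℝ) : |max 0 (min 1 a) - max 0 (min 1 b)| ≤ |a - b| :=
    (abs_max_sub_max_le_max 0 _ 0 _).trans <| by
      simpa using (abs_min_sub_min_le_max 1 a 1 b)
  calc |cutoff x₀ r R x - cutoff x₀ r R y|
      ≤ |2 / (R - r) * (‖y - x₀‖ - ‖x - x₀‖)| := by
        refine (hclamp _ _).trans_eq ?_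
        congr 1
        ring
    _ = 2 / (R - r) * |‖y - x₀‖ - ‖x - x₀‖| := by rw [abs_mul, abs_of_pos (by positivity)]
    _ ≤ 2 / (R - r) * ‖x - y‖ := by
        have := abs_norm_sub_norm_le (y - x₀) (x - x₀)
        rw [sub_sub_sub_cancel_right, norm_sub_rev y x] at this
        gcongr

@[fun_prop]
theorem continuous_cutoff (x₀ : Rn n) (r R : ℝ) : Continuous (cutoff x₀ r R) := by
  unfold cutoff
  fun_prop

end Cutoff

theorem ofReal_posPart (a : ℝ) : ENNReal.ofReal a⁺ = ENNReal.ofReal a := by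
  rcases le_total a 0 with h | h
  · rw [posPart_of_nonpos h, ENNReal.ofReal_zero, ENNReal.ofReal_of_nonpos h]
  · rw [posPart_of_nonneg h]

section TruncationIntegrals

variable {n : ℕ} {s p : ℝ} {u ζ : Rn n → ℝ} {k : ℝ} {B₀ B₁ B₂ : Set (Rn n)} {x x₀ : Rn n}
  {r ρ R L : ℝ}

theorem measurable_truncation (hu : Measurable u) (hζ : Measurable ζ) :
    Measurable (truncation p u ζ k) := by
  unfold truncation
  simp only [posPart_def]
  fun_prop

theorem measurable_truncationError (hu : Measurable u) (hζ : Measurable ζ)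
    (hB₁ : MeasurableSet B₁) (hB₂ : MeasurableSet B₂) :
    Measurable fun z : Rn n × Rn n => truncationError p u ζ k B₁ B₂ z.1 z.2 := by
  unfold truncationError
  simp only [posPart_def]
  refine .add ?_ ?_
  · exact .ite ((measurable_fst hB₂).inter (measurable_snd hB₂)) (by fun_prop) measurable_const
  · exact .ite ((measurable_fst hB₁).inter (measurable_snd hB₂).compl) (by fun_prop)
      measurable_const

theorem measurable_truncationGain (hu : Measurable u) (hB₀ : MeasurableSet B₀)
    (hB₂ : MeasurableSet B₂) :
    Measurable fun z : Rn n × Rn n => truncationGain p u k B₀ B₂ z.1 z.2 := by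
  unfold truncationGain
  simp only [posPart_def]
  exact .ite ((measurable_fst hB₀).inter ((measurable_snd hB₂).inter
    (measurable_snd (measurableSet_le hu measurable_const)))) (by fun_prop) measurable_const

theorem support_truncation_sub_subset (hp : p ≠ 0) (hζ : ∀ x ∉ B₁, ζ x = 0) :
    Function.support (truncation p u ζ k - u) ⊆ B₁ ∩ {x | k < u x} := by
  intro x hx
  rw [Function.mem_support, Pi.sub_apply, sub_ne_zero] at hx
  exact ⟨by_contra fun h => hx (truncation_of_eq_zero hp (hζ x h)),
    not_le.1 fun h => hx (truncation_of_le h)⟩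

theorem lintegral_ball_truncationError_le (hn : n ≠ 0) (hs : s < 1) (hp : 1 < p) (hL : 0 ≤ L)
    (hR : 0 < R) (hζ : ∀ y, |ζ x - ζ y| ≤ L * ‖x - y‖) (hx : x ∈ ball x₀ R) :
    ∫⁻ y in ball x₀ R, ENNReal.ofReal (truncationError p u ζ k B₁ (ball x₀ R) x y) *
        ‖x - y‖ₑ ^ (-((n : ℝ) + s * p)) ≤
      ENNReal.ofReal (p ^ p * L ^ p * (radialConst n (p - s * p) * (2 * R) ^ (p - s * p))) *
        ENNReal.ofReal (u x - k) ^ p := by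
  have hp0 : 0 < p := by linarith
  have hb : 0 < p - s * p := by nlinarith
  set c := ENNReal.ofReal (p ^ p * L ^ p) * ENNReal.ofReal (u x - k) ^ p
  have hpt : ∀ y ∈ ball x₀ R, ENNReal.ofReal (truncationError p u ζ k B₁ (ball x₀ R) x y) ≤
      c * ‖y - x‖ₑ ^ p := by
    intro y hy
    have hζp : |ζ x - ζ y| ^ p ≤ L ^ p * ‖y - x‖ ^ p := by
      rw [← Real.mul_rpow hL (norm_nonneg _), norm_sub_rev]
      exact Real.rpow_le_rpow (abs_nonneg _) (hζ y) hp0.le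
    have herr : truncationError p u ζ k B₁ (ball x₀ R) x y ≤
        p ^ p * L ^ p * ((u x - k)⁺ ^ p * ‖y - x‖ ^ p) := by
      simp only [truncationError, hx, hy, and_self, if_true, not_true_eq_false, and_false,
        if_false, add_zero]
      calc _ ≤ p ^ p * (u x - k)⁺ ^ p * (L ^ p * ‖y - x‖ ^ p) := by gcongr
        _ = _ := by ring
    refine (ENNReal.ofReal_le_ofReal herr).trans_eq ?_
    rw [ENNReal.ofReal_mul (p := p ^ p * L ^ p) (by positivity),
      ENNReal.ofReal_mul (p := (u x - k)⁺ ^ p) (by positivity),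
      ← ENNReal.ofReal_rpow_of_nonneg (posPart_nonneg _) hp0.le, ofReal_posPart,
      ← ENNReal.ofReal_rpow_of_nonneg (norm_nonneg _) hp0.le, ofReal_norm, mul_assoc]
  calc _ ≤ ∫⁻ y in ball x₀ R, c * ‖y - x‖ₑ ^ (p - s * p - n) := by
        refine setLIntegral_mono' measurableSet_ball fun y hy => ?_
        refine (mul_le_mul' (hpt y hy) le_rfl).trans ?_
        rw [mul_assoc, enorm_sub_rev x y]
        gcongr
        rcases eq_or_ne y x with rfl | hyx
        · simp [ENNReal.zero_rpow_of_pos hp0]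
        · rw [← ENNReal.rpow_add _ _ (by simpa [sub_eq_zero] using hyx) enorm_ne_top]
          exact le_of_eq (by ring_nf)
    _ ≤ ∫⁻ y in ball x (2 * R), c * ‖y - x‖ₑ ^ (p - s * p - n) :=
        lintegral_mono_set <| ball_subset_ball' <| by
          linarith [mem_ball'.1 hx]
    _ = _ := by
        rw [lintegral_const_mul _ (by fun_prop), lintegral_ball_rpow hn x hb (by positivity),
          ENNReal.ofReal_mul (p := p ^ p * L ^ p) (by positivity)]
        ring

theorem lintegral_compl_ball_truncationError_le (hsp : 0 ≤ s * p) (hp : 1 < p) (hρR : ρ < R)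
    (hR : 0 < R) :
    ∫⁻ y in (ball x₀ R)ᶜ, ENNReal.ofReal (truncationError p u ζ k (ball x₀ ρ) (ball x₀ R) x y) *
        ‖x - y‖ₑ ^ (-((n : ℝ) + s * p)) ≤
      ENNReal.ofReal (p * (R / (R - ρ)) ^ ((n : ℝ) + s * p) * R ^ (-(s * p))) *
        tailPow n s p (fun y => ENNReal.ofReal (u y - k)) x₀ R * ENNReal.ofReal (u x - k) := by
  have hp0 : 0 < p := by linarith
  have hp1 : 0 ≤ p - 1 := by linarith
  have hRρ : 0 < R - ρ := by linarith
  have hcomp : ∀ y ∈ (ball x₀ R)ᶜ, x ∈ ball x₀ ρ →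
      ‖y - x₀‖ₑ ≤ ENNReal.ofReal (R / (R - ρ)) * ‖x - y‖ₑ := by
    intro y hy hx
    rw [mem_compl_iff, mem_ball_iff_norm, not_lt] at hy
    rw [mem_ball_iff_norm] at hx
    have htri : ‖y - x₀‖ ≤ ‖x - y‖ + ‖x - x₀‖ := by
      rw [norm_sub_rev x y, ← sub_add_sub_cancel y x x₀]
      exact norm_add_le _ _
    rw [← ofReal_norm, ← ofReal_norm, ← ENNReal.ofReal_mul (by positivity), div_mul_eq_mul_div]
    refine ENNReal.ofReal_le_ofReal ((le_div_iff₀ hRρ).2 ?_)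
    nlinarith [norm_nonneg (x - x₀)]
  set c := ENNReal.ofReal (p * (R / (R - ρ)) ^ ((n : ℝ) + s * p)) * ENNReal.ofReal (u x - k)
  calc _ ≤ ∫⁻ y in (ball x₀ R)ᶜ,
        c * (ENNReal.ofReal (u y - k) ^ (p - 1) * ‖y - x₀‖ₑ ^ (-((n : ℝ) + s * p))) := by
        refine setLIntegral_mono' measurableSet_ball.compl fun y hy => ?_
        have hy' : y ∉ ball x₀ R := hy
        by_cases hx : x ∈ ball x₀ ρ
        · have hker := rpow_neg_le_mul_rpow_neg (by positivity) (by positivity) (hcomp y hy hx)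
            (E := n + s * p)
          simp only [truncationError, hx, hy', and_false, if_false, not_false_eq_true, and_self,
            if_true, zero_add]
          rw [ENNReal.ofReal_mul hp0.le, ENNReal.ofReal_mul (posPart_nonneg _),
            ← ENNReal.ofReal_rpow_of_nonneg (posPart_nonneg _) hp1, ofReal_posPart, ofReal_posPart]
          refine (mul_le_mul' le_rfl hker).trans_eq ?_
          simp only [c]
          rw [ENNReal.ofReal_mul hp0.le]
          ring
        · simp [truncationError, hx, hy']
    _ = _ := by
        have hscale := ofReal_rpow_mul_ofReal_rpow_neg hR 1 (s * p)
        rw [one_mul, ENNReal.ofReal_one] at hscale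
        rw [lintegral_const_mul' _ _ (by finiteness),
          ENNReal.ofReal_mul (q := R ^ (-(s * p))) (by positivity), tailPow]
        simp only [c]
        rw [← one_mul (_ * _), ← hscale]
        ring

theorem lintegral_truncationError_le (hn : n ≠ 0) (hs0 : 0 ≤ s) (hs : s < 1) (hp : 1 < p)
    (hu : Measurable u) (hL : 0 ≤ L) (hρR : ρ < R) (hR : 0 < R)
    (hζ : ∀ x y, |ζ x - ζ y| ≤ L * ‖x - y‖) :
    ∫⁻ x, ∫⁻ y, ENNReal.ofReal (truncationError p u ζ k (ball x₀ ρ) (ball x₀ R) x y) *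
        ‖x - y‖ₑ ^ (-((n : ℝ) + s * p)) ≤
      ENNReal.ofReal (p ^ p * L ^ p * (radialConst n (p - s * p) * (2 * R) ^ (p - s * p))) *
          (∫⁻ x in ball x₀ R, ENNReal.ofReal (u x - k) ^ p) +
        ENNReal.ofReal (p * (R / (R - ρ)) ^ ((n : ℝ) + s * p) * R ^ (-(s * p))) *
          tailPow n s p (fun y => ENNReal.ofReal (u y - k)) x₀ R *
          ∫⁻ x in ball x₀ R, ENNReal.ofReal (u x - k) := by
  rw [← lintegral_const_mul _ (by fun_prop), ← lintegral_const_mul _ (by fun_prop),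
    ← lintegral_add_left (by fun_prop), ← lintegral_indicator measurableSet_ball]
  refine lintegral_mono fun x => ?_
  by_cases hx : x ∈ ball x₀ R
  · rw [indicator_of_mem hx, ← lintegral_add_compl _ (measurableSet_ball (x := x₀) (ε := R))]
    exact add_le_add (lintegral_ball_truncationError_le hn hs hp hL hR (hζ x) hx)
      (lintegral_compl_ball_truncationError_le (by positivity) hp hρR hR)
  · have hx' : x ∉ ball x₀ ρ := fun h => hx (ball_subset_ball hρR.le h)
    simp [truncationError, hx, hx']

/-- The double integral of the gain of the truncation of `u` at the level `k`, over the pairs in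
`B_r(x₀) × B_R(x₀)`. -/
noncomputable def gainIntegral (n : ℕ) (s p : ℝ) (u : Rn n → ℝ) (k : ℝ) (x₀ : Rn n) (r R : ℝ) :
    ℝ≥0∞ :=
  ∫⁻ x in ball x₀ r, ∫⁻ y in ball x₀ R ∩ {y | u y ≤ k},
    ENNReal.ofReal (u x - k) *
      max (ENNReal.ofReal (u x - k)) (ENNReal.ofReal (k - u y)) ^ (p - 1) *
      ‖x - y‖ₑ ^ (-((n : ℝ) + s * p))

theorem gainIntegral_le (hp : 1 < p) (hu : Measurable u) :
    gainIntegral n s p u k x₀ r R ≤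
      ∫⁻ z : Rn n × Rn n, ENNReal.ofReal (truncationGain p u k (ball x₀ r) (ball x₀ R) z.1 z.2) *
        ‖z.1 - z.2‖ₑ ^ (-((n : ℝ) + s * p)) := by
  have hm := measurable_truncationGain (p := p) (k := k) hu
    (measurableSet_ball (x := x₀) (ε := r)) (measurableSet_ball (x := x₀) (ε := R))
  rw [Measure.volume_eq_prod, lintegral_prod _ (by fun_prop)]
  refine (setLIntegral_mono' measurableSet_ball fun x hx => ?_).trans
    (setLIntegral_le_lintegral (ball x₀ r) _)
  refine (setLIntegral_mono' (measurableSet_ball.inter (measurableSet_le hu measurable_const))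
    fun y hy => ?_).trans (setLIntegral_le_lintegral _ _)
  have hyk : u y ≤ k := hy.2
  simp only [truncationGain, hx, hy.1, hyk, and_self, if_true]
  rw [ENNReal.ofReal_mul (posPart_nonneg _),
    ← ENNReal.ofReal_rpow_of_nonneg (le_max_of_le_left (posPart_nonneg _)) (by linarith),
    ENNReal.ofReal_max, ofReal_posPart, ofReal_posPart]

theorem lintegral_symmetrize {e : Rn n → Rn n → ℝ} (he : ∀ x y, 0 ≤ e x y)
    (hm : Measurable fun z : Rn n × Rn n => e z.1 z.2) (a : ℝ) :
    ∫⁻ z : Rn n × Rn n, ENNReal.ofReal (e z.1 z.2 + e z.2 z.1) * ‖z.1 - z.2‖ₑ ^ a =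
      2 * ∫⁻ x, ∫⁻ y, ENNReal.ofReal (e x y) * ‖x - y‖ₑ ^ a := by
  have : Measurable fun z : Rn n × Rn n => e z.2 z.1 := hm.comp measurable_swap
  have hmeas : Measurable fun z : Rn n × Rn n =>
      ENNReal.ofReal (e z.1 z.2) * ‖z.1 - z.2‖ₑ ^ a := by fun_prop
  have hmeas' : Measurable fun z : Rn n × Rn n =>
      ENNReal.ofReal (e z.2 z.1) * ‖z.1 - z.2‖ₑ ^ a := by fun_prop
  simp only [ENNReal.ofReal_add (he _ _) (he _ _), add_mul]
  rw [lintegral_add_left hmeas, Measure.volume_eq_prod, lintegral_prod _ hmeas.aemeasurable,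
    lintegral_prod_symm _ hmeas'.aemeasurable, two_mul]
  simp only [enorm_sub_rev]

end TruncationIntegrals

section Caccioppoli

/-- The right-hand side of the Caccioppoli inequality on `B_R(x₀)` at the level `k`, without the
scaling factor. -/
noncomputable def caccioppoliExcess (n : ℕ) (s p F₀ : ℝ) (u : Rn n → ℝ) (k : ℝ) (x₀ : Rn n)
    (R : ℝ) : ℝ≥0∞ :=
  (∫⁻ x in ball x₀ R, ENNReal.ofReal (u x - k) ^ p) +
    tailPow n s p (fun y => ENNReal.ofReal (u y - k)) x₀ R *
      (∫⁻ x in ball x₀ R, ENNReal.ofReal (u x - k)) +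
    ENNReal.ofReal (F₀ * R ^ (s * p)) * volume (ball x₀ R ∩ {x | k < u x})

/-- The fractional De Giorgi class: Caccioppoli inequalities with tails for the truncations
`(u - k)₊` on all balls in `U`. -/
def IsDeGiorgi (n : ℕ) (s p A F₀ : ℝ) (U : Set (Rn n)) (u : Rn n → ℝ) : Prop :=
  ∀ (x₀ : Rn n) (r R k : ℝ), 0 < r → r < R → closedBall x₀ R ⊆ U →
    gainIntegral n s p u k x₀ r R ≤
      ENNReal.ofReal (A * (R / (R - r)) ^ ((n : ℝ) + s * p + p) * R ^ (-(s * p))) *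
        caccioppoliExcess n s p F₀ u k x₀ R

variable {n : ℕ} {s p Λ c F₀ k : ℝ} {Ω B₀ B₁ B₂ : Set (Rn n)} {K : Rn n → Rn n → ℝ}
  {u ζ : Rn n → ℝ} {x₀ : Rn n} {r R : ℝ}

theorem interaction_truncation_add_le (hp : 1 < p)
    (hK : AEMeasurable fun z : Rn n × Rn n => K z.1 z.2) (hK0 : ∀ x y, 0 ≤ K x y)
    (hu : Measurable u) (hζ : IsCutoff ζ B₀ B₁) (hB₀ : MeasurableSet B₀)
    (hB₂ : MeasurableSet B₂) (h12 : B₁ ⊆ B₂) :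
    interaction p K Ω (truncation p u ζ k) +
        ∫⁻ z in crossSet Ω, ENNReal.ofReal (truncationGain p u k B₀ B₂ z.1 z.2 * K z.1 z.2) ≤
      interaction p K Ω u + ∫⁻ z in crossSet Ω,
        ENNReal.ofReal ((truncationError p u ζ k B₁ B₂ z.1 z.2 +
          truncationError p u ζ k B₁ B₂ z.2 z.1) * K z.1 z.2) := by
  have hgain : AEMeasurable (fun z : Rn n × Rn n =>
      ENNReal.ofReal (truncationGain p u k B₀ B₂ z.1 z.2 * K z.1 z.2))
      (volume.restrict (crossSet Ω)) :=
    ((measurable_truncationGain hu hB₀ hB₂).aemeasurable.mul hK).ennreal_ofReal.restrict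
  have hinteraction : AEMeasurable (fun z : Rn n × Rn n =>
      ENNReal.ofReal (|u z.1 - u z.2| ^ p * K z.1 z.2)) (volume.restrict (crossSet Ω)) := by
    have : Measurable fun z : Rn n × Rn n => |u z.1 - u z.2| ^ p := by fun_prop
    exact (this.aemeasurable.mul hK).ennreal_ofReal.restrict
  rw [interaction, interaction, ← lintegral_add_right' _ hgain,
    ← lintegral_add_left' hinteraction]
  refine lintegral_mono fun z => ?_
  have := hK0 z.1 z.2
  have := truncationError_nonneg hp u ζ k B₁ B₂ z.1 z.2
  have := truncationError_nonneg hp u ζ k B₁ B₂ z.2 z.1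
  have := truncationGain_nonneg (p := p) u k B₀ B₂ z.1 z.2
  rw [← ENNReal.ofReal_add (by positivity) (by positivity),
    ← ENNReal.ofReal_add (by positivity) (by positivity), ← add_mul, ← add_mul]
  refine ENNReal.ofReal_le_ofReal (mul_le_mul_of_nonneg_right ?_ ‹_›)
  exact abs_truncation_sub_rpow_add_gain_le hp h12 hζ z.1 z.2

theorem IsAlmostMinimizer.lintegral_gain_le (hp : 1 < p)
    (hK : AEMeasurable fun z : Rn n × Rn n => K z.1 z.2) (hK0 : ∀ x y, 0 ≤ K x y)
    (hu : Measurable u) (hfin : interaction p K Ω u ≠ ∞) (hmin : IsAlmostMinimizer p K c Ω u)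
    (hζm : Measurable ζ) (hζ : IsCutoff ζ B₀ B₁) (hB₀ : MeasurableSet B₀)
    (hB₂ : MeasurableSet B₂) (h12 : B₁ ⊆ B₂) (hB₁ : closure B₁ ⊆ Ω) :
    ∫⁻ z in crossSet Ω, ENNReal.ofReal (truncationGain p u k B₀ B₂ z.1 z.2 * K z.1 z.2) ≤
      (∫⁻ z in crossSet Ω, ENNReal.ofReal ((truncationError p u ζ k B₁ B₂ z.1 z.2 +
        truncationError p u ζ k B₁ B₂ z.2 z.1) * K z.1 z.2)) +
      ENNReal.ofReal c * volume (B₁ ∩ {x | k < u x}) := by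
  have hsupp := support_truncation_sub_subset (u := u) (k := k) (zero_lt_one.trans hp).ne'
    hζ.eq_zero
  have hcompare := hmin (truncation p u ζ k) (measurable_truncation hu hζm)
    ((closure_mono (hsupp.trans inter_subset_left)).trans hB₁)
  refine (ENNReal.add_le_add_iff_left hfin).1 ?_
  calc _ ≤ (interaction p K Ω (truncation p u ζ k) +
          ENNReal.ofReal c * volume (B₁ ∩ {x | k < u x})) + _ := by
        gcongr
        exact hcompare.trans (by gcongr)
    _ = _ := add_right_comm _ _ _
    _ ≤ _ := add_le_add_left (interaction_truncation_add_le hp hK hK0 hu hζ hB₀ hB₂ h12) _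
    _ = _ := add_assoc _ _ _

theorem setLIntegral_crossSet_gain (hB₀Ω : B₀ ⊆ Ω) (a : ℝ) :
    ∫⁻ z in crossSet Ω, ENNReal.ofReal (truncationGain p u k B₀ B₂ z.1 z.2) *
        ‖z.1 - z.2‖ₑ ^ a =
      ∫⁻ z : Rn n × Rn n, ENNReal.ofReal (truncationGain p u k B₀ B₂ z.1 z.2) *
        ‖z.1 - z.2‖ₑ ^ a := by
  refine setLIntegral_eq_of_support_subset fun z hz => ?_
  contrapose! hz
  have : z.1 ∉ B₀ := fun h => hz fun hc => hc.1 (hB₀Ω h)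
  simp [truncationGain, this]

theorem IsAlmostMinimizer.caccioppoli (hp : 1 < p) (hΛ : 0 < Λ)
    (hK : IsAdmissibleKernel n s p Λ K) (hu : Measurable u) (hfin : interaction p K Ω u ≠ ∞)
    (hmin : IsAlmostMinimizer p K c Ω u) (hζm : Measurable ζ) (hζ : IsCutoff ζ B₀ B₁)
    (hB₀ : MeasurableSet B₀) (hB₁ : MeasurableSet B₁) (hB₂ : MeasurableSet B₂) (h12 : B₁ ⊆ B₂)
    (hB₀Ω : B₀ ⊆ Ω) (hB₁Ω : closure B₁ ⊆ Ω) :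
    ∫⁻ z : Rn n × Rn n, ENNReal.ofReal (truncationGain p u k B₀ B₂ z.1 z.2) *
        ‖z.1 - z.2‖ₑ ^ (-((n : ℝ) + s * p)) ≤
      ENNReal.ofReal Λ * (ENNReal.ofReal Λ * (2 * ∫⁻ x, ∫⁻ y,
        ENNReal.ofReal (truncationError p u ζ k B₁ B₂ x y) *
          ‖x - y‖ₑ ^ (-((n : ℝ) + s * p))) +
      ENNReal.ofReal c * volume (B₁ ∩ {x | k < u x})) := by
  have hEr := truncationError_nonneg hp u ζ k B₁ B₂
  have hdiag (z : Rn n × Rn n) (hz : z.1 = z.2) : truncationGain p u k B₀ B₂ z.1 z.2 = 0 :=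
    truncationGain_eq_zero (hz ▸ le_or_gt _ _)
  rw [← setLIntegral_crossSet_gain hB₀Ω,
    ← lintegral_symmetrize hEr (measurable_truncationError hu hζm hB₁ hB₂)]
  refine (hK.le_lintegral_mul hΛ (fun z => truncationGain_nonneg _ _ _ _ _ _) hdiag _).trans ?_
  gcongr
  refine (hmin.lintegral_gain_le hp hK.aemeasurable hK.nonneg hu hfin hζm hζ hB₀ hB₂ h12
    hB₁Ω).trans ?_
  gcongr
  refine (hK.lintegral_mul_le hΛ.le (fun z => add_nonneg (hEr _ _) (hEr _ _)) _).trans ?_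
  gcongr
  exact Measure.restrict_le_self

theorem lipschitz_scale_le (hr : 0 < r) (hrR : r < R) (hp : 0 ≤ p) {a E : ℝ} (ha : 0 ≤ a)
    (hE : 0 ≤ E) :
    p ^ p * (2 / (R - r)) ^ p * (a * (2 * R) ^ (p - s * p)) ≤
      p ^ p * 2 ^ p * a * 2 ^ (p - s * p) * ((R / (R - r)) ^ (E + p) * R ^ (-(s * p))) := by
  have hR : 0 < R := hr.trans hrR
  have hRr : 0 < R - r := sub_pos.2 hrR
  have hq : 1 ≤ R / (R - r) := (one_le_div hRr).2 (by linarith)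
  calc _ = p ^ p * 2 ^ p * a * 2 ^ (p - s * p) * ((R / (R - r)) ^ p * R ^ (-(s * p))) := by
        rw [Real.div_rpow two_pos.le hRr.le, Real.div_rpow hR.le hRr.le,
          Real.mul_rpow two_pos.le hR.le, sub_eq_add_neg p, Real.rpow_add hR]
        ring
    _ ≤ _ := by
        gcongr
        exact le_add_of_nonneg_left hE

theorem tail_scale_le (hr : 0 < r) (hrR : r < R) (hp : 0 ≤ p) (E : ℝ) :
    p * (R / (R - (r + R) / 2)) ^ E * R ^ (-(s * p)) ≤
      p * 2 ^ E * ((R / (R - r)) ^ (E + p) * R ^ (-(s * p))) := by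
  have hR : 0 < R := hr.trans hrR
  have hRr : 0 < R - r := sub_pos.2 hrR
  have hq : 1 ≤ R / (R - r) := (one_le_div hRr).2 (by linarith)
  have hhalf : R / (R - (r + R) / 2) = 2 * (R / (R - r)) := by
    rw [show R - (r + R) / 2 = (R - r) / 2 by ring]
    field_simp
  rw [hhalf, Real.mul_rpow two_pos.le (by positivity), ← mul_assoc, ← mul_assoc]
  gcongr
  exact le_add_of_nonneg_right hp

theorem potential_scale_le (hr : 0 < r) (hrR : r < R) (hF₀ : 0 ≤ F₀) {E : ℝ} (hE : 0 ≤ E) :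
    F₀ ≤ (R / (R - r)) ^ E * R ^ (-(s * p)) * (F₀ * R ^ (s * p)) := by
  have hR : 0 < R := hr.trans hrR
  have hRr : 0 < R - r := sub_pos.2 hrR
  calc F₀ ≤ (R / (R - r)) ^ E * F₀ :=
        le_mul_of_one_le_left hF₀
          (Real.one_le_rpow ((one_le_div hRr).2 (by linarith)) hE)
    _ = (R / (R - r)) ^ E * (R ^ (-(s * p)) * R ^ (s * p)) * F₀ := by
        rw [← Real.rpow_add hR, neg_add_cancel, Real.rpow_zero, mul_one]
    _ = _ := by ring

/-- The constant of the De Giorgi class to which minimizers belong. -/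
noncomputable def caccioppoliConst (n : ℕ) (s p Λ : ℝ) : ℝ :=
  Λ * (2 * Λ * (p ^ p * 2 ^ p * radialConst n (p - s * p) * 2 ^ (p - s * p)) +
    2 * Λ * (p * 2 ^ ((n : ℝ) + s * p)) + 4 * p)

theorem caccioppoliConst_pos (hs : s < 1) (hp : 0 < p) (hΛ : 0 < Λ) :
    0 < caccioppoliConst n s p Λ := by
  have := radialConst_nonneg n (show 0 < p - s * p by nlinarith)
  unfold caccioppoliConst
  positivity

theorem ofReal_mul_add_le_of_le {Λ c₁ c₂ c₃ D : ℝ} (hΛ : 0 ≤ Λ) (hc₁ : 0 ≤ c₁) (hc₂ : 0 ≤ c₂)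
    (hc₃ : 0 ≤ c₃) (hD : 0 ≤ D) (I J V : ℝ≥0∞) :
    ENNReal.ofReal Λ * (ENNReal.ofReal Λ * (2 * (ENNReal.ofReal (c₁ * D) * I +
        ENNReal.ofReal (c₂ * D) * J)) + ENNReal.ofReal (c₃ * D) * V) ≤
      ENNReal.ofReal (Λ * (2 * Λ * c₁ + 2 * Λ * c₂ + c₃) * D) * (I + J + V) := by
  have htwo : (2 : ℝ≥0∞) = ENNReal.ofReal 2 := by simp
  have hsum : Λ * (2 * Λ * c₁ + 2 * Λ * c₂ + c₃) * D =
      Λ * (Λ * (2 * (c₁ * D))) + Λ * (Λ * (2 * (c₂ * D))) + Λ * (c₃ * D) := by ring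
  rw [hsum, ENNReal.ofReal_add (by positivity) (by positivity),
    ENNReal.ofReal_add (by positivity) (by positivity)]
  simp only [ENNReal.ofReal_mul hΛ, ENNReal.ofReal_mul two_pos.le, ← htwo, mul_add]
  simp only [← mul_assoc, add_assoc]
  gcongr
  · exact le_self_add
  · exact le_add_of_nonneg_of_le zero_le le_self_add
  · exact le_add_of_nonneg_of_le zero_le (le_add_of_nonneg_left zero_le)

theorem IsAlmostMinimizer.isDeGiorgi (hn : n ≠ 0) (hs0 : 0 ≤ s) (hs : s < 1) (hp : 1 < p)
    (hΛ : 0 < Λ) (hK : IsAdmissibleKernel n s p Λ K) (hF₀ : 0 ≤ F₀) (hu : Measurable u)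
    (hfin : interaction p K Ω u ≠ ∞) (hmin : IsAlmostMinimizer p K (4 * p * F₀) Ω u) :
    IsDeGiorgi n s p (caccioppoliConst n s p Λ) F₀ Ω u := by
  intro x₀ r R k hr hrR hball
  have hR : 0 < R := hr.trans hrR
  have : 0 < R - r := sub_pos.2 hrR
  have hmid : (r + R) / 2 < R := by linarith
  have hclosure : closure (ball x₀ ((r + R) / 2)) ⊆ Ω :=
    (closure_ball_subset_closedBall.trans (closedBall_subset_closedBall hmid.le)).trans hball
  have hE : 0 ≤ (n : ℝ) + s * p := by positivity
  have ha := radialConst_nonneg n (show 0 < p - s * p by nlinarith)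
  have hcaccioppoli := hmin.caccioppoli (k := k) hp hΛ hK hu hfin
    (continuous_cutoff x₀ r R).measurable (isCutoff_cutoff x₀ hrR) measurableSet_ball
    measurableSet_ball measurableSet_ball (ball_subset_ball hmid.le)
    ((ball_subset_closedBall.trans (closedBall_subset_closedBall hrR.le)).trans hball) hclosure
  have herror := lintegral_truncationError_le (k := k) (x₀ := x₀) hn hs0 hs hp hu (by positivity)
    hmid hR (abs_cutoff_sub_le (x₀ := x₀) hrR)
  have hF : 4 * p * F₀ ≤ 4 * p * ((R / (R - r)) ^ ((n : ℝ) + s * p + p) * R ^ (-(s * p))) *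
      (F₀ * R ^ (s * p)) := by
    rw [mul_assoc (4 * p)]
    exact mul_le_mul_of_nonneg_left (potential_scale_le hr hrR hF₀ (by positivity)) (by positivity)
  rw [caccioppoliConst, mul_assoc _ ((R / (R - r)) ^ _)]
  refine (gainIntegral_le hp hu).trans (hcaccioppoli.trans (le_trans ?_
    (ofReal_mul_add_le_of_le hΛ.le (by positivity) (by positivity) (by positivity) (by positivity)
      _ _ _)))
  rw [← mul_assoc (ENNReal.ofReal (4 * p * _)), ← ENNReal.ofReal_mul (by positivity)]
  gcongr
  · refine herror.trans ?_
    rw [mul_assoc (ENNReal.ofReal (p * _ * _))]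
    exact add_le_add
      (mul_le_mul_left (ENNReal.ofReal_le_ofReal
        (lipschitz_scale_le hr hrR (by positivity) ha hE)) _)
      (mul_le_mul_left (ENNReal.ofReal_le_ofReal
        (tail_scale_le hr hrR (by positivity) _)) _)

end Caccioppoli

section Iteration

variable {n : ℕ} {s p A F₀ : ℝ} {U B : Set (Rn n)} {u : Rn n → ℝ} {x₀ : Rn n}
  {r R ρ k d α t : ℝ}

theorem ennreal_mul_rpow_sub_one (hp : 1 ≤ p) (a : ℝ≥0∞) : a * a ^ (p - 1) = a ^ p := by
  simpa using (ENNReal.rpow_add_of_nonneg (x := a) 1 (p - 1) zero_le_one (sub_nonneg.2 hp)).symm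

theorem le_ofReal_div_of_mul_le {a b : ℝ} {X : ℝ≥0∞} (ha : 0 < a)
    (h : ENNReal.ofReal a * X ≤ ENNReal.ofReal b) : X ≤ ENNReal.ofReal (b / a) := by
  rwa [ENNReal.ofReal_div_of_pos ha, ENNReal.le_div_iff_mul_le (by simp [ha]) (by simp), mul_comm]

theorem ofReal_rpow_neg_le_enorm_rpow_neg {x : Rn n} {E : ℝ} (hρ : 0 < ρ) (hE : 0 ≤ E)
    (hx : ‖x‖ ≤ ρ) : ENNReal.ofReal (ρ ^ (-E)) ≤ ‖x‖ₑ ^ (-E) := by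
  rw [← ENNReal.ofReal_rpow_of_pos hρ, ENNReal.rpow_neg, ENNReal.rpow_neg, ENNReal.inv_le_inv,
    ← ofReal_norm]
  gcongr

theorem volume_superlevel_le (hp : 0 ≤ p) (hu : Measurable u) (hB : MeasurableSet B) (hd : 0 < d)
    (hα : ∫⁻ x in B, ENNReal.ofReal (u x - k) ^ p ≤ ENNReal.ofReal α) :
    volume (B ∩ {x | k + d < u x}) ≤ ENNReal.ofReal (α / d ^ p) := by
  refine le_ofReal_div_of_mul_le (by positivity) (le_trans ?_ hα)
  rw [← setLIntegral_const]
  refine (setLIntegral_mono' (hB.inter (measurableSet_lt measurable_const hu)) fun x hx => ?_).trans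
    (lintegral_mono_set inter_subset_left)
  have hx : k + d < u x := hx.2
  rw [ENNReal.ofReal_rpow_of_pos (by linarith)]
  exact ENNReal.ofReal_le_ofReal (Real.rpow_le_rpow hd.le (by linarith) hp)

theorem lintegral_excess_add_le (hp : 1 ≤ p) (hd : 0 < d)
    (hα : ∫⁻ x in B, ENNReal.ofReal (u x - k) ^ p ≤ ENNReal.ofReal α) :
    ∫⁻ x in B, ENNReal.ofReal (u x - (k + d)) ≤ ENNReal.ofReal (α / d ^ (p - 1)) := by
  refine le_ofReal_div_of_mul_le (by positivity) (le_trans ?_ hα)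
  rw [← lintegral_const_mul' _ _ ENNReal.ofReal_ne_top]
  refine lintegral_mono fun x => ?_
  rcases le_or_gt (u x) (k + d) with h | h
  · simp [ENNReal.ofReal_of_nonpos (sub_nonpos.2 h)]
  · rw [← ennreal_mul_rpow_sub_one hp, mul_comm, ENNReal.ofReal_rpow_of_pos (by linarith)]
    gcongr <;> linarith

theorem volume_real_unitBall_pos (n : ℕ) : 0 < volume.real (ball (0 : Rn n) 1) :=
  ENNReal.toReal_pos (measure_ball_pos volume 0 one_pos).ne' measure_ball_lt_top.ne

theorem half_volume_le_volume_sublevel {x : Rn n} {l : ℝ} (hρ : 0 < ρ)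
    (hsub : ball x ρ ⊆ ball x₀ R)
    (hvol : volume (ball x₀ R ∩ {x | l < u x}) ≤
      ENNReal.ofReal (ρ ^ n * volume.real (ball (0 : Rn n) 1) / 2)) :
    ENNReal.ofReal (ρ ^ n * volume.real (ball (0 : Rn n) 1) / 2) ≤
      volume (ball x ρ ∩ {y | u y ≤ l}) := by
  have hcover : volume (ball x ρ) ≤
      volume (ball x ρ ∩ {y | u y ≤ l}) + volume (ball x₀ R ∩ {x | l < u x}) := by
    refine (measure_mono fun y hy => ?_).trans (measure_union_le _ _)
    exact (le_or_gt (u y) l).imp (fun h => ⟨hy, h⟩) fun h => ⟨hsub hy, h⟩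
  have := volume_real_unitBall_pos n
  rw [volume_ball_eq x hρ, ← add_halves (ρ ^ n * _),
    ENNReal.ofReal_add (by positivity) (by positivity)] at hcover
  exact (ENNReal.add_le_add_iff_right ENNReal.ofReal_ne_top).1
    (hcover.trans (add_le_add_right hvol _))

/-- An elementary fractional Faber–Krahn inequality: half of every ball of radius `ρ` lies below
the level `l`, so each point above the level interacts with a volume of order `ρⁿ`. -/
theorem lintegral_rpow_le_gainIntegral (hs : 0 ≤ s) (hp : 1 ≤ p) {l : ℝ} (hu : Measurable u)
    (hρ : 0 < ρ) (hρR : ρ ≤ R - r)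
    (hvol : volume (ball x₀ R ∩ {x | l < u x}) ≤
      ENNReal.ofReal (ρ ^ n * volume.real (ball (0 : Rn n) 1) / 2)) :
    ENNReal.ofReal (volume.real (ball (0 : Rn n) 1) / 2 * ρ ^ (-(s * p))) *
        (∫⁻ x in ball x₀ r, ENNReal.ofReal (u x - l) ^ p) ≤
      gainIntegral n s p u l x₀ r R := by
  have hω := volume_real_unitBall_pos n
  set ω := volume.real (ball (0 : Rn n) 1)
  rw [gainIntegral, ← lintegral_const_mul' _ _ ENNReal.ofReal_ne_top]
  refine setLIntegral_mono' measurableSet_ball fun x hx => ?_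
  have hsub : ball x ρ ⊆ ball x₀ R := ball_subset_ball' (by linarith [mem_ball.1 hx])
  calc _ = ENNReal.ofReal (u x - l) ^ p * ENNReal.ofReal (ρ ^ (-((n : ℝ) + s * p))) *
        ENNReal.ofReal (ρ ^ n * ω / 2) := by
        rw [mul_comm, mul_assoc, ← ENNReal.ofReal_mul (by positivity),
          show -(s * p) = -((n : ℝ) + s * p) + n by ring, Real.rpow_add hρ, Real.rpow_natCast]
        congr 2
        ring
    _ ≤ ENNReal.ofReal (u x - l) ^ p * ENNReal.ofReal (ρ ^ (-((n : ℝ) + s * p))) *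
        volume (ball x ρ ∩ {y | u y ≤ l}) := by
        gcongr
        exact half_volume_le_volume_sublevel hρ hsub hvol
    _ = ∫⁻ _ in ball x ρ ∩ {y | u y ≤ l},
        ENNReal.ofReal (u x - l) ^ p * ENNReal.ofReal (ρ ^ (-((n : ℝ) + s * p))) := by
        rw [setLIntegral_const]
    _ ≤ ∫⁻ y in ball x ρ ∩ {y | u y ≤ l}, ENNReal.ofReal (u x - l) *
        max (ENNReal.ofReal (u x - l)) (ENNReal.ofReal (l - u y)) ^ (p - 1) *
          ‖x - y‖ₑ ^ (-((n : ℝ) + s * p)) := by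
        refine setLIntegral_mono' (measurableSet_ball.inter (measurableSet_le hu measurable_const))
          fun y hy => mul_le_mul' ?_
            (ofReal_rpow_neg_le_enorm_rpow_neg hρ (by positivity) (mem_ball_iff_norm'.1 hy.1).le)
        rw [← ennreal_mul_rpow_sub_one hp]
        gcongr
        exact le_max_left _ _
    _ ≤ _ := lintegral_mono_set (inter_subset_inter_left _ hsub)

theorem caccioppoliExcess_add_le (hp : 1 ≤ p) (hF₀ : 0 ≤ F₀) (hu : Measurable u) (hR : 0 < R)
    (hd : 0 < d) (hα0 : 0 ≤ α) (ht0 : 0 ≤ t)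
    (hα : ∫⁻ x in ball x₀ R, ENNReal.ofReal (u x - k) ^ p ≤ ENNReal.ofReal α)
    (ht : tailPow n s p (fun y => ENNReal.ofReal (u y - (k + d))) x₀ R ≤ ENNReal.ofReal t) :
    caccioppoliExcess n s p F₀ u (k + d) x₀ R ≤
      ENNReal.ofReal ((1 + t / d ^ (p - 1) + F₀ * R ^ (s * p) / d ^ p) * α) := by
  have hα' : ∫⁻ x in ball x₀ R, ENNReal.ofReal (u x - (k + d)) ^ p ≤ ENNReal.ofReal α := by
    refine (lintegral_mono fun x => ?_).trans hα
    gcongr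
    linarith
  have hsplit : (1 + t / d ^ (p - 1) + F₀ * R ^ (s * p) / d ^ p) * α =
      α + t * (α / d ^ (p - 1)) + F₀ * R ^ (s * p) * (α / d ^ p) := by ring
  rw [caccioppoliExcess, hsplit, ENNReal.ofReal_add (by positivity) (by positivity),
    ENNReal.ofReal_add (by positivity) (by positivity), ENNReal.ofReal_mul ht0,
    ENNReal.ofReal_mul (p := F₀ * R ^ (s * p)) (by positivity)]
  gcongr
  · exact lintegral_excess_add_le hp hd hα
  · exact volume_superlevel_le (by positivity) hu measurableSet_ball hd hα

theorem IsDeGiorgi.lintegral_excess_add_le (hs : 0 ≤ s) (hp : 1 ≤ p) (hA : 0 ≤ A) (hF₀ : 0 ≤ F₀)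
    (hu : Measurable u) (hDG : IsDeGiorgi n s p A F₀ U u) (hr : 0 < r) (hρ : 0 < ρ)
    (hρR : ρ ≤ R - r) (hd : 0 < d) (hball : closedBall x₀ R ⊆ U) (hα0 : 0 ≤ α) (ht0 : 0 ≤ t)
    (hα : ∫⁻ x in ball x₀ R, ENNReal.ofReal (u x - k) ^ p ≤ ENNReal.ofReal α)
    (hαρ : α ≤ volume.real (ball (0 : Rn n) 1) / 2 * ρ ^ n * d ^ p)
    (ht : tailPow n s p (fun y => ENNReal.ofReal (u y - (k + d))) x₀ R ≤ ENNReal.ofReal t) :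
    ∫⁻ x in ball x₀ r, ENNReal.ofReal (u x - (k + d)) ^ p ≤
      ENNReal.ofReal (2 / volume.real (ball (0 : Rn n) 1) * ρ ^ (s * p) *
        (A * (R / (R - r)) ^ ((n : ℝ) + s * p + p) * R ^ (-(s * p))) *
        (1 + t / d ^ (p - 1) + F₀ * R ^ (s * p) / d ^ p) * α) := by
  have hRr : 0 < R - r := hρ.trans_le hρR
  have hR : 0 < R := by linarith
  have hω := volume_real_unitBall_pos n
  have hvol : volume (ball x₀ R ∩ {x | k + d < u x}) ≤
      ENNReal.ofReal (ρ ^ n * volume.real (ball (0 : Rn n) 1) / 2) := by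
    refine (volume_superlevel_le (by positivity) hu measurableSet_ball hd hα).trans
      (ENNReal.ofReal_le_ofReal ?_)
    rw [div_le_iff₀ (by positivity)]
    linarith
  have hgain := (lintegral_rpow_le_gainIntegral hs hp hu hρ hρR hvol).trans
    ((hDG x₀ r R (k + d) hr (by linarith) hball).trans
      (mul_le_mul_right (caccioppoliExcess_add_le hp hF₀ hu hR hd hα0 ht0 hα ht) _))
  rw [← ENNReal.ofReal_mul (by positivity)] at hgain
  refine (le_ofReal_div_of_mul_le (by positivity) hgain).trans_eq (congrArg _ ?_)
  rw [Real.rpow_neg hρ.le]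
  field_simp

end Iteration

section DeGiorgiLemma

variable {n : ℕ} {s p A B F₀ : ℝ} {U : Set (Rn n)} {u : Rn n → ℝ} {x₀ : Rn n}
  {R k M θ e : ℝ}

theorem tailPow_le_of_le_two_mul {f : Rn n → ℝ≥0∞} {R' : ℝ} (hsp : 0 ≤ s * p) (hR : 0 < R)
    (hR' : R ≤ R') (hR'2 : R' ≤ 2 * R) :
    tailPow n s p f x₀ R' ≤ ENNReal.ofReal (2 ^ (s * p)) * tailPow n s p f x₀ R := by
  rw [tailPow, tailPow, ← mul_assoc, ← ENNReal.ofReal_mul (by positivity),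
    ← Real.mul_rpow two_pos.le hR.le]
  exact mul_le_mul' (ENNReal.ofReal_le_ofReal (Real.rpow_le_rpow (by linarith) hR'2 hsp))
    (lintegral_mono_set (compl_subset_compl.2 (ball_subset_ball hR')))

/-- The exponent `κ` for which the radii `ρ = R θ e^κ` of the balls in the Faber–Krahn inequality
make the constants in De Giorgi's iteration independent of the scale `e`. -/
noncomputable def deGiorgiExponent (n : ℕ) (s p : ℝ) : ℝ :=
  ((n : ℝ) + s * p + 2 * p) / (s * p)

/-- The bound for the excess over `k + M (1 - e)` in the ball of radius `R (1 + e)` that is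
propagated by De Giorgi's iteration. It is the largest one for which the levels `k + M (1 - e / 2)`
are exceeded in at most half of the volume of a ball of radius `R θ e^κ`. -/
noncomputable def excessBound (n : ℕ) (s p R M θ e : ℝ) : ℝ :=
  volume.real (ball (0 : Rn n) 1) / 2 * (R * θ * e ^ deGiorgiExponent n s p) ^ n *
    (M * (e / 2)) ^ p

/-- The constant in one step of De Giorgi's iteration, up to the factor `θ^{sp}`. -/
noncomputable def deGiorgiStepConst (n : ℕ) (s p A B : ℝ) : ℝ :=
  2 / volume.real (ball (0 : Rn n) 1) * A * 4 ^ ((n : ℝ) + s * p + p) * 2 ^ p *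
    (1 + 2 ^ (s * p) * (B + 1))

theorem deGiorgiExponent_mul (hsp : 0 < s * p) :
    deGiorgiExponent n s p * (s * p) = (n : ℝ) + s * p + 2 * p :=
  div_mul_cancel₀ _ hsp.ne'

theorem one_le_deGiorgiExponent (hsp : 0 < s * p) (hp : 0 ≤ p) : 1 ≤ deGiorgiExponent n s p := by
  rw [deGiorgiExponent, one_le_div hsp]
  linarith [(Nat.cast_nonneg n : (0 : ℝ) ≤ n)]

theorem excessBound_nonneg (hR : 0 ≤ R) (hM : 0 ≤ M) (hθ : 0 ≤ θ) (he : 0 ≤ e) :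
    0 ≤ excessBound n s p R M θ e := by
  unfold excessBound
  positivity

theorem deGiorgiStepConst_pos (hA : 0 < A) (hB : 0 ≤ B) : 0 < deGiorgiStepConst n s p A B := by
  have := volume_real_unitBall_pos n
  unfold deGiorgiStepConst
  positivity

theorem excessBound_half (hM : 0 ≤ M) (he : 0 ≤ e) :
    excessBound n s p R M θ (e / 2) =
      2 ^ (-(deGiorgiExponent n s p * n + p)) * excessBound n s p R M θ e := by
  have hM' : (M * (e / 2 / 2)) ^ p = (M * (e / 2)) ^ p / 2 ^ p := by
    rw [← Real.div_rpow (by positivity) two_pos.le, mul_div_assoc]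
  rw [excessBound, excessBound, hM', Real.div_rpow he two_pos.le, Real.rpow_neg two_pos.le,
    Real.rpow_add two_pos, Real.rpow_mul two_pos.le, Real.rpow_natCast, mul_pow _ (_ / _),
    mul_pow _ (e ^ _), div_pow]
  field_simp

theorem excessBound_two_pow_neg (hM : 0 ≤ M) (j : ℕ) :
    excessBound n s p R M θ ((1 / 2) ^ j) =
      excessBound n s p R M θ 1 * (2 ^ (-(deGiorgiExponent n s p * n + p))) ^ j := by
  induction j with
  | zero => simp
  | succ j ih =>
    rw [pow_succ, mul_one_div, excessBound_half hM (by positivity), ih]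
    ring

theorem excess_scale_factor_le {E q : ℝ} (hR : 0 < R) (he : 0 < e) (he1 : e ≤ 1) (hE : 0 ≤ E)
    (hq : 0 ≤ q) :
    (R * (1 + e) / (R * (1 + e) - R * (1 + e / 2))) ^ E * (R * (1 + e)) ^ (-q) ≤
      (4 / e) ^ E * R ^ (-q) := by
  have hgap : R * (1 + e) - R * (1 + e / 2) = R * (e / 2) := by ring
  have hratio : R * (1 + e) / (R * (e / 2)) ≤ 4 / e := by
    rw [div_le_div_iff₀ (by positivity) he]
    nlinarith [mul_pos hR he]
  rw [hgap]
  gcongr ?_ * ?_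
  · exact Real.rpow_le_rpow (by positivity) hratio hE
  · exact Real.rpow_le_rpow_of_nonpos hR (by nlinarith) (by linarith)

theorem excess_data_factor_le (hp : 0 ≤ p) (hsp : 0 ≤ s * p) (hB : 0 ≤ B) (hF₀ : 0 ≤ F₀)
    (hR : 0 < R) (hM : 0 < M) (he : 0 < e) (he1 : e ≤ 1) (hFM : F₀ * R ^ (s * p) ≤ M ^ p) :
    1 + 2 ^ (s * p) * (B * M ^ (p - 1)) / (M * (e / 2)) ^ (p - 1) +
        F₀ * (R * (1 + e)) ^ (s * p) / (M * (e / 2)) ^ p ≤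
      (1 + 2 ^ (s * p) * (B + 1)) * ((e / 2) ^ p)⁻¹ := by
  have hone : 1 ≤ ((e / 2) ^ p)⁻¹ :=
    (one_le_inv₀ (by positivity)).2 (Real.rpow_le_one (by positivity) (by linarith) hp)
  have htail : 2 ^ (s * p) * (B * M ^ (p - 1)) / (M * (e / 2)) ^ (p - 1) ≤
      2 ^ (s * p) * B * ((e / 2) ^ p)⁻¹ := by
    have : (e / 2) ^ p ≤ (e / 2) ^ (p - 1) :=
      Real.rpow_le_rpow_of_exponent_ge (by positivity) (by linarith) (by linarith)
    calc _ = 2 ^ (s * p) * B * ((e / 2) ^ (p - 1))⁻¹ := by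
          rw [Real.mul_rpow hM.le (by positivity)]
          field_simp
      _ ≤ _ := by gcongr
  have hforce : F₀ * (R * (1 + e)) ^ (s * p) / (M * (e / 2)) ^ p ≤
      2 ^ (s * p) * ((e / 2) ^ p)⁻¹ := by
    have : (R * (1 + e)) ^ (s * p) ≤ 2 ^ (s * p) * R ^ (s * p) := by
      rw [← Real.mul_rpow two_pos.le hR.le]
      exact Real.rpow_le_rpow (by positivity) (by nlinarith) hsp
    rw [Real.mul_rpow hM.le (by positivity), div_le_iff₀ (by positivity)]
    calc _ ≤ F₀ * (2 ^ (s * p) * R ^ (s * p)) := by gcongr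
      _ = 2 ^ (s * p) * (F₀ * R ^ (s * p)) := by ring
      _ ≤ 2 ^ (s * p) * M ^ p := by gcongr
      _ = _ := by field_simp
  linarith

theorem excess_step_const_eq {a c : ℝ} (hsp : 0 < s * p) (hR : 0 < R) (hθ : 0 < θ) (he : 0 < e) :
    a * (R * θ * e ^ deGiorgiExponent n s p) ^ (s * p) *
        (A * ((4 / e) ^ ((n : ℝ) + s * p + p) * R ^ (-(s * p)))) * (c * ((e / 2) ^ p)⁻¹) =
      a * A * 4 ^ ((n : ℝ) + s * p + p) * 2 ^ p * c * θ ^ (s * p) := by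
  have hscale : e ^ ((n : ℝ) + s * p + 2 * p) = e ^ ((n : ℝ) + s * p + p) * e ^ p := by
    rw [← Real.rpow_add he]
    ring_nf
  rw [Real.mul_rpow (by positivity) (by positivity), Real.mul_rpow hR.le hθ.le,
    ← Real.rpow_mul he.le, deGiorgiExponent_mul hsp, hscale, Real.div_rpow (by norm_num) he.le,
    Real.div_rpow he.le two_pos.le, Real.rpow_neg hR.le]
  field_simp

theorem exists_mul_rpow_le {C δ q : ℝ} (hC : 0 < C) (hδ : 0 < δ) (hq : 0 < q) :
    ∃ θ : ℝ, 0 < θ ∧ θ ≤ 1 / 2 ∧ C * θ ^ q ≤ δ := by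
  refine ⟨min (1 / 2) ((δ / C) ^ q⁻¹), by positivity, min_le_left _ _, ?_⟩
  rw [mul_comm, ← le_div_iff₀ hC]
  calc _ ≤ ((δ / C) ^ q⁻¹) ^ q := by gcongr; exact min_le_right _ _
    _ = δ / C := Real.rpow_inv_rpow (by positivity) hq.ne'

theorem IsDeGiorgi.lintegral_excess_half_le (hs : 0 < s) (hp : 1 < p) (hA : 0 < A) (hB : 0 ≤ B)
    (hF₀ : 0 ≤ F₀) (hu : Measurable u) (hDG : IsDeGiorgi n s p A F₀ U u) (hR : 0 < R) (hM : 0 < M)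
    (hθ : 0 < θ) (hθ2 : θ ≤ 1 / 2)
    (hθC : deGiorgiStepConst n s p A B * θ ^ (s * p) ≤
      2 ^ (-(deGiorgiExponent n s p * n + p)))
    (he : 0 < e) (he1 : e ≤ 1) (hball : closedBall x₀ (2 * R) ⊆ U)
    (hFM : F₀ * R ^ (s * p) ≤ M ^ p)
    (htail : tailPow n s p (fun y => ENNReal.ofReal (u y - k)) x₀ R ≤
      ENNReal.ofReal (B * M ^ (p - 1)))
    (hexc : ∫⁻ x in ball x₀ (R * (1 + e)), ENNReal.ofReal (u x - (k + M * (1 - e))) ^ p ≤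
      ENNReal.ofReal (excessBound n s p R M θ e)) :
    ∫⁻ x in ball x₀ (R * (1 + e / 2)), ENNReal.ofReal (u x - (k + M * (1 - e / 2))) ^ p ≤
      ENNReal.ofReal (excessBound n s p R M θ (e / 2)) := by
  have hsp : 0 < s * p := by positivity
  have hbound := excessBound_nonneg (n := n) (s := s) (p := p) hR.le hM.le hθ.le he.le
  have hρR : R * θ * e ^ deGiorgiExponent n s p ≤ R * (1 + e) - R * (1 + e / 2) := by
    have : e ^ deGiorgiExponent n s p ≤ e := by
      simpa using Real.rpow_le_rpow_of_exponent_ge he he1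
        (one_le_deGiorgiExponent (n := n) hsp (by linarith))
    calc _ ≤ R * (1 / 2) * e := by gcongr
      _ = _ := by ring
  have htail' : tailPow n s p (fun y => ENNReal.ofReal (u y - (k + M * (1 - e) + M * (e / 2)))) x₀
      (R * (1 + e)) ≤ ENNReal.ofReal (2 ^ (s * p) * (B * M ^ (p - 1))) := by
    rw [ENNReal.ofReal_mul (by positivity)]
    refine (tailPow_le_of_le_two_mul hsp.le hR (by nlinarith) (by nlinarith)).trans
      (mul_le_mul_right ((tailPow_mono hp (.of_forall fun y => ?_)).trans htail) _)
    exact ENNReal.ofReal_le_ofReal (by nlinarith)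
  have hstep := hDG.lintegral_excess_add_le hs.le hp.le hA.le hF₀ hu (r := R * (1 + e / 2))
    (ρ := R * θ * e ^ deGiorgiExponent n s p) (by positivity) (by positivity) hρR
    (d := M * (e / 2)) (by positivity)
    ((closedBall_subset_closedBall (by nlinarith)).trans hball) hbound (by positivity) hexc le_rfl
    htail'
  rw [show k + M * (1 - e) + M * (e / 2) = k + M * (1 - e / 2) by ring] at hstep
  refine hstep.trans (ENNReal.ofReal_le_ofReal ?_)
  have : 0 ≤ R * (1 + e) / (R * (1 + e) - R * (1 + e / 2)) :=
    div_nonneg (by positivity) ((by positivity : (0 : ℝ) ≤ _).trans hρR)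
  rw [excessBound_half hM.le he.le, mul_assoc A]
  refine mul_le_mul_of_nonneg_right (le_trans ?_ hθC) hbound
  rw [deGiorgiStepConst, ← excess_step_const_eq hsp hR hθ he]
  refine mul_le_mul ?_ (excess_data_factor_le (by linarith) hsp.le hB hF₀ hR hM he he1 hFM)
    (by positivity) (by positivity)
  have := excess_scale_factor_le (E := n + s * p + p) hR he he1 (by positivity) hsp.le
  gcongr

theorem ae_le_of_lintegral_excess_le (hp : 0 < p) (hu : Measurable u) {S : Set (Rn n)} {l : ℝ}
    {a : ℕ → ℝ} (ha : Filter.Tendsto a Filter.atTop (nhds 0))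
    (h : ∀ j, ∫⁻ x in S, ENNReal.ofReal (u x - l) ^ p ≤ ENNReal.ofReal (a j)) :
    ∀ᵐ x ∂(volume.restrict S), u x ≤ l := by
  have hzero : ∫⁻ x in S, ENNReal.ofReal (u x - l) ^ p = 0 :=
    le_antisymm (ge_of_tendsto' (by simpa using ENNReal.tendsto_ofReal ha) h) bot_le
  rw [lintegral_eq_zero_iff (by fun_prop)] at hzero
  filter_upwards [hzero] with x hx
  simpa [hp, hp.not_gt] using hx

theorem tendsto_excessBound (hp : 0 < p) (hsp : 0 < s * p) (hM : 0 ≤ M) :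
    Filter.Tendsto (fun j : ℕ => excessBound n s p R M θ ((1 / 2) ^ j)) Filter.atTop (nhds 0) := by
  have hκ := one_le_deGiorgiExponent (n := n) hsp hp.le
  simp only [excessBound_two_pow_neg hM]
  simpa using (tendsto_pow_atTop_nhds_zero_of_lt_one (by positivity)
    (Real.rpow_lt_one_of_one_lt_of_neg one_lt_two
      (neg_neg_of_pos (by positivity : 0 < deGiorgiExponent n s p * n + p)))).const_mul
    (excessBound n s p R M θ 1)

/-- **De Giorgi's lemma**. -/
theorem IsDeGiorgi.exists_ae_le_add (n : ℕ) (hs : 0 < s) (hp : 1 < p) (hA : 0 < A) (hB : 0 ≤ B) :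
    ∃ ν : ℝ, 0 < ν ∧ ∀ (F₀ : ℝ) (U : Set (Rn n)) (u : Rn n → ℝ), 0 ≤ F₀ → Measurable u →
      IsDeGiorgi n s p A F₀ U u → ∀ (x₀ : Rn n) (R k M : ℝ), 0 < R → 0 < M →
      closedBall x₀ (2 * R) ⊆ U → F₀ * R ^ (s * p) ≤ M ^ p →
      tailPow n s p (fun y => ENNReal.ofReal (u y - k)) x₀ R ≤ ENNReal.ofReal (B * M ^ (p - 1)) →
      ∫⁻ x in ball x₀ (2 * R), ENNReal.ofReal (u x - k) ^ p ≤
        ENNReal.ofReal (ν * M ^ p * R ^ n) →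
      ∀ᵐ x ∂(volume.restrict (ball x₀ R)), u x ≤ k + M := by
  have hsp : 0 < s * p := by positivity
  have hω := volume_real_unitBall_pos n
  obtain ⟨θ, hθ, hθ2, hθC⟩ := exists_mul_rpow_le (deGiorgiStepConst_pos (n := n) (s := s) (p := p)
    hA hB) (Real.rpow_pos_of_pos two_pos (-(deGiorgiExponent n s p * n + p))) hsp
  refine ⟨volume.real (ball (0 : Rn n) 1) / 2 * θ ^ n * (1 / 2) ^ p, by positivity, ?_⟩
  intro F₀ U u hF₀ hu hDG x₀ R k M hR hM hball hFM htail hexc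
  have hiter (j : ℕ) : ∫⁻ x in ball x₀ (R * (1 + (1 / 2) ^ j)),
      ENNReal.ofReal (u x - (k + M * (1 - (1 / 2) ^ j))) ^ p ≤
        ENNReal.ofReal (excessBound n s p R M θ ((1 / 2) ^ j)) := by
    induction j with
    | zero =>
      have hone : excessBound n s p R M θ 1 =
          volume.real (ball (0 : Rn n) 1) / 2 * θ ^ n * (1 / 2) ^ p * M ^ p * R ^ n := by
        rw [excessBound, Real.mul_rpow hM.le (by positivity), Real.one_rpow]
        ring
      rw [pow_zero, hone, one_add_one_eq_two, mul_comm R]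
      simpa using hexc
    | succ j ih =>
      rw [pow_succ, mul_one_div]
      exact hDG.lintegral_excess_half_le hs hp hA hB hF₀ hu hR hM hθ hθ2 hθC (by positivity)
        (pow_le_one₀ (by norm_num) (by norm_num)) hball hFM htail ih
  refine ae_le_of_lintegral_excess_le (p := p) (by positivity) hu
    (tendsto_excessBound (by positivity) hsp hM.le) fun j => le_trans ?_ (hiter j)
  have hj : (0 : ℝ) < (1 / 2) ^ j := by positivity
  refine (lintegral_mono_set (ball_subset_ball (by nlinarith))).trans
    (lintegral_mono fun x => ?_)
  have : M * (1 - (1 / 2) ^ j) ≤ M := by nlinarith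
  gcongr

end DeGiorgiLemma

section Oscillation

variable {n : ℕ} {s p A D F₀ : ℝ} {U S : Set (Rn n)} {u : Rn n → ℝ} {x₀ : Rn n}
  {r ρ R c b k m T : ℝ}

theorem volume_ball_mul {l : ℝ} (hl : 0 < l) (hr : 0 < r) :
    volume (ball x₀ (l * r)) = ENNReal.ofReal (l ^ n) * volume (ball x₀ r) := by
  rw [volume_ball_eq x₀ (by positivity), volume_ball_eq x₀ hr, ← ENNReal.ofReal_mul (by positivity),
    mul_pow, mul_assoc]

theorem lintegral_excess_mul_volume_sublevel_le_gainIntegral (hs : 0 ≤ s) (hp : 1 ≤ p)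
    (hu : Measurable u) (hr : 0 < r) (hrR : r ≤ R) (hb : 0 < b) (hk : c + b ≤ k) :
    (∫⁻ x in ball x₀ r, ENNReal.ofReal (u x - k)) *
        (ENNReal.ofReal (b ^ (p - 1) * (2 * r) ^ (-((n : ℝ) + s * p))) *
          volume (ball x₀ r ∩ {y | u y ≤ c})) ≤
      gainIntegral n s p u k x₀ r R := by
  rw [gainIntegral, ← lintegral_mul_const _ (by fun_prop)]
  refine setLIntegral_mono' measurableSet_ball fun x hx => ?_
  have hsub : ball x₀ r ∩ {y | u y ≤ c} ⊆ ball x₀ R ∩ {y | u y ≤ k} := fun y hy =>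
    ⟨ball_subset_ball hrR hy.1, le_trans (b := c) hy.2 (by linarith)⟩
  rw [← mul_assoc, ← setLIntegral_const, ENNReal.ofReal_mul (by positivity), ← mul_assoc]
  refine (setLIntegral_mono' (measurableSet_ball.inter (measurableSet_le hu measurable_const))
    fun y hy => mul_le_mul' ?_ ?_).trans (lintegral_mono_set hsub)
  · have : u y ≤ c := hy.2
    rw [← ENNReal.ofReal_rpow_of_pos hb]
    have : ENNReal.ofReal b ≤ max (ENNReal.ofReal (u x - k)) (ENNReal.ofReal (k - u y)) :=
      (ENNReal.ofReal_le_ofReal (by linarith)).trans (le_max_right _ _)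
    gcongr
  · refine ofReal_rpow_neg_le_enorm_rpow_neg (by positivity) (by positivity) ?_
    rw [← dist_eq_norm]
    linarith [dist_triangle_right x y x₀, mem_ball.1 hx, mem_ball.1 hy.1]

theorem lintegral_excess_rpow_le_of_ae_le (hp : 1 ≤ p) (hm : 0 < m)
    (hup : ∀ᵐ x ∂(volume.restrict S), u x ≤ k + m) :
    ∫⁻ x in S, ENNReal.ofReal (u x - k) ^ p ≤
      ENNReal.ofReal (m ^ (p - 1)) * ∫⁻ x in S, ENNReal.ofReal (u x - k) := by
  rw [← lintegral_const_mul' _ _ ENNReal.ofReal_ne_top]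
  refine lintegral_mono_ae ?_
  filter_upwards [hup] with x hx
  rw [← ennreal_mul_rpow_sub_one hp, mul_comm, ← ENNReal.ofReal_rpow_of_pos hm]
  gcongr
  linarith

theorem caccioppoliExcess_le_of_ae_le (hp : 1 ≤ p) (hm : 0 < m) (hD : 0 ≤ D)
    (hup : ∀ᵐ x ∂(volume.restrict (ball x₀ R)), u x ≤ k + m)
    (htail : tailPow n s p (fun y => ENNReal.ofReal (u y - k)) x₀ R ≤
      ENNReal.ofReal (D * m ^ (p - 1)))
    (hF : F₀ * R ^ (s * p) ≤ m ^ p) :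
    caccioppoliExcess n s p F₀ u k x₀ R ≤
      ENNReal.ofReal ((D + 2) * m ^ p) * volume (ball x₀ R) := by
  have hone : ∫⁻ x in ball x₀ R, ENNReal.ofReal (u x - k) ≤
      ENNReal.ofReal m * volume (ball x₀ R) := by
    rw [← setLIntegral_const]
    refine lintegral_mono_ae ?_
    filter_upwards [hup] with x hx
    gcongr
    linarith
  have hsum : (D + 2) * m ^ p = m ^ (p - 1) * m + D * m ^ (p - 1) * m + m ^ p := by
    rw [mul_assoc D, mul_comm _ m, mul_rpow_sub_one_eq (by linarith) hm.le]
    ring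
  rw [caccioppoliExcess, hsum, ENNReal.ofReal_add (by positivity) (by positivity),
    ENNReal.ofReal_add (by positivity) (by positivity), ENNReal.ofReal_mul (q := m) (by positivity),
    ENNReal.ofReal_mul (q := m) (by positivity), add_mul, add_mul, mul_assoc, mul_assoc]
  refine add_le_add_three ?_ (mul_le_mul' htail hone)
    (mul_le_mul' (ENNReal.ofReal_le_ofReal hF) (measure_mono inter_subset_left))
  exact (lintegral_excess_rpow_le_of_ae_le hp hm hup).trans (mul_le_mul_right hone _)

/-- The constant in the estimate of the excess over a level which is not reached in half of a
ball. -/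
noncomputable def densityConst (n : ℕ) (s p A D : ℝ) : ℝ :=
  A * 2 ^ ((n : ℝ) + s * p + p) * (D + 2) * 2 * 8 ^ n

theorem densityConst_pos (hA : 0 < A) (hD : 0 ≤ D) : 0 < densityConst n s p A D := by
  unfold densityConst
  positivity

theorem IsDeGiorgi.lintegral_excess_le (hs : 0 ≤ s) (hp : 1 ≤ p) (hA : 0 ≤ A) (hu : Measurable u)
    (hDG : IsDeGiorgi n s p A F₀ U u) (hρ : 0 < ρ) (hb : 0 < b) (hk : c + b ≤ k) (hm : 0 < m)
    (hD : 0 ≤ D) (hball : closedBall x₀ (4 * ρ) ⊆ U)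
    (hup : ∀ᵐ x ∂(volume.restrict (ball x₀ (4 * ρ))), u x ≤ k + m)
    (htail : tailPow n s p (fun y => ENNReal.ofReal (u y - k)) x₀ (4 * ρ) ≤
      ENNReal.ofReal (D * m ^ (p - 1)))
    (hF : F₀ * (4 * ρ) ^ (s * p) ≤ m ^ p)
    (hhalf : volume (ball x₀ (2 * ρ)) ≤ 2 * volume (ball x₀ (2 * ρ) ∩ {y | u y ≤ c})) :
    ∫⁻ x in ball x₀ (2 * ρ), ENNReal.ofReal (u x - k) ≤
      ENNReal.ofReal (densityConst n s p A D * (m ^ p / b ^ (p - 1)) * ρ ^ n) := by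
  set a := b ^ (p - 1) * (2 * (2 * ρ)) ^ (-((n : ℝ) + s * p)) with ha
  set Q := A * 2 ^ ((n : ℝ) + s * p + p) * (4 * ρ) ^ (-(s * p))
  set V := volume (ball x₀ (2 * ρ))
  set X := ∫⁻ x in ball x₀ (2 * ρ), ENNReal.ofReal (u x - k)
  have hVpos : V ≠ 0 := (measure_ball_pos _ _ (by positivity)).ne'
  have hgain : gainIntegral n s p u k x₀ (2 * ρ) (4 * ρ) ≤
      ENNReal.ofReal (Q * ((D + 2) * m ^ p) * 2 ^ n) * V := by
    have hcacc := hDG x₀ (2 * ρ) (4 * ρ) k (by positivity) (by linarith) hball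
    rw [show 4 * ρ / (4 * ρ - 2 * ρ) = 2 by field_simp; norm_num] at hcacc
    refine hcacc.trans ((mul_le_mul_right
      (caccioppoliExcess_le_of_ae_le hp hm hD hup htail hF) _).trans_eq ?_)
    rw [show 4 * ρ = 2 * (2 * ρ) by ring, volume_ball_mul two_pos (by positivity), ← mul_assoc,
      ← mul_assoc, ← ENNReal.ofReal_mul (by positivity), ← ENNReal.ofReal_mul (by positivity),
      ← show 4 * ρ = 2 * (2 * ρ) by ring]
  have hX : ENNReal.ofReal a * X * V ≤
      ENNReal.ofReal (2 * (Q * ((D + 2) * m ^ p) * 2 ^ n)) * V := by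
    calc _ ≤ ENNReal.ofReal a * X * (2 * volume (ball x₀ (2 * ρ) ∩ {y | u y ≤ c})) := by gcongr
      _ = 2 * (X * (ENNReal.ofReal a * volume (ball x₀ (2 * ρ) ∩ {y | u y ≤ c}))) := by ring
      _ ≤ 2 * (ENNReal.ofReal (Q * ((D + 2) * m ^ p) * 2 ^ n) * V) := by
          refine mul_le_mul_right (le_trans ?_ hgain) _
          exact lintegral_excess_mul_volume_sublevel_le_gainIntegral hs hp hu (by positivity)
            (by linarith) hb hk
      _ = _ := by rw [ENNReal.ofReal_mul two_pos.le, ENNReal.ofReal_ofNat, mul_assoc (2 : ℝ≥0∞)]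
  refine (le_ofReal_div_of_mul_le (by positivity)
    ((ENNReal.mul_le_mul_iff_left hVpos measure_ball_lt_top.ne).1 hX)).trans_eq (congrArg _ ?_)
  have hscale : (4 * ρ) ^ (-(s * p)) = (4 * ρ) ^ (-((n : ℝ) + s * p)) * (4 * ρ) ^ n := by
    rw [← Real.rpow_add_natCast (by positivity)]
    ring_nf
  rw [ha, densityConst, show 2 * (2 * ρ) = 4 * ρ by ring, show (8 : ℝ) = 4 * 2 by norm_num,
    mul_pow]
  simp only [Q, hscale, mul_pow]
  field_simp

theorem tailPow_le_of_ae_le (hs : 0 < s) (hp : 1 < p) (hr : 0 < r) (hR : 0 < R) (hm : 0 < m)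
    (hT : 0 ≤ T) (hup : ∀ᵐ x ∂(volume.restrict (ball x₀ R)), u x ≤ k + m)
    (htail : tailPow n s p (fun y => ENNReal.ofReal (u y - k)) x₀ R ≤ ENNReal.ofReal T)
    (hrR : (r / R) ^ (s * p) * T ≤ m ^ (p - 1)) :
    tailPow n s p (fun y => ENNReal.ofReal (u y - k)) x₀ r ≤
      ENNReal.ofReal ((radialConst n (s * p) + 1) * m ^ (p - 1)) := by
  have hC₀ := radialConst_nonneg n (b := s * p) (by positivity)
  have hrecenter := tailPow_recenter_le (n := n) (s := s) hp (by positivity) (x₁ := x₀) hR hr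
    one_pos (f := fun y => ENNReal.ofReal (u y - k)) (c := ENNReal.ofReal m)
    (fun y _ _ => (one_mul _).ge) (by
      filter_upwards [hup] with x hx
      exact ENNReal.ofReal_le_ofReal (by linarith))
  refine hrecenter.trans ((add_le_add_right (mul_le_mul_right htail _) _).trans ?_)
  rw [Real.one_rpow, one_mul, ENNReal.ofReal_rpow_of_pos hm, ← ENNReal.ofReal_mul hC₀,
    ← ENNReal.ofReal_mul (by positivity), ← ENNReal.ofReal_add (by positivity) (by positivity)]
  exact ENNReal.ofReal_le_ofReal (by linarith)

theorem IsDeGiorgi.lintegral_excess_rpow_le {ω δ ν : ℝ} (hs : 0 < s) (hp : 1 < p) (hA : 0 < A)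
    (hu : Measurable u) (hDG : IsDeGiorgi n s p A F₀ U u) (hρ : 0 < ρ) (hω : 0 < ω) (hδ : 0 < δ)
    (hδ8 : δ ≤ 1 / 8) (hD : 0 ≤ D)
    (hδν : densityConst n s p A D * 2 ^ (p - 1) * 2 ^ p * (4 * δ) ^ (p - 1) ≤ ν)
    (hball : closedBall x₀ (4 * ρ) ⊆ U)
    (hup : ∀ᵐ x ∂(volume.restrict (ball x₀ (4 * ρ))), u x ≤ c + ω)
    (htail : tailPow n s p (fun y => ENNReal.ofReal (u y - (c + ω - 4 * δ * ω))) x₀ (4 * ρ) ≤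
      ENNReal.ofReal (D * (4 * δ * ω) ^ (p - 1)))
    (hF : F₀ * (4 * ρ) ^ (s * p) ≤ (4 * δ * ω) ^ p)
    (hhalf : volume (ball x₀ (2 * ρ)) ≤ 2 * volume (ball x₀ (2 * ρ) ∩ {y | u y ≤ c})) :
    ∫⁻ x in ball x₀ (2 * ρ), ENNReal.ofReal (u x - (c + ω - 4 * δ * ω)) ^ p ≤
      ENNReal.ofReal (ν * (2 * δ * ω) ^ p * ρ ^ n) := by
  have hG := densityConst_pos (n := n) (s := s) (p := p) hA hD
  have hup' : ∀ᵐ x ∂(volume.restrict (ball x₀ (4 * ρ))), u x ≤ c + ω - 4 * δ * ω + 4 * δ * ω := by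
    simpa using hup
  have hexc := hDG.lintegral_excess_le (k := c + ω - 4 * δ * ω) (m := 4 * δ * ω) hs.le hp.le hA.le
    hu hρ (half_pos hω) (by nlinarith) (by positivity) hD hball hup' htail hF hhalf
  refine (lintegral_excess_rpow_le_of_ae_le hp.le (by positivity)
    (ae_restrict_of_ae_restrict_of_subset (ball_subset_ball (by linarith)) hup')).trans
    ((mul_le_mul_right hexc _).trans ?_)
  rw [← ENNReal.ofReal_mul (by positivity)]
  refine ENNReal.ofReal_le_ofReal ?_
  calc _ = densityConst n s p A D * 2 ^ (p - 1) * 2 ^ p * (4 * δ) ^ (p - 1) * (2 * δ * ω) ^ p *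
        ρ ^ n := by
        rw [show 4 * δ * ω = 2 * (2 * δ * ω) by ring, Real.mul_rpow (z := p) two_pos.le
          (by positivity), show 2 * (2 * δ * ω) = 4 * δ * ω by ring, Real.mul_rpow (y := ω)
          (by positivity) hω.le, Real.div_rpow hω.le two_pos.le]
        field_simp
    _ ≤ _ := by gcongr

/-- The oscillation is reduced from above if the function lies below the middle level in half of a
small ball: this makes the excess over a level close to the supremum small compared to the distance
of that level to the supremum, and De Giorgi's lemma applies. -/
theorem IsDeGiorgi.exists_upper_reduction (n : ℕ) (hs : 0 < s) (hp : 1 < p) (hA : 0 < A) :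
    ∃ δ : ℝ, 0 < δ ∧ δ ≤ 1 / 8 ∧ ∀ (F₀ : ℝ) (U : Set (Rn n)) (u : Rn n → ℝ), 0 ≤ F₀ →
      Measurable u → IsDeGiorgi n s p A F₀ U u → ∀ (x₀ : Rn n) (R ρ B c ω : ℝ), 0 < ρ → 4 * ρ ≤ R →
      0 < ω → 0 ≤ B → B * (4 * ρ / R) ^ (s * p) ≤ (4 * δ) ^ (p - 1) → closedBall x₀ R ⊆ U →
      (∀ᵐ x ∂(volume.restrict (ball x₀ R)), u x ≤ c + ω) →
      tailPow n s p (fun y => ENNReal.ofReal |u y - c|) x₀ R ≤ ENNReal.ofReal (B * ω ^ (p - 1)) →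
      F₀ * R ^ (s * p) ≤ (2 * δ * ω) ^ p →
      volume (ball x₀ (2 * ρ)) ≤ 2 * volume (ball x₀ (2 * ρ) ∩ {y | u y ≤ c}) →
      ∀ᵐ x ∂(volume.restrict (ball x₀ ρ)), u x ≤ c + ω - 2 * δ * ω := by
  have hC₀ := radialConst_nonneg n (b := s * p) (by positivity)
  obtain ⟨ν, hν, hsmall⟩ := IsDeGiorgi.exists_ae_le_add n (s := s) (p := p) (A := A)
    (B := (radialConst n (s * p) + 1) * 2 ^ (p - 1)) hs hp hA (by positivity)
  have hG := densityConst_pos (n := n) (s := s) (p := p) (D := radialConst n (s * p) + 1) hA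
    (by positivity)
  obtain ⟨θ, hθ, hθ2, hθν⟩ := exists_mul_rpow_le
    (by positivity : 0 < densityConst n s p A (radialConst n (s * p) + 1) * 2 ^ (p - 1) * 2 ^ p) hν
    (sub_pos.2 hp)
  obtain ⟨δ, rfl⟩ : ∃ δ, θ = 4 * δ := ⟨θ / 4, by ring⟩
  have hδ : 0 < δ := by linarith
  refine ⟨δ, hδ, by linarith, ?_⟩
  intro F₀ U u hF₀ hu hDG x₀ R ρ B c ω hρ hρR hω hB hBρ hball hup htail hF hhalf
  have hR : 0 < R := by linarith
  have htail' (r : ℝ) (hr : 0 < r) (hrρ : r ≤ 4 * ρ) :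
      tailPow n s p (fun y => ENNReal.ofReal (u y - (c + ω - 4 * δ * ω))) x₀ r ≤
        ENNReal.ofReal ((radialConst n (s * p) + 1) * (4 * δ * ω) ^ (p - 1)) := by
    refine tailPow_le_of_ae_le hs hp hr hR (by positivity) (by positivity) (by simpa using hup)
      ((tailPow_mono hp (.of_forall fun y => ENNReal.ofReal_le_ofReal ?_)).trans htail) ?_
    · nlinarith [le_abs_self (u y - c)]
    · calc _ ≤ (4 * ρ / R) ^ (s * p) * (B * ω ^ (p - 1)) := by gcongr
        _ = B * (4 * ρ / R) ^ (s * p) * ω ^ (p - 1) := by ring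
        _ ≤ (4 * δ) ^ (p - 1) * ω ^ (p - 1) := by gcongr
        _ = _ := (Real.mul_rpow hθ.le hω.le).symm
  have hF' (r : ℝ) (hr : 0 < r) (hrρ : r ≤ 4 * ρ) : F₀ * r ^ (s * p) ≤ (2 * δ * ω) ^ p := by
    refine le_trans ?_ hF
    gcongr
    linarith
  have hexc := hDG.lintegral_excess_rpow_le hs hp hA hu hρ hω hδ (by linarith) (by positivity) hθν
    ((closedBall_subset_closedBall hρR).trans hball)
    (ae_restrict_of_ae_restrict_of_subset (ball_subset_ball hρR) hup)
    (htail' _ (by positivity) le_rfl)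
    ((hF' _ (by positivity) le_rfl).trans (by gcongr; norm_num)) hhalf
  have hM : (radialConst n (s * p) + 1) * (4 * δ * ω) ^ (p - 1) =
      (radialConst n (s * p) + 1) * 2 ^ (p - 1) * (2 * δ * ω) ^ (p - 1) := by
    rw [show 4 * δ * ω = 2 * (2 * δ * ω) by ring, Real.mul_rpow two_pos.le (by positivity)]
    ring
  filter_upwards [hsmall F₀ U u hF₀ hu hDG x₀ ρ (c + ω - 4 * δ * ω) (2 * δ * ω) hρ (by positivity)
    ((closedBall_subset_closedBall (by linarith)).trans hball) (hF' ρ hρ (by linarith))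
    (hM ▸ htail' ρ hρ (by linarith)) hexc] with x hx
  linarith

end Oscillation

section Decay

variable {n : ℕ} {s p A B F₀ ε c c' ω R : ℝ} {U : Set (Rn n)} {u : Rn n → ℝ} {x₀ : Rn n}

/-- Both `u` and `-u` belong to the De Giorgi class; this is what interior regularity needs of a
minimizer. -/
structure IsTwoSidedDeGiorgi (n : ℕ) (s p A F₀ : ℝ) (U : Set (Rn n)) (u : Rn n → ℝ) : Prop where
  measurable : Measurable u
  force_nonneg : 0 ≤ F₀
  upper : IsDeGiorgi n s p A F₀ U u
  lower : IsDeGiorgi n s p A F₀ U (fun x => -u x)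

theorem IsTwoSidedDeGiorgi.neg (h : IsTwoSidedDeGiorgi n s p A F₀ U u) :
    IsTwoSidedDeGiorgi n s p A F₀ U (fun x => -u x) :=
  ⟨h.measurable.neg, h.force_nonneg, h.lower, by simpa only [neg_neg] using h.upper⟩

/-- The state of the oscillation decay at scale `R`: `u` is within `ω` of `c` in the ball of
radius `R`, with matching bounds on the tail and on the force term. -/
structure OscBound (n : ℕ) (s p F₀ B ε : ℝ) (u : Rn n → ℝ) (x₀ : Rn n) (R c ω : ℝ) : Prop where
  ae_abs_le : ∀ᵐ x ∂(volume.restrict (ball x₀ R)), |u x - c| ≤ ω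
  tail_le : tailPow n s p (fun y => ENNReal.ofReal |u y - c|) x₀ R ≤
    ENNReal.ofReal (B * ω ^ (p - 1))
  force_le : F₀ * R ^ (s * p) ≤ ε * ω ^ p

theorem OscBound.neg (h : OscBound n s p F₀ B ε u x₀ R c ω) :
    OscBound n s p F₀ B ε (fun x => -u x) x₀ R (-c) ω where
  ae_abs_le := by simpa only [neg_sub_neg, abs_sub_comm] using h.ae_abs_le
  tail_le := by simpa only [neg_sub_neg, abs_sub_comm] using h.tail_le
  force_le := h.force_le

theorem OscBound.tailPow_le (hs : 0 < s) (hp : 1 < p) {θ : ℝ} (hR : 0 < R) (hθ : 0 < θ)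
    (hω : 0 < ω) (hB : 0 ≤ B) (h : OscBound n s p F₀ B ε u x₀ R c ω) (hc : |c' - c| ≤ ω) :
    tailPow n s p (fun y => ENNReal.ofReal |u y - c'|) x₀ (θ * R) ≤
      ENNReal.ofReal (2 ^ (p - 1) * (radialConst n (s * p) +
        θ ^ (s * p) * (B + radialConst n (s * p))) * ω ^ (p - 1)) := by
  have hsp : 0 < s * p := by positivity
  have hC₀ := radialConst_nonneg n hsp
  have htri (y : Rn n) : |u y - c'| ≤ |u y - c| + ω := by
    linarith [abs_sub_le (u y) c c', abs_sub_comm c c']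
  have hnear := tailPow_recenter_le (n := n) (s := s) (f := fun y => ENNReal.ofReal |u y - c'|)
    (x₀ := x₀) (x₁ := x₀) (c := ENNReal.ofReal (2 * ω)) hp hsp hR (mul_pos hθ hR) one_pos
    (fun y _ _ => (one_mul _).ge) (h.ae_abs_le.mono fun x hx =>
      ENNReal.ofReal_le_ofReal (by linarith [htri x]))
  have hfar : tailPow n s p (fun y => ENNReal.ofReal |u y - c'|) x₀ R ≤
      ENNReal.ofReal (2 ^ (p - 1) * ((B + radialConst n (s * p)) * ω ^ (p - 1))) := by
    calc _ ≤ tailPow n s p (fun y => ENNReal.ofReal |u y - c| + ENNReal.ofReal ω) x₀ R := by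
          refine tailPow_mono hp (.of_forall fun y => ?_)
          rw [← ENNReal.ofReal_add (abs_nonneg _) hω.le]
          exact ENNReal.ofReal_le_ofReal (htri y)
      _ ≤ ENNReal.ofReal (2 ^ (p - 1)) * (ENNReal.ofReal (B * ω ^ (p - 1)) +
          ENNReal.ofReal (radialConst n (s * p)) * ENNReal.ofReal ω ^ (p - 1)) := by
          refine (tailPow_add_const_le hp hsp hR _).trans (mul_le_mul_right ?_ _)
          exact add_le_add_left h.tail_le _
      _ = _ := by
          rw [ENNReal.ofReal_rpow_of_pos hω, ← ENNReal.ofReal_mul hC₀,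
            ← ENNReal.ofReal_add (by positivity) (by positivity),
            ← ENNReal.ofReal_mul (by positivity), add_mul]
  refine (hnear.trans (add_le_add le_rfl (mul_le_mul' le_rfl hfar))).trans_eq ?_
  rw [ENNReal.ofReal_rpow_of_pos (by positivity), ← ENNReal.ofReal_mul hC₀,
    ← ENNReal.ofReal_mul (by positivity), ← ENNReal.ofReal_add (by positivity) (by positivity),
    Real.one_rpow, Real.mul_rpow two_pos.le hω.le, mul_div_cancel_right₀ _ hR.ne']
  congr 1
  ring

/-- A tail bound that reproduces itself under `OscBound.rescale`. -/
noncomputable def oscTailConst (n : ℕ) (s p : ℝ) : ℝ :=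
  4 ^ (p - 1) * (radialConst n (s * p) + 1)

theorem one_le_oscTailConst (n : ℕ) (hs : 0 < s) (hp : 1 < p) : 1 ≤ oscTailConst n s p :=
  one_le_mul_of_one_le_of_one_le (Real.one_le_rpow (by norm_num) (by linarith))
    (le_add_of_nonneg_left (radialConst_nonneg n (by positivity)))

theorem OscBound.rescale (hs : 0 < s) (hp : 1 < p) {δ θ : ℝ} (hR : 0 < R) (hω : 0 < ω)
    (hε : 0 ≤ ε) (hδ : δ ≤ 1 / 2) (hθ : 0 < θ)
    (hθB : θ ^ (s * p) * (oscTailConst n s p + radialConst n (s * p)) ≤ 1)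
    (hθp : θ ^ (s * p) ≤ (1 / 2) ^ p)
    (h : OscBound n s p F₀ (oscTailConst n s p) ε u x₀ R c ω) (hc : |c' - c| ≤ ω)
    (habs : ∀ᵐ x ∂(volume.restrict (ball x₀ (θ * R))), |u x - c'| ≤ (1 - δ) * ω) :
    OscBound n s p F₀ (oscTailConst n s p) ε u x₀ (θ * R) c' ((1 - δ) * ω) := by
  have hB := one_le_oscTailConst n hs hp
  have : 0 ≤ radialConst n (s * p) := radialConst_nonneg n (by positivity)
  have hhalf : ω / 2 ≤ (1 - δ) * ω := by nlinarith
  refine ⟨habs, ?_, ?_⟩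
  · have h4 : (4 : ℝ) ^ (p - 1) = 2 ^ (p - 1) * 2 ^ (p - 1) := by
      rw [← Real.mul_rpow two_pos.le two_pos.le]
      norm_num
    refine (h.tailPow_le hs hp hR hθ hω (by linarith) hc).trans (ENNReal.ofReal_le_ofReal ?_)
    calc _ ≤ 2 ^ (p - 1) * (radialConst n (s * p) + 1) * ω ^ (p - 1) := by gcongr
      _ = oscTailConst n s p * (ω / 2) ^ (p - 1) := by
          rw [oscTailConst, h4, Real.div_rpow hω.le two_pos.le]
          field_simp
      _ ≤ _ := by gcongr
  · calc F₀ * (θ * R) ^ (s * p) = θ ^ (s * p) * (F₀ * R ^ (s * p)) := by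
          rw [Real.mul_rpow hθ.le hR.le]
          ring
      _ ≤ θ ^ (s * p) * (ε * ω ^ p) := mul_le_mul_of_nonneg_left h.force_le (by positivity)
      _ ≤ (1 / 2) ^ p * (ε * ω ^ p) := by gcongr
      _ = ε * (ω / 2) ^ p := by
          rw [Real.div_rpow hω.le two_pos.le, Real.div_rpow zero_le_one two_pos.le, Real.one_rpow]
          ring
      _ ≤ _ := by gcongr

theorem OscBound.rescale_of_le (hs : 0 < s) (hp : 1 < p) {δ θ : ℝ} (hR : 0 < R) (hω : 0 < ω)
    (hε : 0 ≤ ε) (hδ : 0 ≤ δ) (hδ2 : δ ≤ 1 / 2) (hθ : 0 < θ) (hθ1 : θ ≤ 1)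
    (hθB : θ ^ (s * p) * (oscTailConst n s p + radialConst n (s * p)) ≤ 1)
    (hθp : θ ^ (s * p) ≤ (1 / 2) ^ p)
    (h : OscBound n s p F₀ (oscTailConst n s p) ε u x₀ R c ω)
    (hup : ∀ᵐ x ∂(volume.restrict (ball x₀ (θ * R))), u x ≤ c + ω - 2 * δ * ω) :
    OscBound n s p F₀ (oscTailConst n s p) ε u x₀ (θ * R) (c - δ * ω) ((1 - δ) * ω) := by
  refine h.rescale hs hp hR hω hε hδ2 hθ hθB hθp ?_ ?_
  · rw [sub_sub_cancel_left, abs_neg, abs_of_nonneg (by positivity)]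
    nlinarith
  · filter_upwards [hup, ae_restrict_of_ae_restrict_of_subset
      (ball_subset_ball (mul_le_of_le_one_left hR.le hθ1)) h.ae_abs_le] with x hle habs
    rw [abs_le] at habs ⊢
    constructor <;> linarith [habs.1]

theorem volume_le_two_mul_sublevel_or_superlevel (S : Set (Rn n)) (u : Rn n → ℝ) (c : ℝ) :
    volume S ≤ 2 * volume (S ∩ {y | u y ≤ c}) ∨ volume S ≤ 2 * volume (S ∩ {y | -u y ≤ -c}) := by
  have hcover : volume S ≤ volume (S ∩ {y | u y ≤ c}) + volume (S ∩ {y | -u y ≤ -c}) := by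
    refine (measure_mono fun y hy => ?_).trans (measure_union_le _ _)
    exact (le_total (u y) c).imp (⟨hy, ·⟩) fun h => ⟨hy, neg_le_neg h⟩
  simp only [two_mul]
  exact (le_total (volume (S ∩ {y | -u y ≤ -c})) (volume (S ∩ {y | u y ≤ c}))).imp
    (fun h => hcover.trans (add_le_add_right h _)) fun h => hcover.trans (add_le_add_left h _)

theorem exists_oscBound_step (n : ℕ) (hs : 0 < s) (hp : 1 < p) (hA : 0 < A) :
    ∃ δ θ ε : ℝ, 0 < δ ∧ δ ≤ 1 / 8 ∧ 0 < θ ∧ θ ≤ 1 / 4 ∧ 0 < ε ∧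
      ∀ (F₀ : ℝ) (U : Set (Rn n)) (u : Rn n → ℝ), IsTwoSidedDeGiorgi n s p A F₀ U u →
      ∀ (x₀ : Rn n) (R c ω : ℝ), 0 < R → 0 < ω → closedBall x₀ R ⊆ U →
      OscBound n s p F₀ (oscTailConst n s p) ε u x₀ R c ω →
      ∃ c', OscBound n s p F₀ (oscTailConst n s p) ε u x₀ (θ * R) c' ((1 - δ) * ω) ∧
        |c' - c| ≤ δ * ω := by
  have hsp : 0 < s * p := by positivity
  have hB := one_le_oscTailConst n hs hp
  have hC₀ := radialConst_nonneg n hsp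
  obtain ⟨δ, hδ, hδ8, hreduce⟩ := IsDeGiorgi.exists_upper_reduction n hs hp hA
  obtain ⟨τ, hτ, hτ2, hτη⟩ := exists_mul_rpow_le one_pos (δ := min (min ((4 * δ) ^ (p - 1) /
    (oscTailConst n s p * 2 ^ (s * p))) (1 / (oscTailConst n s p + radialConst n (s * p))))
    ((1 / 2) ^ p)) (by positivity) hsp
  simp only [one_mul, le_min_iff] at hτη
  obtain ⟨⟨hτδ, hτB⟩, hτp⟩ := hτη
  rw [le_div_iff₀ (by positivity)] at hτδ hτB
  have hhalf : (τ / 2) ^ (s * p) ≤ τ ^ (s * p) := by gcongr; linarith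
  refine ⟨δ, τ / 2, (2 * δ) ^ p, hδ, hδ8, half_pos hτ, by linarith, by positivity, ?_⟩
  intro F₀ U u hu x₀ R c ω hR hω hball hosc
  have hfrom_above (v : Rn n → ℝ) (c : ℝ) (hv : IsTwoSidedDeGiorgi n s p A F₀ U v)
      (hosc : OscBound n s p F₀ (oscTailConst n s p) ((2 * δ) ^ p) v x₀ R c ω)
      (hvol : volume (ball x₀ (2 * (τ / 2 * R))) ≤
        2 * volume (ball x₀ (2 * (τ / 2 * R)) ∩ {y | v y ≤ c})) :
      OscBound n s p F₀ (oscTailConst n s p) ((2 * δ) ^ p) v x₀ (τ / 2 * R) (c - δ * ω)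
        ((1 - δ) * ω) := by
    have hup := hreduce F₀ U v hv.force_nonneg hv.measurable hv.upper x₀ R (τ / 2 * R)
      (oscTailConst n s p) c ω (by positivity) (by nlinarith) hω (by linarith) (by
        rw [show 4 * (τ / 2 * R) / R = τ * 2 by field_simp; norm_num,
          Real.mul_rpow hτ.le two_pos.le]
        linarith) hball (hosc.ae_abs_le.mono fun x hx => by linarith [(abs_le.1 hx).2]) hosc.tail_le
      (by simpa only [Real.mul_rpow (by positivity : 0 ≤ 2 * δ) hω.le] using hosc.force_le) hvol
    exact hosc.rescale_of_le hs hp hR hω (by positivity) hδ.le (by linarith) (half_pos hτ)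
      (by linarith) ((mul_le_mul_of_nonneg_right hhalf (by positivity)).trans hτB)
      (hhalf.trans hτp) hup
  rcases volume_le_two_mul_sublevel_or_superlevel (ball x₀ (2 * (τ / 2 * R))) u c with hvol | hvol
  · refine ⟨c - δ * ω, hfrom_above u c hu hosc hvol, ?_⟩
    rw [sub_sub_cancel_left, abs_neg, abs_of_pos (by positivity)]
  · refine ⟨-(-c - δ * ω), ?_, ?_⟩
    · simpa only [neg_neg] using (hfrom_above _ (-c) hu.neg hosc.neg hvol).neg
    · rw [neg_sub, sub_neg_eq_add, add_sub_cancel_right, abs_of_pos (by positivity)]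

theorem exists_limit_of_forall_exists_dist_le {X : Type*} [PseudoMetricSpace X] [CompleteSpace X]
    {P : ℕ → X → Prop} {x₀ : X} {C r : ℝ} (hr : r < 1) (h₀ : P 0 x₀)
    (hstep : ∀ j x, P j x → ∃ y, P (j + 1) y ∧ dist x y ≤ C * r ^ j) :
    ∃ l, ∀ j, ∃ x, P j x ∧ dist x l ≤ C * r ^ j / (1 - r) := by
  choose! next hnext using hstep
  let x (j : ℕ) : X := Nat.rec x₀ next j
  have hP (j : ℕ) : P j (x j) := by
    induction j with
    | zero => exact h₀
    | succ j ih => exact (hnext j _ ih).1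
  have hdist (j : ℕ) : dist (x j) (x (j + 1)) ≤ C * r ^ j := (hnext j _ (hP j)).2
  obtain ⟨l, hl⟩ := cauchySeq_tendsto_of_complete (cauchySeq_of_le_geometric r C hr hdist)
  exact ⟨l, fun j => ⟨x j, hP j, dist_le_of_le_geometric_of_tendsto r C hr hdist hl j⟩⟩

theorem exists_rpow_eq {x y : ℝ} (hx : 0 < x) (hxy : x < y) (hy : y < 1) :
    ∃ α : ℝ, 0 < α ∧ α < 1 ∧ x ^ α = y := by
  have hx1 := hxy.trans hy
  have hy0 := hx.trans hxy
  refine ⟨Real.logb x y, Real.logb_pos_of_base_lt_one hx hx1 hy0 hy, ?_,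
    Real.rpow_logb hx hx1.ne hy0⟩
  rwa [Real.logb_lt_iff_lt_rpow_of_base_lt_one hx hx1 hy0, Real.rpow_one]

theorem exists_le_pow_and_rpow_pow_succ_le {x θ α : ℝ} (hx : 0 < x) (hx1 : x ≤ 1) (hθ : 0 < θ)
    (hθ1 : θ < 1) (hα : 0 ≤ α) : ∃ j : ℕ, x ≤ θ ^ j ∧ (θ ^ α) ^ (j + 1) ≤ x ^ α := by
  obtain ⟨j, hlt, hle⟩ := exists_nat_pow_near_of_lt_one hx hx1 hθ hθ1
  refine ⟨j, hle, ?_⟩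
  rw [← Real.rpow_mul_natCast hθ.le, mul_comm, Real.rpow_natCast_mul hθ.le]
  gcongr

theorem exists_holder_at (n : ℕ) (hs : 0 < s) (hp : 1 < p) (hA : 0 < A) :
    ∃ α C ε : ℝ, 0 < α ∧ α < 1 ∧ 0 < ε ∧ ∀ (F₀ : ℝ) (U : Set (Rn n)) (u : Rn n → ℝ),
      IsTwoSidedDeGiorgi n s p A F₀ U u →
      ∀ (x₀ : Rn n) (R c₀ ω : ℝ), 0 < R → 0 < ω → closedBall x₀ R ⊆ U →
      OscBound n s p F₀ (oscTailConst n s p) ε u x₀ R c₀ ω →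
      ∃ c, ∀ r, 0 < r → r ≤ R →
        ∀ᵐ x ∂(volume.restrict (ball x₀ r)), |u x - c| ≤ C * ω * (r / R) ^ α := by
  obtain ⟨δ, θ, ε, hδ, hδ8, hθ, hθ4, hε, hstep⟩ := exists_oscBound_step n hs hp hA
  obtain ⟨α, hα, hα1, hθα⟩ :=
    exists_rpow_eq hθ (by linarith : θ < 1 - δ) (by linarith)
  have hδ1 : 0 < 1 - δ := by linarith
  refine ⟨α, 2 / (1 - δ), ε, hα, hα1, hε, ?_⟩
  intro F₀ U u hu x₀ R c₀ ω hR hω hball hosc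
  obtain ⟨l, hl⟩ := exists_limit_of_forall_exists_dist_le (x₀ := c₀) (C := δ * ω) (r := 1 - δ)
    (P := fun j c => OscBound n s p F₀ (oscTailConst n s p) ε u x₀ (θ ^ j * R) c (ω * (1 - δ) ^ j))
    (by linarith) (by simpa using hosc) fun j c hc => by
      obtain ⟨c', hc', hcc'⟩ := hstep F₀ U u hu x₀ (θ ^ j * R) c (ω * (1 - δ) ^ j) (by positivity)
        (by positivity) ((closedBall_subset_closedBall
          (mul_le_of_le_one_left hR.le (pow_le_one₀ hθ.le (by linarith)))).trans hball) hc
      refine ⟨c', ?_, ?_⟩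
      · convert hc' using 1 <;> ring
      · rwa [dist_comm, Real.dist_eq, mul_assoc]
  refine ⟨l, fun r hr hrR => ?_⟩
  obtain ⟨j, hj, hpow⟩ := exists_le_pow_and_rpow_pow_succ_le (div_pos hr hR)
    ((div_le_one hR).2 hrR) hθ (by linarith) hα.le
  obtain ⟨c, hc, hcl⟩ := hl j
  rw [Real.dist_eq, sub_sub_cancel, mul_assoc, mul_div_cancel_left₀ _ hδ.ne'] at hcl
  filter_upwards [ae_restrict_of_ae_restrict_of_subset (ball_subset_ball ((div_le_iff₀ hR).1 hj))
    hc.ae_abs_le] with x hx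
  calc |u x - l| ≤ ω * (1 - δ) ^ j + ω * (1 - δ) ^ j := (abs_sub_le _ _ _).trans (add_le_add hx hcl)
    _ = 2 / (1 - δ) * ω * (θ ^ α) ^ (j + 1) := by
        rw [hθα]
        field_simp
        ring
    _ ≤ _ := by gcongr

end Decay

section LocalEstimate

variable {n : ℕ} {s p A B F₀ ε H M R : ℝ} {U : Set (Rn n)} {u : Rn n → ℝ} {x₀ x₁ : Rn n}

/-- `M` dominates, up to the factor `B`, the quantities that control `u` near the ball of radius
`R`: force, tail and `L^p` average. -/
structure SizeBound (n : ℕ) (s p F₀ B : ℝ) (u : Rn n → ℝ) (x₀ : Rn n) (R M : ℝ) : Prop where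
  force_le : F₀ * R ^ (s * p) ≤ M ^ p
  tail_le : tailPow n s p (fun y => ENNReal.ofReal |u y|) x₀ R ≤ ENNReal.ofReal (B * M ^ (p - 1))
  lintegral_le : ∫⁻ x in ball x₀ (2 * R), ENNReal.ofReal |u x| ^ p ≤
    ENNReal.ofReal (B * M ^ p * R ^ n)

theorem exists_abs_le (n : ℕ) (hs : 0 < s) (hp : 1 < p) (hA : 0 < A) (hB : 0 ≤ B) :
    ∃ H : ℝ, 1 ≤ H ∧ ∀ (F₀ : ℝ) (U : Set (Rn n)) (u : Rn n → ℝ),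
      IsTwoSidedDeGiorgi n s p A F₀ U u → ∀ (x₀ : Rn n) (R M : ℝ), 0 < R → 0 < M →
      closedBall x₀ (2 * R) ⊆ U → SizeBound n s p F₀ B u x₀ R M →
      ∀ᵐ x ∂(volume.restrict (ball x₀ R)), |u x| ≤ H * M := by
  have hp0 : 0 < p := by linarith
  obtain ⟨ν, hν, hsup⟩ := IsDeGiorgi.exists_ae_le_add n hs hp hA hB
  obtain ⟨H, hH, hHν⟩ := ((Filter.eventually_ge_atTop 1).and
    ((tendsto_rpow_atTop hp0).eventually_ge_atTop (B / ν))).exists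
  rw [div_le_iff₀ hν] at hHν
  refine ⟨H, hH, ?_⟩
  intro F₀ U u hu x₀ R M hR hM hball hsize
  have hHM : M ≤ H * M := le_mul_of_one_le_left hM.le hH
  have hle (v : Rn n → ℝ) (hv : IsTwoSidedDeGiorgi n s p A F₀ U v) (hvu : ∀ x, v x ≤ |u x|) :
      ∀ᵐ x ∂(volume.restrict (ball x₀ R)), v x ≤ 0 + H * M := by
    refine hsup F₀ U v hv.force_nonneg hv.measurable hv.upper x₀ R 0 (H * M) hR (by positivity)
      hball (hsize.force_le.trans (by gcongr)) ?_ ?_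
    · refine (tailPow_mono hp (.of_forall fun y => ?_)).trans (hsize.tail_le.trans ?_)
      · rw [sub_zero]
        exact ENNReal.ofReal_le_ofReal (hvu y)
      · exact ENNReal.ofReal_le_ofReal (by gcongr)
    · refine (lintegral_mono fun x => ?_).trans (hsize.lintegral_le.trans ?_)
      · rw [sub_zero]
        exact ENNReal.rpow_le_rpow (ENNReal.ofReal_le_ofReal (hvu x)) hp0.le
      · rw [Real.mul_rpow (by linarith) hM.le, ← mul_assoc, mul_comm ν]
        exact ENNReal.ofReal_le_ofReal (by gcongr)
  filter_upwards [hle u hu fun x => le_abs_self _, hle _ hu.neg fun x => neg_le_abs _]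
    with x hupper hlower
  rw [abs_le]
  constructor <;> linarith

/-- The constant in the size bound on the balls of half the radius centred in the original one. -/
noncomputable def recenterConst (n : ℕ) (s p H : ℝ) : ℝ :=
  radialConst n (s * p) * H ^ (p - 1) + 3 ^ ((n : ℝ) + s * p) * (1 / 2) ^ (s * p) + 2 ^ n

theorem recenterConst_nonneg (n : ℕ) (hsp : 0 < s * p) (hH : 0 ≤ H) :
    0 ≤ recenterConst n s p H := by
  have := radialConst_nonneg n hsp
  rw [recenterConst]
  positivity

theorem SizeBound.recenter (hs : 0 < s) (hp : 1 < p) (hF₀ : 0 ≤ F₀) (hH : 0 ≤ H) (hR : 0 < R)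
    (hM : 0 < M) (h : SizeBound n s p F₀ 1 u x₀ R M) (hx₁ : x₁ ∈ ball x₀ R)
    (hsup : ∀ᵐ x ∂(volume.restrict (ball x₀ R)), |u x| ≤ H * M) :
    SizeBound n s p F₀ (recenterConst n s p H) u x₁ (R / 2) M := by
  have hsp : 0 < s * p := by positivity
  have hC₀ := radialConst_nonneg n hsp
  have hdist : dist x₁ x₀ < R := hx₁
  refine ⟨?_, ?_, ?_⟩
  · refine le_trans ?_ h.force_le
    gcongr
    linarith
  · have hmove := tailPow_recenter_le (n := n) (s := s) (f := fun y => ENNReal.ofReal |u y|)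
      (x₀ := x₀) (x₁ := x₁) (c := ENNReal.ofReal (H * M)) hp hsp hR (half_pos hR) three_pos
      (fun y _ hy => by
        rw [← dist_eq_norm] at hy ⊢
        rw [← dist_eq_norm]
        linarith [dist_triangle y x₁ x₀])
      (hsup.mono fun x hx => ENNReal.ofReal_le_ofReal hx)
    refine (hmove.trans (add_le_add le_rfl (mul_le_mul' le_rfl h.tail_le))).trans ?_
    rw [ENNReal.ofReal_rpow_of_nonneg (by positivity) (by linarith), ← ENNReal.ofReal_mul hC₀,
      ← ENNReal.ofReal_mul (by positivity), ← ENNReal.ofReal_add (by positivity) (by positivity),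
      Real.mul_rpow hH hM.le, div_right_comm, div_self hR.ne', one_mul, recenterConst]
    refine ENNReal.ofReal_le_ofReal ?_
    have : 0 ≤ 2 ^ n * M ^ (p - 1) := by positivity
    linarith
  · rw [mul_div_cancel₀ R two_ne_zero]
    refine (lintegral_mono_set (ball_subset_ball' (by linarith))).trans (h.lintegral_le.trans ?_)
    refine ENNReal.ofReal_le_ofReal ?_
    calc 1 * M ^ p * R ^ n = 2 ^ n * M ^ p * (R / 2) ^ n := by
          rw [div_pow]
          field_simp
      _ ≤ _ := by
          rw [recenterConst]
          gcongr
          exact le_add_of_nonneg_left (by positivity)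

theorem SizeBound.oscBound (hH : 0 ≤ H) (hM : 0 ≤ M) {T : ℝ}
    (hT : T ≤ B * H ^ (p - 1)) (hHε : 1 ≤ ε * H ^ p) (h : SizeBound n s p F₀ T u x₀ R M)
    (hsup : ∀ᵐ x ∂(volume.restrict (ball x₀ R)), |u x| ≤ H * M) :
    OscBound n s p F₀ B ε u x₀ R 0 (H * M) where
  ae_abs_le := by simpa only [sub_zero] using hsup
  tail_le := by
    simp only [sub_zero]
    rw [Real.mul_rpow hH hM, ← mul_assoc]
    exact h.tail_le.trans (ENNReal.ofReal_le_ofReal (by gcongr))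
  force_le := by
    rw [Real.mul_rpow hH hM, ← mul_assoc]
    exact h.force_le.trans (le_mul_of_one_le_left (by positivity) hHε)

theorem exists_holder_at_of_sizeBound (n : ℕ) (hs : 0 < s) (hp : 1 < p) (hA : 0 < A)
    (hB : 0 ≤ B) :
    ∃ α C : ℝ, 0 < α ∧ α < 1 ∧ ∀ (F₀ : ℝ) (U : Set (Rn n)) (u : Rn n → ℝ),
      IsTwoSidedDeGiorgi n s p A F₀ U u → ∀ (x₀ : Rn n) (R M : ℝ), 0 < R → 0 < M →
      closedBall x₀ (2 * R) ⊆ U → SizeBound n s p F₀ B u x₀ R M →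
      ∃ c, ∀ r, 0 < r → r ≤ R →
        ∀ᵐ x ∂(volume.restrict (ball x₀ r)), |u x - c| ≤ C * M * (r / R) ^ α := by
  have hp0 : 0 < p := by linarith
  obtain ⟨H₀, hH₀, hsup⟩ := exists_abs_le n hs hp hA hB
  obtain ⟨α, C, ε, hα, hα1, hε, hholder⟩ := exists_holder_at n hs hp hA
  obtain ⟨H, hHH₀, hHB, hHε⟩ := ((Filter.eventually_ge_atTop H₀).and
    (((tendsto_rpow_atTop (sub_pos.2 hp)).eventually_ge_atTop B).and
      ((tendsto_rpow_atTop hp0).eventually_ge_atTop (1 / ε)))).exists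
  have hH : 0 < H := by linarith
  refine ⟨α, C * H, hα, hα1, ?_⟩
  intro F₀ U u hu x₀ R M hR hM hball hsize
  have hosc : OscBound n s p F₀ (oscTailConst n s p) ε u x₀ R 0 (H * M) :=
    hsize.oscBound hH.le hM.le
      (hHB.trans (le_mul_of_one_le_left (by positivity) (one_le_oscTailConst n hs hp)))
      ((div_le_iff₀' hε).1 hHε)
      ((hsup F₀ U u hu x₀ R M hR hM hball hsize).mono fun x hx => hx.trans (by gcongr))
  simpa only [mul_assoc] using hholder F₀ U u hu x₀ R 0 (H * M) hR (by positivity)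
    ((closedBall_subset_closedBall (by linarith)).trans hball) hosc

theorem exists_local_estimate (n : ℕ) (hs : 0 < s) (hp : 1 < p) (hA : 0 < A) :
    ∃ α C : ℝ, 0 < α ∧ α < 1 ∧ 0 < C ∧ ∀ (F₀ : ℝ) (U : Set (Rn n)) (u : Rn n → ℝ),
      IsTwoSidedDeGiorgi n s p A F₀ U u → ∀ (x₀ : Rn n) (R M : ℝ), 0 < R → 0 < M →
      closedBall x₀ (2 * R) ⊆ U → SizeBound n s p F₀ 1 u x₀ R M →
      (∀ᵐ x ∂(volume.restrict (ball x₀ R)), |u x| ≤ C * M) ∧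
      ∀ x₁ ∈ ball x₀ R, ∃ c, ∀ r, 0 < r → r ≤ R / 2 →
        ∀ᵐ x ∂(volume.restrict (ball x₁ r)), |u x - c| ≤ C * M * (r / R) ^ α := by
  obtain ⟨H, hH, hsup⟩ := exists_abs_le n hs hp hA zero_le_one
  obtain ⟨α, C, hα, hα1, hholder⟩ := exists_holder_at_of_sizeBound n hs hp hA
    (recenterConst_nonneg n (by positivity : 0 < s * p) (zero_le_one.trans hH))
  refine ⟨α, max H (C * 2 ^ α), hα, hα1, by positivity, ?_⟩
  intro F₀ U u hu x₀ R M hR hM hball hsize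
  have hsup₀ := hsup F₀ U u hu x₀ R M hR hM hball hsize
  refine ⟨hsup₀.mono fun x hx => hx.trans (by gcongr; exact le_max_left _ _), fun x₁ hx₁ => ?_⟩
  have hx₁R : dist x₁ x₀ < R := hx₁
  obtain ⟨c, hc⟩ := hholder F₀ U u hu x₁ (R / 2) M (half_pos hR) hM
    ((closedBall_subset_closedBall' (by linarith)).trans hball)
    (hsize.recenter hs hp hu.force_nonneg (by linarith) hR hM hx₁ hsup₀)
  refine ⟨c, fun r hr hrR => (hc r hr hrR).mono fun x hx => hx.trans ?_⟩
  calc C * M * (r / (R / 2)) ^ α = C * 2 ^ α * M * (r / R) ^ α := by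
        rw [div_div_eq_mul_div, mul_div_right_comm, Real.mul_rpow (by positivity) two_pos.le]
        ring
    _ ≤ _ := by
        gcongr
        exact le_max_right _ _

end LocalEstimate

section Modification

variable {n : ℕ} {s p : ℝ} {Ω : Set (Rn n)} {K : Rn n → Rn n → ℝ} {F : Rn n → ℝ → ℝ}
  {u w : Rn n → ℝ}

theorem ae_prod_of_ae {X Y : Type*} [MeasureSpace X] [MeasureSpace Y] {P : X → Prop} {Q : Y → Prop}
    (hP : ∀ᵐ x, P x) (hQ : ∀ᵐ y, Q y) : ∀ᵐ z : X × Y, P z.1 ∧ Q z.2 := by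
  rw [Measure.volume_eq_prod]
  exact (Measure.quasiMeasurePreserving_fst.ae hP).and (Measure.quasiMeasurePreserving_snd.ae hQ)

theorem energy_congr (h : u =ᵐ[volume] w) : energy p K F Ω u = energy p K F Ω w := by
  unfold energy
  congr 1
  · congr 2
    refine lintegral_congr_ae (ae_restrict_of_ae ?_)
    filter_upwards [ae_prod_of_ae h h] with z hz
    rw [hz.1, hz.2]
  · congr 1
    refine integral_congr_ae (ae_restrict_of_ae ?_)
    filter_upwards [h] with x hx
    rw [hx]

theorem MemW.congr (h : u =ᵐ[volume] w) (hu : MemW n s p Ω u) : MemW n s p Ω w := by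
  refine ⟨hu.1.congr h, hu.2.1.ae_eq (ae_restrict_of_ae h), lt_of_eq_of_lt ?_ hu.2.2⟩
  refine lintegral_congr_ae (ae_restrict_of_ae ?_)
  filter_upwards [ae_prod_of_ae h h] with z hz
  rw [hz.1, hz.2]

theorem MemWeightedL.congr (h : u =ᵐ[volume] w) (hu : MemWeightedL n s p u) :
    MemWeightedL n s p w := by
  refine ⟨hu.1.congr h, lt_of_eq_of_lt (lintegral_congr_ae ?_) hu.2⟩
  filter_upwards [h] with x hx
  rw [hx]

theorem IsMinimizer.congr (h : u =ᵐ[volume] w) (hu : IsMinimizer s p K F Ω u) :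
    IsMinimizer s p K F Ω w := by
  refine ⟨hu.1.congr h, fun φ hφ hsupp => ?_⟩
  have h_add : (fun x => u x + φ x) =ᵐ[volume] fun x => w x + φ x := by
    filter_upwards [h] with x hx
    rw [hx]
  rw [← energy_congr h, ← energy_congr h_add]
  exact hu.2 φ hφ hsupp

theorem tail_congr (h : u =ᵐ[volume] w) (x₀ : Rn n) (R : ℝ) :
    tail n s p u x₀ R = tail n s p w x₀ R := by
  unfold tail
  congr 2
  refine lintegral_congr_ae (ae_restrict_of_ae ?_)
  filter_upwards [h] with x hx
  rw [hx]

end Modification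

section Reflection

variable {n : ℕ} {s p Λ F₀ : ℝ} {Ω : Set (Rn n)} {K : Rn n → Rn n → ℝ} {F : Rn n → ℝ → ℝ}
  {u : Rn n → ℝ}

theorem MemW.neg (hu : MemW n s p Ω u) : MemW n s p Ω (fun x => -u x) :=
  ⟨hu.1.neg, hu.2.1.neg, by simpa only [neg_sub_neg, abs_sub_comm] using hu.2.2⟩

theorem energy_neg (u : Rn n → ℝ) :
    energy p K (fun x t => F x (-t)) Ω (fun x => -u x) = energy p K F Ω u := by
  simp only [energy, neg_neg, neg_sub_neg, abs_sub_comm]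

theorem IsMinimizer.neg (hu : IsMinimizer s p K F Ω u) :
    IsMinimizer s p K (fun x t => F x (-t)) Ω (fun x => -u x) := by
  refine ⟨hu.1.neg, fun φ hφ hsupp => ?_⟩
  have hsupp' : tsupport (-φ) ⊆ Ω := by rwa [tsupport, Function.support_neg]
  calc energy p K (fun x t => F x (-t)) Ω (fun x => -u x) = energy p K F Ω u := energy_neg u
    _ ≤ energy p K F Ω (fun x => u x + (-φ) x) := hu.2 (-φ) hφ.neg hsupp'
    _ = energy p K (fun x t => F x (-t)) Ω (fun x => -u x + φ x) := by
        rw [← energy_neg]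
        simp only [Pi.neg_apply, neg_add, neg_neg]

theorem SuperpositionMeasurable.neg (hF : SuperpositionMeasurable Ω F) :
    SuperpositionMeasurable Ω (fun x t => F x (-t)) :=
  fun v hv => hF (fun x => -v x) hv.neg

theorem IsMinimizer.isDeGiorgi (hn : n ≠ 0) (hs : s ∈ Ioo (0 : ℝ) 1) (hp : 1 < p) (hΛ : 0 < Λ)
    (hΩ : volume Ω ≠ ∞) (hK : IsAdmissibleKernel n s p Λ K) (hF : SuperpositionMeasurable Ω F)
    (hF₀ : 0 ≤ F₀) (hFb : ∀ᵐ x ∂(volume.restrict Ω), ∀ t : ℝ, |F x t| ≤ F₀) (hu : Measurable u)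
    (hmin : IsMinimizer s p K F Ω u) :
    IsDeGiorgi n s p (caccioppoliConst n s p Λ) F₀ Ω u :=
  (hmin.isAlmostMinimizer (by linarith) hΩ hF hF₀ hFb hu).isDeGiorgi hn hs.1.le hs.2 hp hΛ hK hF₀
    hu (hmin.1.interaction_lt_top hΛ.le hK).ne

theorem IsMinimizer.isTwoSidedDeGiorgi (hn : n ≠ 0) (hs : s ∈ Ioo (0 : ℝ) 1) (hp : 1 < p)
    (hΛ : 0 < Λ) (hΩ : volume Ω ≠ ∞) (hK : IsAdmissibleKernel n s p Λ K)
    (hF : SuperpositionMeasurable Ω F) (hF₀ : 0 ≤ F₀)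
    (hFb : ∀ᵐ x ∂(volume.restrict Ω), ∀ t : ℝ, |F x t| ≤ F₀) (hu : Measurable u)
    (hmin : IsMinimizer s p K F Ω u) :
    IsTwoSidedDeGiorgi n s p (caccioppoliConst n s p Λ) F₀ Ω u where
  measurable := hu
  force_nonneg := hF₀
  upper := hmin.isDeGiorgi hn hs hp hΛ hΩ hK hF hF₀ hFb hu
  lower := hmin.neg.isDeGiorgi hn hs hp hΛ hΩ hK hF.neg hF₀ (hFb.mono fun _ hx t => hx (-t)) hu.neg

end Reflection

section Tail

variable {n : ℕ} {s p R : ℝ} {u : Rn n → ℝ} {x₀ : Rn n}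

theorem tail_eq_tailPow_rpow (hp : 1 ≤ p) (hR : 0 < R) (u : Rn n → ℝ) (x₀ : Rn n) :
    tail n s p u x₀ R = tailPow n s p (fun y => ENNReal.ofReal |u y|) x₀ R ^ (1 / (p - 1)) := by
  unfold tail tailPow
  congr 2
  refine setLIntegral_congr_fun measurableSet_ball.compl fun y hy => ?_
  have hpos : 0 < ‖y - x₀‖ := hR.trans_le (by simpa [dist_eq_norm] using hy)
  beta_reduce
  rw [← ofReal_norm, ENNReal.ofReal_rpow_of_pos hpos,
    ENNReal.ofReal_rpow_of_nonneg (abs_nonneg _) (sub_nonneg.2 hp),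
    ← ENNReal.ofReal_mul (by positivity), Real.rpow_neg hpos.le, div_eq_mul_inv]

theorem one_add_norm_le_mul_norm_sub {E : Type*} [SeminormedAddCommGroup E] {R : ℝ} {x y : E}
    (hR : 0 < R) (h : R ≤ ‖y - x‖) : 1 + ‖y‖ ≤ ((1 + ‖x‖) / R + 1) * ‖y - x‖ := by
  have htriangle : ‖y‖ ≤ ‖y - x‖ + ‖x‖ := norm_le_norm_sub_add y x
  have : 1 + ‖x‖ ≤ (1 + ‖x‖) / R * ‖y - x‖ := by
    rw [div_mul_eq_mul_div, le_div_iff₀ hR]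
    gcongr
  linarith

theorem tail_lt_top (hs : 0 ≤ s) (hp : 1 ≤ p) (hu : MemWeightedL n s p u) (hR : 0 < R) :
    tail n s p u x₀ R < ∞ := by
  have hE : 0 ≤ (n : ℝ) + s * p := by positivity
  set E := (n : ℝ) + s * p
  set κ := (1 + ‖x₀‖) / R + 1
  have hweight (y : Rn n) (hy : y ∈ (ball x₀ R)ᶜ) :
      |u y| ^ (p - 1) / ‖y - x₀‖ ^ E ≤ κ ^ E * (|u y| ^ (p - 1) / (1 + ‖y‖) ^ E) := by
    have hRy : R ≤ ‖y - x₀‖ := by simpa [dist_eq_norm] using hy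
    have hpos : 0 < ‖y - x₀‖ := hR.trans_le hRy
    have hpow : (1 + ‖y‖) ^ E ≤ κ ^ E * ‖y - x₀‖ ^ E := by
      rw [← Real.mul_rpow (by positivity) hpos.le]
      exact Real.rpow_le_rpow (by positivity) (one_add_norm_le_mul_norm_sub hR hRy) hE
    rw [← mul_div_assoc, div_le_div_iff₀ (by positivity) (by positivity), mul_comm (κ ^ E),
      mul_assoc]
    gcongr
  refine ENNReal.rpow_lt_top_of_nonneg (one_div_nonneg.2 (sub_nonneg.2 hp)) ?_
  refine (ENNReal.mul_lt_top ENNReal.ofReal_lt_top ?_).ne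
  calc _ ≤ ∫⁻ x in (ball x₀ R)ᶜ, ENNReal.ofReal (κ ^ E) *
        ENNReal.ofReal (|u x| ^ (p - 1) / (1 + ‖x‖) ^ E) := by
        refine setLIntegral_mono' measurableSet_ball.compl fun y hy => ?_
        rw [← ENNReal.ofReal_mul (by positivity)]
        exact ENNReal.ofReal_le_ofReal (hweight y hy)
    _ ≤ ENNReal.ofReal (κ ^ E) * ∫⁻ x, ENNReal.ofReal (|u x| ^ (p - 1) / (1 + ‖x‖) ^ E) := by
        rw [lintegral_const_mul' _ _ ENNReal.ofReal_ne_top]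
        exact mul_le_mul' le_rfl (setLIntegral_le_lintegral _ _)
    _ < ∞ := ENNReal.mul_lt_top ENNReal.ofReal_lt_top hu.2

end Tail

section EssLim

open Filter Topology

section Topological

variable {X : Type*} [TopologicalSpace X] [MeasurableSpace X] {μ : Measure X}
  {u : X → ℝ} {x : X}

/-- The essential limit of `u` at `x`, insensitive to modifications of `u` on null sets. It is the
precise representative of a function which is a.e. equal to a continuous one. -/
noncomputable def essLim (μ : Measure X) (u : X → ℝ) (x : X) : ℝ :=
  limUnder (𝓝 x ⊓ ae μ) u

instance nhds_inf_ae_neBot [μ.IsOpenPosMeasure] : NeBot (𝓝 x ⊓ ae μ) :=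
  inf_neBot_iff.2 fun _ hs t ht => by
    have ht' : ∀ᵐ y ∂μ, y ∈ t := ht
    rw [inter_comm]
    exact (Measure.dense_of_ae ht').inter_nhds_nonempty hs

theorem eventually_nhds_inf_ae_of_ae_restrict [OpensMeasurableSpace X] {U : Set X} {P : X → Prop}
    (hU : IsOpen U) (hx : x ∈ U) (h : ∀ᵐ y ∂(μ.restrict U), P y) : ∀ᶠ y in 𝓝 x ⊓ ae μ, P y := by
  rw [ae_restrict_iff' hU.measurableSet] at h
  filter_upwards [mem_inf_of_left (hU.mem_nhds hx), mem_inf_of_right h] with y hy hPy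
  exact hPy hy

theorem ae_restrict_of_forall_eventually_nhds_inf_ae [SecondCountableTopology X] {S : Set X}
    (hS : MeasurableSet S) {P : X → Prop} (h : ∀ x ∈ S, ∀ᶠ y in 𝓝 x ⊓ ae μ, P y) :
    ∀ᵐ x ∂(μ.restrict S), P x := by
  rw [ae_restrict_iff' hS, ae_iff]
  refine measure_null_of_locally_null _ fun x hx => ?_
  obtain ⟨U, hU, V, hV, hUV⟩ := mem_inf_iff_superset.1 (h x (Classical.not_imp.1 hx).1)
  refine ⟨_, inter_mem_nhdsWithin _ hU, measure_mono_null ?_ hV⟩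
  rintro y ⟨hy, hyU⟩ hyV
  exact (Classical.not_imp.1 hy).2 (hUV ⟨hyU, hyV⟩)

theorem essLim_ae_eq [SecondCountableTopology X] {S : Set X} (hS : MeasurableSet S)
    (hlim : ∀ x ∈ S, Tendsto u (𝓝 x ⊓ ae μ) (𝓝 (essLim μ u x)))
    (hcont : ∀ x ∈ S, ContinuousAt (essLim μ u) x) : essLim μ u =ᵐ[μ.restrict S] u := by
  have hclose (ε : ℝ) (hε : 0 < ε) : ∀ᵐ x ∂(μ.restrict S), dist (essLim μ u x) (u x) < ε := by
    refine ae_restrict_of_forall_eventually_nhds_inf_ae hS fun x hx => ?_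
    have hdist := ((hcont x hx).mono_left inf_le_left).dist (hlim x hx)
    rw [dist_self] at hdist
    exact hdist.eventually_lt_const hε
  have hall : ∀ᵐ x ∂(μ.restrict S), ∀ k : ℕ, dist (essLim μ u x) (u x) < 1 / ((k : ℝ) + 1) :=
    ae_all_iff.2 fun k => hclose _ (by positivity)
  filter_upwards [hall] with x hx
  exact dist_le_zero.1 (ge_of_tendsto' tendsto_one_div_add_atTop_nhds_zero_nat fun k => (hx k).le)

end Topological

section HolderDecay

variable {X : Type*} [PseudoMetricSpace X] [MeasurableSpace X] [OpensMeasurableSpace X]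
  {μ : Measure X} {u : X → ℝ} {x₀ x : X} {c H R α : ℝ}

theorem tendsto_of_holder_decay (hα : 0 < α) (hR : 0 < R)
    (h : ∀ r, 0 < r → r ≤ R / 2 → ∀ᵐ y ∂(μ.restrict (ball x r)), |u y - c| ≤ H * (r / R) ^ α) :
    Tendsto u (𝓝 x ⊓ ae μ) (𝓝 c) := by
  refine Metric.tendsto_nhds.2 fun ε hε => ?_
  have hdecay : Tendsto (fun r : ℝ => H * (r / R) ^ α) (𝓝[>] 0) (𝓝 0) := by
    have hcont : Continuous fun r : ℝ => H * (r / R) ^ α :=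
      continuous_const.mul ((continuous_id.div_const R).rpow_const fun _ => Or.inr hα.le)
    have hlim := hcont.tendsto 0
    rw [zero_div, Real.zero_rpow hα.ne', mul_zero] at hlim
    exact hlim.mono_left nhdsWithin_le_nhds
  have hsmall : ∀ᶠ r : ℝ in 𝓝[>] 0, r ≤ R / 2 :=
    nhdsWithin_le_nhds (ge_mem_nhds (half_pos hR))
  obtain ⟨r, ⟨hrε, hrR⟩, hr⟩ :=
    (((hdecay.eventually_lt_const hε).and hsmall).and self_mem_nhdsWithin).exists
  exact eventually_nhds_inf_ae_of_ae_restrict isOpen_ball (mem_ball_self hr)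
    ((h r hr hrR).mono fun y hy => hy.trans_lt hrε)

variable [μ.IsOpenPosMeasure]

theorem abs_sub_essLim_le_of_holder_decay (hα : 0 < α) (hR : 0 < R)
    (h : ∃ c, ∀ r, 0 < r → r ≤ R / 2 →
      ∀ᵐ y ∂(μ.restrict (ball x r)), |u y - c| ≤ H * (r / R) ^ α) :
    ∀ r, 0 < r → r ≤ R / 2 →
      ∀ᵐ y ∂(μ.restrict (ball x r)), |u y - essLim μ u x| ≤ H * (r / R) ^ α := by
  obtain ⟨c, hc⟩ := h
  rw [essLim, (tendsto_of_holder_decay hα hR hc).limUnder_eq]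
  exact hc

theorem dist_essLim_le_of_holder_decay (hα : 0 < α) (hα1 : α ≤ 1) (hR : 0 < R)
    (hsup : ∀ᵐ x ∂(μ.restrict (ball x₀ R)), |u x| ≤ H)
    (h : ∀ x ∈ ball x₀ R, ∀ r, 0 < r → r ≤ R / 2 →
      ∀ᵐ y ∂(μ.restrict (ball x r)), |u y - essLim μ u x| ≤ H * (r / R) ^ α)
    {x y : X} (hx : x ∈ ball x₀ R) (hy : y ∈ ball x₀ R) :
    dist (essLim μ u x) (essLim μ u y) ≤ 8 * H * (dist x y / R) ^ α := by
  have hlim (z : X) (hz : z ∈ ball x₀ R) : Tendsto u (𝓝 z ⊓ ae μ) (𝓝 (essLim μ u z)) :=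
    tendsto_of_holder_decay hα hR (h z hz)
  have hbound (z : X) (hz : z ∈ ball x₀ R) : |essLim μ u z| ≤ H :=
    le_of_tendsto (hlim z hz).abs (eventually_nhds_inf_ae_of_ae_restrict isOpen_ball hz hsup)
  have hH : 0 ≤ H := (abs_nonneg _).trans (hbound x hx)
  have hrescale {t : ℝ} (ht : 1 ≤ t) : (t * dist x y / R) ^ α ≤ t * (dist x y / R) ^ α := by
    rw [mul_div_assoc, Real.mul_rpow (by positivity) (by positivity)]
    gcongr
    exact Real.rpow_le_self_of_one_le ht hα1
  have : 0 ≤ (dist x y / R) ^ α := by positivity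
  rw [Real.dist_eq]
  rcases (dist_nonneg (x := x) (y := y)).eq_or_lt with hxy | hxy
  · have hnhds : 𝓝 x = 𝓝 y := (Metric.inseparable_iff.2 hxy.symm).nhds_eq
    rw [essLim, essLim, hnhds, sub_self, abs_zero]
    positivity
  rcases le_or_gt (2 * dist x y) (R / 2) with hnear | hfar
  · have hux := eventually_nhds_inf_ae_of_ae_restrict isOpen_ball (mem_ball_self (by positivity))
      (h x hx _ (by positivity) hnear)
    have huy := eventually_nhds_inf_ae_of_ae_restrict isOpen_ball
      (mem_ball.2 (by linarith : dist x y < 2 * dist x y)) (h y hy _ (by positivity) hnear)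
    obtain ⟨z, hzx, hzy⟩ := (hux.and huy).exists
    have := mul_le_mul_of_nonneg_left (hrescale one_le_two) hH
    rw [abs_le] at hzx hzy ⊢
    constructor <;> nlinarith
  · have hone : 1 ≤ (4 * dist x y / R) ^ α :=
      Real.one_le_rpow ((one_le_div hR).2 (by linarith)) hα.le
    have := mul_le_mul_of_nonneg_left (hone.trans (hrescale (by norm_num))) hH
    have hx' := abs_le.1 (hbound x hx)
    have hy' := abs_le.1 (hbound y hy)
    rw [abs_le]
    constructor <;> nlinarith

end HolderDecay

end EssLim

section Holder

open Filter Topology NNReal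

section Metric

variable {X Y : Type*} [PseudoMetricSpace X] [PseudoMetricSpace Y] {v : X → Y} {α : ℝ≥0}

theorem exists_eventually_edist_le_of_continuousAt {x y : X} (hx : ContinuousAt v x)
    (hy : ContinuousAt v y) (hxy : nndist x y ≠ 0) :
    ∃ C : ℝ≥0, ∀ᶠ z in 𝓝 (x, y), edist (v z.1) (v z.2) ≤ C * edist z.1 z.2 ^ (α : ℝ) := by
  have hdist : ContinuousAt (fun z : X × X => nndist z.1 z.2) (x, y) := by fun_prop
  have hquot : ContinuousAt (fun z : X × X => nndist (v z.1) (v z.2) / nndist z.1 z.2 ^ (α : ℝ))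
      (x, y) := by
    have hvx : ContinuousAt (fun z : X × X => v z.1) (x, y) := hx.comp continuousAt_fst
    have hvy : ContinuousAt (fun z : X × X => v z.2) (x, y) := hy.comp continuousAt_snd
    exact (hvx.nndist hvy).div (hdist.nnrpow tendsto_const_nhds (Or.inl hxy))
      (NNReal.rpow_pos (pos_iff_ne_zero.2 hxy)).ne'
  refine ⟨nndist (v x) (v y) / nndist x y ^ (α : ℝ) + 1, ?_⟩
  filter_upwards [hquot.eventually_lt_const (lt_add_one _), hdist.eventually_ne hxy] with z hz hz0
  rw [div_lt_iff₀ (NNReal.rpow_pos (pos_iff_ne_zero.2 hz0))] at hz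
  rw [edist_nndist, edist_nndist, ← ENNReal.coe_rpow_of_nonneg _ α.coe_nonneg]
  exact_mod_cast hz.le

theorem exists_holderOnWith_of_isCompact {Q : Set X} (hQ : IsCompact Q) (hα : 0 < α)
    (h : ∀ x ∈ Q, ∃ t ∈ 𝓝 x, ∃ C, HolderOnWith C α v t) : ∃ C, HolderOnWith C α v Q := by
  have hcont (x : X) (hx : x ∈ Q) : ContinuousAt v x := by
    obtain ⟨t, ht, C, hC⟩ := h x hx
    exact (hC.continuousOn hα).continuousAt ht
  suffices ∃ C : ℝ≥0, ∀ z ∈ Q ×ˢ Q, edist (v z.1) (v z.2) ≤ C * edist z.1 z.2 ^ (α : ℝ) by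
    obtain ⟨C, hC⟩ := this
    exact ⟨C, fun x hx y hy => hC (x, y) ⟨hx, hy⟩⟩
  refine (hQ.prod hQ).induction_on (p := fun S => ∃ C : ℝ≥0, ∀ z ∈ S,
    edist (v z.1) (v z.2) ≤ C * edist z.1 z.2 ^ (α : ℝ)) ⟨0, by simp⟩ ?_ ?_ ?_
  · rintro S T hST ⟨C, hC⟩
    exact ⟨C, fun z hz => hC z (hST hz)⟩
  · rintro S T ⟨C, hC⟩ ⟨D, hD⟩
    refine ⟨max C D, ?_⟩
    rintro z (hz | hz)
    · exact (hC z hz).trans (by gcongr; exact le_max_left _ _)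
    · exact (hD z hz).trans (by gcongr; exact le_max_right _ _)
  · rintro ⟨x, y⟩ ⟨hx, hy⟩
    rcases eq_or_ne (nndist x y) 0 with hxy | hxy
    · obtain ⟨t, ht, C, hC⟩ := h x hx
      have hnhds : 𝓝 x = 𝓝 y := (Metric.inseparable_iff_nndist.2 hxy).nhds_eq
      exact ⟨t ×ˢ t, mem_nhdsWithin_of_mem_nhds (prod_mem_nhds ht (hnhds ▸ ht)), C,
        fun z hz => hC z.1 hz.1 z.2 hz.2⟩
    · obtain ⟨C, hC⟩ := exists_eventually_edist_le_of_continuousAt (α := α) (hcont x hx)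
        (hcont y hy) hxy
      exact ⟨_, mem_nhdsWithin_of_mem_nhds hC, C, fun z hz => hz⟩

theorem holderOnWith_of_dist_le {S : Set X} {C R : ℝ} (hC : 0 ≤ C) (hR : 0 < R)
    (h : ∀ x ∈ S, ∀ y ∈ S, dist (v x) (v y) ≤ C * (dist x y / R) ^ (α : ℝ)) :
    HolderOnWith (C * R ^ (-α : ℝ)).toNNReal α v S := by
  intro x hx y hy
  rw [edist_dist, edist_dist, ENNReal.ofReal_rpow_of_nonneg dist_nonneg α.coe_nonneg,
    ← ENNReal.ofReal, ← ENNReal.ofReal_mul (by positivity)]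
  refine ENNReal.ofReal_le_ofReal ((h x hx y hy).trans_eq ?_)
  rw [Real.div_rpow dist_nonneg hR.le, Real.rpow_neg hR.le]
  ring

end Metric

variable {n : ℕ} {v : Rn n → ℝ} {C α : ℝ≥0} {Ω : Set (Rn n)}

theorem holderSeminorm_le_of_holderOnWith {S : Set (Rn n)} (h : HolderOnWith C α v S) :
    holderSeminorm α v S ≤ C :=
  iSup₂_le fun x hx => iSup₂_le fun y hy => ENNReal.div_le_of_le_mul (h x hx y hy)

theorem memHolderLoc_of_forall_mem_nhds (hα : 0 < α)
    (h : ∀ x ∈ Ω, ∃ t ∈ 𝓝 x, ∃ C, HolderOnWith C α v t) : MemHolderLoc α v Ω := by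
  intro Q hQ hQΩ
  obtain ⟨C, hC⟩ := exists_holderOnWith_of_isCompact hQ hα fun x hx => h x (hQΩ hx)
  exact (holderSeminorm_le_of_holderOnWith hC).trans_lt ENNReal.coe_lt_top

end Holder

theorem closedBall_subset_of_lt_infDist_frontier {E : Type*} [NormedAddCommGroup E]
    [NormedSpace ℝ E] {Ω : Set E} (hΩ : IsOpen Ω) {x₀ : E} {r : ℝ} (hx₀ : x₀ ∈ Ω) (hr : 0 ≤ r)
    (h : r < infDist x₀ (frontier Ω)) : closedBall x₀ r ⊆ Ω := by
  refine (convex_closedBall x₀ r).isPreconnected.subset_of_closure_inter_subset hΩ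
    ⟨x₀, mem_closedBall_self hr, hx₀⟩ fun z ⟨hzΩ, hz⟩ => ?_
  by_contra hzΩ'
  have hfrontier : z ∈ frontier Ω := hΩ.frontier_eq ▸ ⟨hzΩ, hzΩ'⟩
  linarith [infDist_le_dist_of_mem (x := x₀) hfrontier, mem_closedBall'.1 hz]

section LocalSize

variable {n : ℕ} {s p F₀ R M : ℝ} {Ω : Set (Rn n)} {u : Rn n → ℝ} {x₀ : Rn n}

/-- The quantity controlling `u` on `B_R(x₀)` in the Hölder estimate: normalized `L^p` norm, tail
and force. -/
noncomputable def localSize (n : ℕ) (s p F₀ : ℝ) (u : Rn n → ℝ) (x₀ : Rn n) (R : ℝ) : ℝ≥0∞ :=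
  eLpNorm u (ENNReal.ofReal p) (volume.restrict (ball x₀ (2 * R))) /
      ENNReal.ofReal (R ^ ((n : ℝ) / p)) +
    tail n s p u x₀ R + ENNReal.ofReal (R ^ s * F₀ ^ (1 / p))

theorem lintegral_rpow_le_of_eLpNorm_div_le (hp : 0 < p) (hR : 0 < R) (hM : 0 < M)
    (h : eLpNorm u (ENNReal.ofReal p) (volume.restrict Ω) / ENNReal.ofReal (R ^ ((n : ℝ) / p)) ≤
      ENNReal.ofReal M) :
    ∫⁻ x in Ω, ENNReal.ofReal |u x| ^ p ≤ ENNReal.ofReal (M ^ p * R ^ n) := by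
  have hRn : 0 < R ^ ((n : ℝ) / p) := by positivity
  rw [ENNReal.div_le_iff (by simpa using hRn) ENNReal.ofReal_ne_top, ← ENNReal.ofReal_mul hM.le,
    eLpNorm_eq_lintegral_rpow_enorm_toReal (by simpa using hp) ENNReal.ofReal_ne_top,
    ENNReal.toReal_ofReal hp.le, one_div, ENNReal.rpow_inv_le_iff hp,
    ENNReal.ofReal_rpow_of_pos (by positivity), Real.mul_rpow hM.le hRn.le, ← Real.rpow_mul hR.le,
    div_mul_cancel₀ _ hp.ne', Real.rpow_natCast] at h
  simpa only [← ofReal_norm, Real.norm_eq_abs] using h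

theorem sizeBound_of_localSize_le (hp : 1 < p) (hF₀ : 0 ≤ F₀) (hR : 0 < R) (hM : 0 < M)
    (h : localSize n s p F₀ u x₀ R ≤ ENNReal.ofReal M) : SizeBound n s p F₀ 1 u x₀ R M where
  force_le := by
    have hforce := (ENNReal.ofReal_le_ofReal_iff hM.le).1 (le_add_self.trans h)
    calc F₀ * R ^ (s * p) = (R ^ s * F₀ ^ (1 / p)) ^ p := by
          rw [Real.mul_rpow (by positivity) (by positivity), ← Real.rpow_mul hR.le,
            ← Real.rpow_mul hF₀, one_div_mul_cancel (by linarith), Real.rpow_one, mul_comm]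
      _ ≤ M ^ p := by gcongr
  tail_le := by
    have htail := (le_add_self.trans le_self_add).trans h
    rwa [tail_eq_tailPow_rpow hp.le hR, one_div, ENNReal.rpow_inv_le_iff (sub_pos.2 hp),
      ENNReal.ofReal_rpow_of_pos hM, ← one_mul (M ^ (p - 1))] at htail
  lintegral_le := by
    rw [one_mul]
    exact lintegral_rpow_le_of_eLpNorm_div_le (by linarith) hR hM
      ((le_self_add.trans le_self_add).trans h)

theorem localSize_lt_top (hs : 0 ≤ s) (hp : 1 ≤ p) (hu : MemWeightedL n s p u)
    (huW : MemW n s p Ω u) (hR : 0 < R) (hball : closedBall x₀ (2 * R) ⊆ Ω) :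
    localSize n s p F₀ u x₀ R < ∞ := by
  have hRn : 0 < R ^ ((n : ℝ) / p) := by positivity
  have hnorm : eLpNorm u (ENNReal.ofReal p) (volume.restrict (ball x₀ (2 * R))) < ∞ :=
    (eLpNorm_mono_measure _ (Measure.restrict_mono
      (ball_subset_closedBall.trans hball) le_rfl)).trans_lt huW.2.1.2
  exact ENNReal.add_lt_top.2 ⟨ENNReal.add_lt_top.2
    ⟨ENNReal.div_lt_top hnorm.ne (by simpa using hRn), tail_lt_top hs hp hu hR⟩,
    ENNReal.ofReal_lt_top⟩

theorem exists_localSize_le (hs : 0 ≤ s) (hp : 1 ≤ p) (hΩ : IsOpen Ω) (hu : MemWeightedL n s p u)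
    (huW : MemW n s p Ω u) (hx₀ : x₀ ∈ Ω) :
    ∃ R M : ℝ, 0 < R ∧ 0 < M ∧ closedBall x₀ (2 * R) ⊆ Ω ∧
      localSize n s p F₀ u x₀ R ≤ ENNReal.ofReal M := by
  obtain ⟨r, hr, hball⟩ := nhds_basis_closedBall.mem_iff.1 (hΩ.mem_nhds hx₀)
  rw [← mul_div_cancel₀ r two_ne_zero] at hball
  have hfin := localSize_lt_top (F₀ := F₀) hs hp hu huW (half_pos hr) hball
  refine ⟨r / 2, (localSize n s p F₀ u x₀ (r / 2)).toReal + 1, half_pos hr, by positivity, hball,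
    ?_⟩
  exact (ENNReal.le_ofReal_iff_toReal_le hfin.ne (by positivity)).2 (by linarith)

theorem le_mul_of_forall_le_ofReal {a b : ℝ≥0∞} {C : ℝ} (hC : 0 < C)
    (h : ∀ M : ℝ, 0 < M → b ≤ ENNReal.ofReal M → a ≤ ENNReal.ofReal (C * M)) :
    a ≤ ENNReal.ofReal C * b := by
  have hC' : ENNReal.ofReal C ≠ 0 := by simpa using hC
  rw [mul_comm, ← ENNReal.div_le_iff hC' ENNReal.ofReal_ne_top]
  refine le_of_forall_gt_imp_ge_of_dense fun M hM => ?_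
  rcases eq_or_ne M ∞ with rfl | hM_top
  · exact le_top
  rw [ENNReal.div_le_iff hC' ENNReal.ofReal_ne_top, mul_comm, ← ENNReal.ofReal_toReal hM_top,
    ← ENNReal.ofReal_mul hC.le]
  exact h _ (ENNReal.toReal_pos (pos_of_gt hM).ne' hM_top)
    (hM.le.trans_eq (ENNReal.ofReal_toReal hM_top).symm)

end LocalSize

section Regularity

open Filter Topology NNReal

variable {n : ℕ} {s p A H R : ℝ} {α : ℝ≥0} {Ω : Set (Rn n)} {u : Rn n → ℝ} {x₀ : Rn n}

/-- `u` is bounded by `H` on `B_R(x₀)`, and its precise representative is there Hölder continuous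
with the constant `H / R ^ α`. -/
structure HolderBound (α : ℝ≥0) (H : ℝ) (u : Rn n → ℝ) (x₀ : Rn n) (R : ℝ) : Prop where
  ae_abs_le : ∀ᵐ x ∂(volume.restrict (ball x₀ R)), |u x| ≤ H
  tendsto_essLim : ∀ x ∈ ball x₀ R, Tendsto u (𝓝 x ⊓ ae volume) (𝓝 (essLim volume u x))
  holderOnWith : HolderOnWith (H * R ^ (-α : ℝ)).toNNReal α (essLim volume u) (ball x₀ R)

theorem essLim_ae_eq_of_forall_holderBound (hα : 0 < α) (hΩ : MeasurableSet Ω)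
    (h : ∀ x ∈ Ω, ∃ R H : ℝ, 0 < R ∧ HolderBound α H u x R) :
    essLim volume u =ᵐ[volume.restrict Ω] u := by
  refine essLim_ae_eq hΩ (fun x hx => ?_) fun x hx => ?_ <;> obtain ⟨R, H, hR, hbound⟩ := h x hx
  · exact hbound.tendsto_essLim x (mem_ball_self hR)
  · exact (hbound.holderOnWith.continuousOn hα).continuousAt (ball_mem_nhds x hR)

theorem memHolderLoc_essLim_of_forall_holderBound (hα : 0 < α)
    (h : ∀ x ∈ Ω, ∃ R H : ℝ, 0 < R ∧ HolderBound α H u x R) :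
    MemHolderLoc α (essLim volume u) Ω :=
  memHolderLoc_of_forall_mem_nhds hα fun x hx =>
    let ⟨_, _, hR, hbound⟩ := h x hx
    ⟨_, ball_mem_nhds x hR, _, hbound.holderOnWith⟩

theorem HolderBound.eLpNorm_add_holderSeminorm_le (hR : 0 < R) (hH : 0 ≤ H)
    (h : HolderBound α H u x₀ R) (hu : essLim volume u =ᵐ[volume.restrict (ball x₀ R)] u) :
    eLpNorm (essLim volume u) ∞ (volume.restrict (ball x₀ R)) +
        ENNReal.ofReal (R ^ (α : ℝ)) * holderSeminorm α (essLim volume u) (ball x₀ R) ≤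
      ENNReal.ofReal (2 * H) := by
  rw [two_mul, ENNReal.ofReal_add hH hH]
  refine add_le_add ?_ ?_
  · rw [eLpNorm_congr_ae hu, eLpNorm_exponent_top]
    exact eLpNormEssSup_le_of_ae_bound h.ae_abs_le
  · rw [← ofReal_rpow_mul_ofReal_rpow_neg hR H α]
    exact mul_le_mul' le_rfl (holderSeminorm_le_of_holderOnWith h.holderOnWith)

theorem exists_holderBound (n : ℕ) (hs : 0 < s) (hp : 1 < p) (hA : 0 < A) :
    ∃ (α : ℝ≥0) (C : ℝ), 0 < α ∧ α < 1 ∧ 0 < C ∧ ∀ (F₀ : ℝ) (Ω : Set (Rn n)) (u : Rn n → ℝ),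
      IsTwoSidedDeGiorgi n s p A F₀ Ω u → ∀ (x₀ : Rn n) (R M : ℝ), 0 < R → 0 < M →
      closedBall x₀ (2 * R) ⊆ Ω → localSize n s p F₀ u x₀ R ≤ ENNReal.ofReal M →
      HolderBound α (C * M) u x₀ R := by
  obtain ⟨α, C, hα, hα1, hC, hlocal⟩ := exists_local_estimate n hs hp hA
  lift α to ℝ≥0 using hα.le
  refine ⟨α, 8 * C, mod_cast hα, mod_cast hα1, by positivity, ?_⟩
  intro F₀ Ω u hu x₀ R M hR hM hball hsize
  obtain ⟨hsup, hosc⟩ := hlocal F₀ Ω u hu x₀ R M hR hM hball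
    (sizeBound_of_localSize_le hp hu.force_nonneg hR hM hsize)
  have hdecay (x : Rn n) (hx : x ∈ ball x₀ R) := abs_sub_essLim_le_of_holder_decay hα hR (hosc x hx)
  exact
    { ae_abs_le := hsup.mono fun x hx => hx.trans (by nlinarith [mul_pos hC hM])
      tendsto_essLim := fun x hx => tendsto_of_holder_decay hα hR (hdecay x hx)
      holderOnWith := holderOnWith_of_dist_le (by positivity) hR fun x hx y hy => by
        rw [mul_assoc 8]
        exact dist_essLim_le_of_holder_decay hα hα1.le hR hsup hdecay hx hy }

theorem IsTwoSidedDeGiorgi.exists_regularity (n : ℕ) (hs : 0 < s) (hp : 1 < p) (hA : 0 < A) :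
    ∃ (α : ℝ≥0) (C : ℝ), 0 < α ∧ α < 1 ∧ 0 < C ∧ ∀ (F₀ : ℝ) (Ω : Set (Rn n)) (u : Rn n → ℝ),
      IsOpen Ω → MemWeightedL n s p u → MemW n s p Ω u → IsTwoSidedDeGiorgi n s p A F₀ Ω u →
      essLim volume u =ᵐ[volume.restrict Ω] u ∧ MemHolderLoc α (essLim volume u) Ω ∧
      ∀ (x₀ : Rn n) (R : ℝ), 0 < R → closedBall x₀ (2 * R) ⊆ Ω →
        eLpNorm (essLim volume u) ∞ (volume.restrict (ball x₀ R)) +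
            ENNReal.ofReal (R ^ (α : ℝ)) * holderSeminorm α (essLim volume u) (ball x₀ R) ≤
          ENNReal.ofReal C * localSize n s p F₀ u x₀ R := by
  obtain ⟨α, C, hα, hα1, hC, hbound⟩ := exists_holderBound n hs hp hA
  refine ⟨α, 2 * C, hα, hα1, by positivity, ?_⟩
  intro F₀ Ω u hΩ huL huW hu
  have hlocal (x : Rn n) (hx : x ∈ Ω) : ∃ R H : ℝ, 0 < R ∧ HolderBound α H u x R := by
    obtain ⟨R, M, hR, hM, hball, hsize⟩ := exists_localSize_le (F₀ := F₀) hs.le hp.le hΩ huL huW hx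
    exact ⟨R, C * M, hR, hbound F₀ Ω u hu x R M hR hM hball hsize⟩
  have hae := essLim_ae_eq_of_forall_holderBound hα hΩ.measurableSet hlocal
  refine ⟨hae, memHolderLoc_essLim_of_forall_holderBound hα hlocal, fun x₀ R hR hball => ?_⟩
  have hsub : ball x₀ R ⊆ Ω :=
    ((ball_subset_ball (by linarith)).trans ball_subset_closedBall).trans hball
  refine le_mul_of_forall_le_ofReal (by positivity) fun M hM hsize => ?_
  rw [mul_assoc]
  exact (hbound F₀ Ω u hu x₀ R M hR hM hball hsize).eLpNorm_add_holderSeminorm_le hR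
    (by positivity) (ae_restrict_of_ae_restrict_of_subset hsub hae)

end Regularity

end NonlocalEnergy

theorem corollary3p3 (n : ℕ) (hn : 1 ≤ n) (s p Λ : ℝ) (hs : s ∈ Set.Ioo (0 : ℝ) 1) (hp : 1 < p)
    (hΛ : 1 ≤ Λ) :
    ∃ α ∈ Set.Ioo (0 : ℝ) 1, ∃ C : ℝ, 1 ≤ C ∧
      ∀ (Ω : Set (Rn n)) (K : Rn n → Rn n → ℝ) (F : Rn n → ℝ → ℝ) (F₀ : ℝ) (u : Rn n → ℝ),
        IsOpen Ω → Bornology.IsBounded Ω →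
        NonlocalEnergy.IsAdmissibleKernel n s p Λ K →
        NonlocalEnergy.SuperpositionMeasurable Ω F →
        0 ≤ F₀ → (∀ᵐ x ∂(volume.restrict Ω), ∀ t : ℝ, |F x t| ≤ F₀) →
        NonlocalEnergy.MemWeightedL n s p u →
        NonlocalEnergy.IsMinimizer s p K F Ω u →
        -- `v` is the Hölder continuous representative of `u` in `Ω`
        ∃ v : Rn n → ℝ, v =ᵐ[volume.restrict Ω] u ∧
          NonlocalEnergy.MemHolderLoc α v Ω ∧
          ∀ x₀ ∈ Ω, ∀ R : ℝ, 0 < R → R < Metric.infDist x₀ (frontier Ω) / 2 →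
            eLpNorm v ∞ (volume.restrict (Metric.ball x₀ R)) +
                ENNReal.ofReal (R ^ α) * NonlocalEnergy.holderSeminorm α v (Metric.ball x₀ R) ≤
              ENNReal.ofReal C *
                (eLpNorm u (ENNReal.ofReal p) (volume.restrict (Metric.ball x₀ (2 * R))) /
                    ENNReal.ofReal (R ^ ((n : ℝ) / p)) +
                  NonlocalEnergy.tail n s p u x₀ R +
                  ENNReal.ofReal (R ^ s * F₀ ^ (1 / p))) := by
  open NonlocalEnergy in
  have hp₀ : 0 < p := by linarith
  have hΛ₀ : 0 < Λ := by linarith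
  obtain ⟨α, C, hα, hα1, -, hreg⟩ := IsTwoSidedDeGiorgi.exists_regularity n hs.1 hp
    (caccioppoliConst_pos (n := n) hs.2 hp₀ hΛ₀)
  refine ⟨α, ⟨mod_cast hα, mod_cast hα1⟩, max 1 C, le_max_left _ _, ?_⟩
  intro Ω K F F₀ u hΩ hΩb hK hF hF₀ hFb huL hmin
  obtain ⟨w, hw, huw⟩ : ∃ w, Measurable w ∧ u =ᵐ[volume] w :=
    ⟨huL.1.mk u, huL.1.measurable_mk, huL.1.ae_eq_mk⟩
  have hminw : IsMinimizer s p K F Ω w := hmin.congr huw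
  have hw_deGiorgi := hminw.isTwoSidedDeGiorgi (by lia) hs hp hΛ₀ hΩb.measure_lt_top.ne
    hK hF hF₀ hFb hw
  obtain ⟨hae, hloc, hest⟩ := hreg F₀ Ω w hΩ (huL.congr huw) hminw.1 hw_deGiorgi
  refine ⟨essLim volume w, hae.trans (ae_restrict_of_ae huw.symm), hloc,
    fun x₀ hx₀ R hR hRd => ?_⟩
  have hball : Metric.closedBall x₀ (2 * R) ⊆ Ω :=
    closedBall_subset_of_lt_infDist_frontier hΩ hx₀ (by positivity) (by linarith)
  refine (hest x₀ R hR hball).trans ?_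
  rw [localSize, ← tail_congr huw, ← eLpNorm_congr_ae (ae_restrict_of_ae huw)]
  exact mul_le_mul' (ENNReal.ofReal_le_ofReal (le_max_right _ _)) le_rfl
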